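/- **Theorem V.** Let $n\ge 2$, let $Q\in\mathcal D'(\mathbb R^n)$ be a complex-valued distribution and let $0<p<1$. Consider the multiplicative inequality $$|\langle Qu,u\rangle|\le C\,\|\nabla u\|_{L^2(\mathbb R^n)}^{2p}\,\|u\|_{L^2(\mathbb R^n)}^{2(1-p)}\qquad\text{for all } u\in C_0^\infty(\mathbb R^n), \tag{1}$$ where $\langle Qu,u\rangle=\langle Q,|u|^2\rangle$, $u$ is complex-valued, and $C$ does not depend on $u$. For a vector field $\vec\Gamma\in L^2_{\rm loc}(\mathbb R^n)^n$ with values in $\mathbb C^n$ consider the condition $(\ast)_p$ * if $p=\tfrac12$: $\vec\Gamma\in\mathrm{BMO}(\mathbb R^n)$, i.e. $\sup_{x_0,\,\delta>0}\frac1{|B_\delta(x_0)|}\int_{B_\delta(x_0)}|\vec\Gamma-m_{B_\delta(x_0)}(\vec\Gamma)|\,dx<\infty$, where $m_B(\vec\Gamma)$ is the mean of $\vec\Gamma$ over $B$; * if $0<p<\tfrac12$: $\vec\Gamma\in\mathrm{Lip}_{1-2p}(\mathbb R^n)$, i.e. $|\vec\Gamma(x)-\vec\Gamma(x')|\le c\,|x-x'|^{1-2p}$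 for all $x,x'\in\mathbb R^n$; * if $\tfrac12<p<1$: $\vec\Gamma$ is in the Morrey space given by $\int_{B_\delta(x_0)}|\vec\Gamma|^2\,dx\le c\,\delta^{\,n+2-4p}$ with $c$ independent of $x_0\in\mathbb R^n$ and $\delta>0$. The operator $\nabla\Delta^{-1}$ is convolution with $\frac{x}{n|B_1(0)|\,|x|^n}$, the gradient of the fundamental solution of $\Delta$. We write $\vec\Gamma=\nabla\Delta^{-1}Q$ if, for every $\chi\in C_0^\infty(\mathbb R^n)$ with $\chi=1$ near $0$, $\nabla\Delta^{-1}(\chi(\cdot/R)\,Q)\to\vec\Gamma$ as $R\to\infty$ in $\mathcal D'(\mathbb R^n)^n$; and $\vec\Gamma=\nabla\Delta^{-1}Q$ modulo constants if this convergence holds modulo constant vector fields, i.e. when tested against test functions of integral zero. (i) Inequality (1) holds for some $C$ if and only if there is $\vec\Gamma\in L^2_{\rm loc}(\mathbb R^n)^n$ with $\vec\Gamma=\nabla\Delta^{-1}Q$ (modulo constants if $p\le\tfrac12$, exactly if $p>\tfrac12$) such that $Q=\operatorname{div}\vec\Gamma$ in $\mathcal D'(\mathbb R^n)$ and $\vec\Gamma$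 satisfies $(\ast)_p$. (ii) More generally, if $Q=\operatorname{div}\vec\Gamma$ in $\mathcal D'(\mathbb R^n)$ for any $\vec\Gamma\in L^2_{\rm loc}(\mathbb R^n)^n$ satisfying $(\ast)_p$, then (1) holds for some $C$. -/

import Mathlib

open MeasureTheory Filter Topology TopologicalSpace Metric
open scoped Distributions ContDiff Convolution

/-- Euclidean space `ℝⁿ`. -/
abbrev Rn (n : ℕ) := EuclideanSpace ℝ (Fin n)

/-- Test functions on `ℝⁿ`: smooth, compactly supported, with values in `F`. -/
abbrev Test (n : ℕ) (F : Type) [NormedAddCommGroup F] [NormedSpace ℝ F] :=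
  𝓓((⊤ : Opens (Rn n)), F)

/-- Complex-valued distributions on `ℝⁿ`. -/
abbrev Distr (n : ℕ) := 𝓓'((⊤ : Opens (Rn n)), ℂ)

noncomputable section

/-- The `i`-th standard basis vector of `ℝⁿ`. -/
def stdVec {n : ℕ} (i : Fin n) : Rn n := EuclideanSpace.single i 1

/-- The test function `|u|²`. -/
def normSqTest {n : ℕ} (u : Test n ℂ) : Test n ℝ where
  toFun x := ‖u x‖ ^ 2
  contDiff' := u.contDiff.norm_sq ℝ
  hasCompactSupport' := u.hasCompactSupport.comp_left (g := fun z : ℂ => ‖z‖ ^ 2) (by simp)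
  tsupport_subset' := fun _ _ => trivial

/-- The quadratic form `⟨Qu, u⟩ = ⟨Q, |u|²⟩`. -/
def quadForm {n : ℕ} (Q : Distr n) (u : Test n ℂ) : ℂ := Q (normSqTest u)

/-- The gradient of a complex-valued function, as a vector field with values in `ℂⁿ`. -/
def cgrad {n : ℕ} (u : Rn n → ℂ) (x : Rn n) : EuclideanSpace ℂ (Fin n) :=
  WithLp.toLp 2 fun i => fderiv ℝ u x (stdVec i)

/-- The norm of `L²(ℝⁿ)`; it is only applied to continuous compactly supported functions. -/
def l2norm {n : ℕ} {F : Type} [NormedAddCommGroup F] (f : Rn n → F) : ℝ :=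
  √(∫ x, ‖f x‖ ^ 2)

/-- The multiplicative inequality
`|⟨Qu, u⟩| ≤ C ‖∇u‖^(2p) ‖u‖^(2(1-p))` for all test functions `u`. -/
def MultIneq {n : ℕ} (p : ℝ) (Q : Distr n) : Prop :=
  ∃ C : ℝ, ∀ u : Test n ℂ,
    ‖quadForm Q u‖ ≤ C * l2norm (cgrad u) ^ (2 * p) * l2norm u ^ (2 * (1 - p))

/-- `Γ ∈ L²_loc(ℝⁿ)ⁿ`. -/
def IsL2Loc {n : ℕ} (Γ : Rn n → EuclideanSpace ℂ (Fin n)) : Prop :=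
  ∀ K : Set (Rn n), IsCompact K → MemLp Γ 2 (volume.restrict K)

/-- `Q = div Γ` in the sense of distributions. -/
def IsDiv {n : ℕ} (Q : Distr n) (Γ : Rn n → EuclideanSpace ℂ (Fin n)) : Prop :=
  ∀ φ : Test n ℝ, Q φ = -∫ x, ∑ i, Γ x i * (fderiv ℝ φ x (stdVec i) : ℂ)

/-- The `i`-th partial derivative of the fundamental solution of `Δ` on `ℝⁿ`, `n ≥ 2`:
`x_i / (σ |x|ⁿ)`, where `σ = n |B₁(0)|` is the area of the unit sphere. -/
def gradKernel {n : ℕ} (i : Fin n) (x : Rn n) : ℝ :=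
  x i / (n * volume.real (ball (0 : Rn n) 1) * ‖x‖ ^ n)

theorem gradKernel_locallyIntegrable {n : ℕ} (i : Fin n) :
    LocallyIntegrable (gradKernel i) (volume : Measure (Rn n)) := by
  have hn : 1 ≤ n := Nat.one_le_of_lt i.isLt
  have hf : Module.finrank ℝ (Rn n) = n := by simp
  refine locallyIntegrable_of_norm_le_rpow (C := (n * volume.real (ball (0 : Rn n) 1))⁻¹)
    (α := (n : ℝ) - 1) (by rw [hf]; exact hn) (by rw [hf]; linarith) ?_ ?_
  · refine Eventually.of_forall fun x => ?_
    rcases eq_or_ne x 0 with rfl | hx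
    · simp only [gradKernel, PiLp.zero_apply, zero_div, norm_zero]
      positivity
    · have hx' : 0 < ‖x‖ := norm_pos_iff.2 hx
      have h1 : ‖x‖ ^ (-((n : ℝ) - 1)) = ‖x‖ / ‖x‖ ^ n := by
        rw [neg_sub, Real.rpow_sub hx', Real.rpow_one, Real.rpow_natCast]
      have h2 : ‖x i‖ ≤ ‖x‖ := PiLp.norm_apply_le x i
      have h0 : 0 ≤ volume.real (ball (0 : Rn n) 1) := measureReal_nonneg
      rw [h1, gradKernel, norm_div, norm_mul, norm_mul, norm_pow, norm_norm, Real.norm_natCast,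
        Real.norm_of_nonneg h0, div_eq_mul_inv, mul_inv, div_eq_mul_inv, ← mul_assoc]
      rw [mul_comm ‖x i‖, mul_assoc]
      gcongr
  · unfold gradKernel
    exact Measurable.aestronglyMeasurable (by fun_prop)

/-- `∂_i Δ⁻¹ φ` for a test function `φ`: convolution with the `i`-th partial derivative of the
fundamental solution. -/
def gradInvLapTest {n : ℕ} (i : Fin n) (φ : Test n ℝ) : Rn n → ℝ :=
  gradKernel i ⋆[ContinuousLinearMap.mul ℝ ℝ, volume] φ

/-- The test function `χ(x / R) ∂_i Δ⁻¹ φ(x)`. -/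
def cutGradInvLapTest {n : ℕ} (χ : Test n ℝ) (R : Set.Ioi (0 : ℝ)) (i : Fin n) (φ : Test n ℝ) :
    Test n ℝ where
  toFun x := χ ((R : ℝ)⁻¹ • x) * gradInvLapTest i φ x
  contDiff' := (χ.contDiff.comp (contDiff_id.const_smul _)).mul
    (φ.hasCompactSupport.contDiff_convolution_right _ (gradKernel_locallyIntegrable i) φ.contDiff)
  hasCompactSupport' :=
    (χ.hasCompactSupport.comp_smul (inv_ne_zero (ne_of_gt R.2))).mul_right
  tsupport_subset' := fun _ _ => trivial

/-- The pairing `⟨∂_i Δ⁻¹(χ_R Q), φ⟩`, where `χ_R(x) = χ(x / R)`. The distribution `χ_R Q` has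
compact support, and its convolution with the odd kernel of `∂_i Δ⁻¹` acts on `φ` as
`-⟨χ_R Q, ∂_i Δ⁻¹ φ⟩`. -/
def truncPairing {n : ℕ} (Q : Distr n) (χ : Test n ℝ) (R : Set.Ioi (0 : ℝ)) (i : Fin n)
    (φ : Test n ℝ) : ℂ :=
  -Q (cutGradInvLapTest χ R i φ)

/-- `Γ = ∇Δ⁻¹Q`: for every smooth compactly supported `χ` that is `1` near the origin,
`∇Δ⁻¹(χ(·/R) Q) → Γ` in the sense of distributions as `R → ∞`. -/
def IsGradInvLap {n : ℕ} (Q : Distr n) (Γ : Rn n → EuclideanSpace ℂ (Fin n)) : Prop :=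
  ∀ χ : Test n ℝ, (∀ᶠ x in 𝓝 0, χ x = 1) → ∀ (i : Fin n) (φ : Test n ℝ),
    Tendsto (fun R => truncPairing Q χ R i φ) atTop (𝓝 (∫ x, Γ x i * (φ x : ℂ)))

/-- `Γ = ∇Δ⁻¹Q` modulo constant vector fields: the same convergence, in the quotient of the space
of distributions by the constants, that is, against test functions of integral zero. -/
def IsGradInvLapModConst {n : ℕ} (Q : Distr n) (Γ : Rn n → EuclideanSpace ℂ (Fin n)) : Prop :=
  ∀ χ : Test n ℝ, (∀ᶠ x in 𝓝 0, χ x = 1) → ∀ (i : Fin n) (φ : Test n ℝ), ∫ x, φ x = 0 →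
    Tendsto (fun R => truncPairing Q χ R i φ) atTop (𝓝 (∫ x, Γ x i * (φ x : ℂ)))

/-- `Γ ∈ BMO(ℝⁿ)`. -/
def IsBMO {n : ℕ} (Γ : Rn n → EuclideanSpace ℂ (Fin n)) : Prop :=
  LocallyIntegrable Γ volume ∧ ∃ C : ℝ, ∀ (x₀ : Rn n) (δ : ℝ), 0 < δ →
    ⨍ x in ball x₀ δ, ‖Γ x - ⨍ y in ball x₀ δ, Γ y‖ ≤ C

/-- `Γ` lies in the homogeneous Lipschitz (Hölder) space of order `α`. -/
def IsLip {n : ℕ} (α : ℝ) (Γ : Rn n → EuclideanSpace ℂ (Fin n)) : Prop :=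
  ∃ C : ℝ, ∀ x y : Rn n, ‖Γ x - Γ y‖ ≤ C * ‖x - y‖ ^ α

/-- The Morrey condition `∫_{B_δ(x₀)} |Γ|² ≤ C δ^s` for all balls; it is only applied to `Γ` in
`L²_loc`. -/
def IsMorrey {n : ℕ} (s : ℝ) (Γ : Rn n → EuclideanSpace ℂ (Fin n)) : Prop :=
  ∃ C : ℝ, ∀ (x₀ : Rn n) (δ : ℝ), 0 < δ → ∫ x in ball x₀ δ, ‖Γ x‖ ^ 2 ≤ C * δ ^ s

/-- The condition on `Γ` that corresponds to the exponent `p`. -/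
def SpaceCond {n : ℕ} (p : ℝ) (Γ : Rn n → EuclideanSpace ℂ (Fin n)) : Prop :=
  (p = 1 / 2 → IsBMO Γ) ∧
  (p < 1 / 2 → IsLip (1 - 2 * p) Γ) ∧
  (1 / 2 < p → IsMorrey ((n : ℝ) + 2 - 4 * p) Γ)

end

/-! ### Calculus of real test functions. -/

noncomputable section

/-! The multiplicative inequality is equivalent, by optimising in a free scale, to the additive
family |Q(v²)| ≤ C t^(-2p) (t² ‖∇v‖² + ‖v‖²) for all real test functions v and all t > 0
(`FormBound`). Everything else is done with this form, whose right side is a quadratic energy.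

Sufficiency. If Q = div Γ, then Q(v²) = -∑ ∫ Γ_i ∂_i(v²). For p > 1/2, ∂_i(v²) = 2 v ∂_i v reduces
the bound to ∫ |Γ|² v², which the trace inequality `trace_inequality` controls as soon as |Γ|² has
the Morrey growth on balls. For p ≤ 1/2 put α = 1 - 2p. The condition on Γ says that its L²
oscillation on balls of radius r is of order r^(n + 2α): this is immediate for Hölder fields, and
for BMO it is the L² John–Nirenberg inequality `johnNirenberg_sq`. Split each component as g = G +
(g - G) with G its mollification at scale t. The derivative of G is O(t^(α-1)), so G is handled by
integrating by parts; the square of g - G satisfies a growth condition on balls of radius at most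
3t, so the trace inequality handles it (`scalarFormBound_of_campanato`).

Necessity. Polarising the form bound against a cutoff shows that Q is bounded on functions f
supported in a ball of radius r by C r^(n/2 - 2p) times the root of the energy of f
(`exists_localBound`). For a test function φ supported in such a ball, the potential v = ∂_i Δ⁻¹ φ
decays like |x|^(1-n), and one order faster if ∫ φ = 0. The dyadic pieces of v therefore contribute
a geometric series: for p > 1/2 without a condition on φ, and for every p > 0 when ∫ φ = 0. This
gives the limit of the truncated pairings (`LocalBound.exists_limit`). The part of v near the ball
is controlled by Caccioppoli's inequality, and altogether the limit is at most C r^(n/2 + 1 - 2p)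
‖φ‖_{L²} (`LocalBound.exists_isPairing`).

Riesz representation turns these limits into a field in L²_loc. By duality the last bound is the
Morrey condition when it holds for all φ, and a Campanato condition with α = 1 - 2p when it holds
for mean-zero φ; the latter gives BMO for p = 1/2 and Hölder continuity for p < 1/2
(`exists_holder_of_campanato`). Finally Q = div Γ because ∑ ∂_i Δ⁻¹ ∂_i φ = φ and each ∂_i φ has
integral zero, so that its pairing exists for every p. -/

/-- The `i`-th partial derivative. -/
def pd {n : ℕ} (i : Fin n) (f : Rn n → ℝ) (x : Rn n) : ℝ := fderiv ℝ f x (stdVec i)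

/-- The squared length of the gradient. -/
def gradSq {n : ℕ} (f : Rn n → ℝ) (x : Rn n) : ℝ := ∑ i, pd i f x ^ 2

/-- Unbundled real test functions. -/
def IsTest {n : ℕ} (f : Rn n → ℝ) : Prop := ContDiff ℝ ∞ f ∧ HasCompactSupport f

/-- Bundle a smooth compactly supported function. -/
def mkTest {n : ℕ} (f : Rn n → ℝ) (hf : IsTest f) : Test n ℝ where
  toFun := f
  contDiff' := hf.1
  hasCompactSupport' := hf.2
  tsupport_subset' := fun _ _ => trivial

theorem isTest_coe {n : ℕ} (φ : Test n ℝ) : IsTest (φ : Rn n → ℝ) :=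
  ⟨φ.contDiff, φ.hasCompactSupport⟩

namespace IsTest

variable {n : ℕ} {f g : Rn n → ℝ}

theorem continuous (hf : IsTest f) : Continuous f := hf.1.continuous

theorem differentiable (hf : IsTest f) : Differentiable ℝ f := hf.1.differentiable (by simp)

theorem integrable (hf : IsTest f) : Integrable f := hf.continuous.integrable_of_hasCompactSupport hf.2

theorem mul_right (hf : IsTest f) (hg : ContDiff ℝ ∞ g) : IsTest (fun x => f x * g x) :=
  ⟨hf.1.mul hg, hf.2.mul_right⟩

theorem mul_left (hf : ContDiff ℝ ∞ f) (hg : IsTest g) : IsTest (fun x => f x * g x) :=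
  ⟨hf.mul hg.1, hg.2.mul_left⟩

theorem add (hf : IsTest f) (hg : IsTest g) : IsTest (fun x => f x + g x) :=
  ⟨hf.1.add hg.1, hf.2.add hg.2⟩

theorem sub (hf : IsTest f) (hg : IsTest g) : IsTest (fun x => f x - g x) :=
  ⟨hf.1.sub hg.1, hf.2.sub hg.2⟩

theorem const_mul (c : ℝ) (hf : IsTest f) : IsTest (fun x => c * f x) :=
  mul_left contDiff_const hf

theorem sq (hf : IsTest f) : IsTest (fun x => f x ^ 2) := by
  simpa only [pow_two] using hf.mul_right hf.1

theorem zero : IsTest (fun _ : Rn n => (0 : ℝ)) := ⟨contDiff_const, HasCompactSupport.zero⟩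

theorem fderiv_apply (hf : IsTest f) (v : Rn n) : IsTest (fun x => fderiv ℝ f x v) := by
  refine ⟨(hf.1.fderiv_right (m := ∞) (by simp)).clm_apply contDiff_const, ?_⟩
  exact (hf.2.fderiv (𝕜 := ℝ)).comp_left (g := fun L : Rn n →L[ℝ] ℝ => L v) (by simp)

theorem pd (hf : IsTest f) (i : Fin n) : IsTest (pd i f) := hf.fderiv_apply _

theorem gradSq (hf : IsTest f) : IsTest (gradSq f) := by
  have h : ∀ s : Finset (Fin n), IsTest (fun x => ∑ i ∈ s, _root_.pd i f x ^ 2) := by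
    intro s
    classical
    induction s using Finset.induction_on with
    | empty => simpa using IsTest.zero
    | insert a s ha ih =>
      simp only [Finset.sum_insert ha]
      exact ((hf.pd a).sq).add ih
  exact h _

theorem comp_smul_sub (hf : IsTest f) {c : ℝ} (hc : c ≠ 0) (a : Rn n) :
    IsTest (fun x => f (c • (x - a))) := by
  refine ⟨hf.1.comp ((contDiff_id.sub contDiff_const).const_smul c), ?_⟩
  have h := (hf.2.comp_smul hc)
  exact h.comp_homeomorph (Homeomorph.subRight a)

end IsTest

theorem contDiff_pd {n : ℕ} {f : Rn n → ℝ} (hf : ContDiff ℝ ∞ f) (i : Fin n) :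
    ContDiff ℝ ∞ (pd i f) :=
  (hf.fderiv_right (m := ∞) (by simp)).clm_apply contDiff_const

theorem norm_stdVec {n : ℕ} (i : Fin n) : ‖(stdVec i : Rn n)‖ = 1 := by simp [stdVec]

theorem abs_pd_le {n : ℕ} (i : Fin n) (f : Rn n → ℝ) (x : Rn n) : |pd i f x| ≤ ‖fderiv ℝ f x‖ := by
  have := (fderiv ℝ f x).le_opNorm (stdVec i)
  rwa [norm_stdVec, mul_one] at this

theorem gradSq_nonneg {n : ℕ} (f : Rn n → ℝ) (x : Rn n) : 0 ≤ gradSq f x :=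
  Finset.sum_nonneg fun _ _ => sq_nonneg _

theorem pd_sq_le_gradSq {n : ℕ} (i : Fin n) (f : Rn n → ℝ) (x : Rn n) :
    pd i f x ^ 2 ≤ gradSq f x :=
  Finset.single_le_sum (f := fun i => pd i f x ^ 2) (fun _ _ => sq_nonneg _) (Finset.mem_univ i)

theorem gradSq_le {n : ℕ} (f : Rn n → ℝ) (x : Rn n) : gradSq f x ≤ n * ‖fderiv ℝ f x‖ ^ 2 := by
  have : gradSq f x ≤ ∑ _i : Fin n, ‖fderiv ℝ f x‖ ^ 2 := by
    refine Finset.sum_le_sum fun i _ => ?_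
    rw [← sq_abs]
    exact pow_le_pow_left₀ (abs_nonneg _) (abs_pd_le i f x) 2
  simpa using this

theorem pd_mul {n : ℕ} (i : Fin n) {f g : Rn n → ℝ} {x : Rn n} (hf : DifferentiableAt ℝ f x)
    (hg : DifferentiableAt ℝ g x) :
    pd i (fun y => f y * g y) x = f x * pd i g x + pd i f x * g x := by
  unfold pd
  rw [fderiv_fun_mul hf hg]
  simp [mul_comm]

theorem pd_sq {n : ℕ} (i : Fin n) {f : Rn n → ℝ} {x : Rn n} (hf : DifferentiableAt ℝ f x) :
    pd i (fun y => f y ^ 2) x = 2 * (f x * pd i f x) := by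
  simp only [pow_two]
  rw [pd_mul i hf hf]
  ring

theorem pd_add {n : ℕ} (i : Fin n) {f g : Rn n → ℝ} {x : Rn n} (hf : DifferentiableAt ℝ f x)
    (hg : DifferentiableAt ℝ g x) :
    pd i (fun y => f y + g y) x = pd i f x + pd i g x := by
  unfold pd
  rw [fderiv_fun_add hf hg]
  simp

theorem pd_sub {n : ℕ} (i : Fin n) {f g : Rn n → ℝ} {x : Rn n} (hf : DifferentiableAt ℝ f x)
    (hg : DifferentiableAt ℝ g x) :
    pd i (fun y => f y - g y) x = pd i f x - pd i g x := by
  unfold pd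
  rw [fderiv_fun_sub hf hg]
  simp

theorem pd_const_mul {n : ℕ} (i : Fin n) (c : ℝ) {f : Rn n → ℝ} {x : Rn n}
    (hf : DifferentiableAt ℝ f x) :
    pd i (fun y => c * f y) x = c * pd i f x := by
  unfold pd
  rw [fderiv_const_mul hf]
  simp

/-! ### Energies, and the passage between the multiplicative and the additive inequality. -/

/-- The scale-invariant quadratic energy `t² ‖∇v‖² + ‖v‖²`. -/
def energy {n : ℕ} (t : ℝ) (v : Rn n → ℝ) : ℝ := t ^ 2 * (∫ x, gradSq v x) + ∫ x, v x ^ 2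

theorem energy_nonneg {n : ℕ} (t : ℝ) (v : Rn n → ℝ) : 0 ≤ energy t v :=
  add_nonneg (mul_nonneg (sq_nonneg _) (integral_nonneg fun _ => gradSq_nonneg _ _))
    (integral_nonneg fun _ => sq_nonneg _)

/-- The additive form, on real test functions and with a free scale `t`, of the multiplicative
inequality. -/
def FormBound {n : ℕ} (p : ℝ) (Q : Distr n) : Prop :=
  ∃ C : ℝ, 0 ≤ C ∧ ∀ (v : Rn n → ℝ) (hv : IsTest v) (t : ℝ), 0 < t →
    ‖Q (mkTest (fun x => v x ^ 2) hv.sq)‖ ≤ C * t ^ (-2 * p) * energy t v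

/-- Weighted AM–GM for t²X² and Y² with weights p and 1 - p; the weights are then bounded by one. -/
theorem rpow_mul_rpow_le_scaled {p : ℝ} (hp0 : 0 < p) (hp1 : p < 1) {X Y t : ℝ} (hX : 0 ≤ X)
    (hY : 0 ≤ Y) (ht : 0 < t) :
    X ^ (2 * p) * Y ^ (2 * (1 - p)) ≤ t ^ (-2 * p) * (t ^ 2 * X ^ 2 + Y ^ 2) := by
  have h := Real.geom_mean_le_arith_mean2_weighted hp0.le (by linarith : 0 ≤ 1 - p)
    (mul_nonneg (sq_nonneg t) (sq_nonneg X)) (sq_nonneg Y) (by ring)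
  have h1 : (t ^ 2 * X ^ 2) ^ p = t ^ (2 * p) * X ^ (2 * p) := by
    rw [Real.mul_rpow (sq_nonneg _) (sq_nonneg _), ← Real.rpow_natCast, ← Real.rpow_natCast,
      ← Real.rpow_mul ht.le, ← Real.rpow_mul hX]
    norm_num
  have h2 : (Y ^ 2) ^ (1 - p) = Y ^ (2 * (1 - p)) := by
    rw [← Real.rpow_natCast, ← Real.rpow_mul hY]
    norm_num
  rw [h1, h2] at h
  have h3 : t ^ (-2 * p) * t ^ (2 * p) = 1 := by
    rw [← Real.rpow_add ht]; simp
  have h4 : 0 < t ^ (-2 * p) := Real.rpow_pos_of_pos ht _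
  calc X ^ (2 * p) * Y ^ (2 * (1 - p))
      = t ^ (-2 * p) * (t ^ (2 * p) * X ^ (2 * p) * Y ^ (2 * (1 - p))) := by
        rw [mul_assoc (t ^ (2 * p)), ← mul_assoc, h3, one_mul]
    _ ≤ _ := by
        gcongr
        refine h.trans ?_
        nlinarith [mul_nonneg (sq_nonneg t) (sq_nonneg X), sq_nonneg Y]

/-- At t = Y / X the two summands coincide, whence the factor 2. In the degenerate cases the right
side is zero, which is reached by t → ∞ if X = 0 and by t → 0 if Y = 0. -/
theorem le_rpow_mul_rpow_of_forall_scaled {p : ℝ} (hp0 : 0 < p) (hp1 : p < 1) {A C X Y : ℝ}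
    (hX : 0 ≤ X) (hY : 0 ≤ Y) (h : ∀ t : ℝ, 0 < t → A ≤ C * t ^ (-2 * p) * (t ^ 2 * X ^ 2 + Y ^ 2)) :
    A ≤ 2 * C * X ^ (2 * p) * Y ^ (2 * (1 - p)) := by
  rcases hX.eq_or_lt with rfl | hX
  · rw [Real.zero_rpow (by positivity)]
    have h1 : Tendsto (fun t : ℝ => C * t ^ (-(2 * p)) * Y ^ 2) atTop (𝓝 (C * 0 * Y ^ 2)) :=
      ((tendsto_rpow_neg_atTop (by positivity : 0 < 2 * p)).const_mul C).mul_const _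
    have h2 : A ≤ C * 0 * Y ^ 2 := by
      refine ge_of_tendsto h1 ?_
      filter_upwards [eventually_gt_atTop 0] with t ht
      simpa using h t ht
    simpa using h2
  rcases hY.eq_or_lt with rfl | hY
  · rw [Real.zero_rpow (by linarith : 2 * (1 - p) ≠ 0)]
    have h1 : Tendsto (fun t : ℝ => C * t ^ (2 - 2 * p) * X ^ 2) (𝓝[>] 0)
        (𝓝 (C * 0 * X ^ 2)) := by
      have : Tendsto (fun t : ℝ => t ^ (2 - 2 * p)) (𝓝[>] 0) (𝓝 0) := by
        have h0 := (Real.continuousAt_rpow_const 0 (2 - 2 * p) (Or.inr (by linarith))).tendsto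
        rw [Real.zero_rpow (by linarith)] at h0
        exact h0.mono_left nhdsWithin_le_nhds
      exact (this.const_mul C).mul_const _
    have h2 : A ≤ C * 0 * X ^ 2 := by
      refine ge_of_tendsto h1 ?_
      filter_upwards [self_mem_nhdsWithin] with t ht
      have ht : 0 < t := ht
      have := h t ht
      have e : t ^ (2 - 2 * p) = t ^ (-2 * p) * t ^ 2 := by
        rw [← Real.rpow_natCast, ← Real.rpow_add ht]; congr 1; push_cast; ring
      rw [e]
      calc A ≤ _ := this
        _ = _ := by ring
    simpa using h2
  · have := h (Y / X) (by positivity)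
    refine this.trans_eq ?_
    have e1 : (Y / X) ^ 2 * X ^ 2 = Y ^ 2 := by field_simp
    have e2 : (Y / X) ^ (-2 * p) = X ^ (2 * p) * Y ^ (-2 * p) := by
      rw [Real.div_rpow hY.le hX.le, show (-2 * p) = -(2 * p) by ring, Real.rpow_neg hX.le,
        div_inv_eq_mul, mul_comm]
    have e3 : Y ^ (2 * (1 - p)) = Y ^ (-2 * p) * Y ^ 2 := by
      rw [← Real.rpow_natCast, ← Real.rpow_add hY]; congr 1; push_cast; ring
    rw [e1, e2, e3]
    ring

theorem l2norm_sq {n : ℕ} {F : Type} [NormedAddCommGroup F] (f : Rn n → F) :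
    l2norm f ^ 2 = ∫ x, ‖f x‖ ^ 2 :=
  Real.sq_sqrt (integral_nonneg fun _ => sq_nonneg _)

theorem l2norm_nonneg {n : ℕ} {F : Type} [NormedAddCommGroup F] (f : Rn n → F) : 0 ≤ l2norm f :=
  Real.sqrt_nonneg _

theorem formBound_of_multIneq {n : ℕ} {p : ℝ} (hp0 : 0 < p) (hp1 : p < 1) {Q : Distr n}
    (h : MultIneq p Q) : FormBound p Q := by
  obtain ⟨C, hC⟩ := h
  refine ⟨|C|, abs_nonneg _, fun v hv t ht => ?_⟩
  let u : Test n ℂ :=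
    { toFun := fun x => (v x : ℂ)
      contDiff' := Complex.ofRealCLM.contDiff.comp hv.1
      hasCompactSupport' := hv.2.comp_left (g := fun r : ℝ => (r : ℂ)) (by simp)
      tsupport_subset' := fun _ _ => trivial }
  have hu : ∀ x, u x = (v x : ℂ) := fun _ => rfl
  have e1 : normSqTest u = mkTest (fun x => v x ^ 2) hv.sq := by
    ext x
    change ‖u x‖ ^ 2 = v x ^ 2
    rw [hu]; simp
  have hfd : ∀ x i, fderiv ℝ u x (stdVec i) = (pd i v x : ℂ) := by
    intro x i
    have : HasFDerivAt u (Complex.ofRealCLM.comp (fderiv ℝ v x)) x :=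
      Complex.ofRealCLM.hasFDerivAt.comp x (hv.differentiable x).hasFDerivAt
    rw [this.fderiv]; rfl
  have e2 : l2norm (cgrad u) ^ 2 = ∫ x, gradSq v x := by
    rw [l2norm_sq]
    congr 1; ext x
    rw [EuclideanSpace.norm_sq_eq]
    simp [cgrad, hfd, gradSq]
  have e3 : l2norm u ^ 2 = ∫ x, v x ^ 2 := by
    rw [l2norm_sq]
    congr 1; ext x
    rw [hu]; simp
  have h1 := hC u
  rw [quadForm, e1] at h1
  refine h1.trans ?_
  rw [energy, ← e2, ← e3, mul_assoc, mul_assoc]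
  have h2 := rpow_mul_rpow_le_scaled hp0 hp1 (l2norm_nonneg (cgrad u)) (l2norm_nonneg u) ht
  exact mul_le_mul (le_abs_self C) h2 (mul_nonneg (Real.rpow_nonneg (l2norm_nonneg _) _)
    (Real.rpow_nonneg (l2norm_nonneg _) _)) (abs_nonneg _)

/-- |u|² and both L² norms squared split additively into real and imaginary parts. The additive
bound respects this splitting at each fixed t, so the optimisation in t comes only after adding up.
-/
theorem multIneq_of_formBound {n : ℕ} {p : ℝ} (hp0 : 0 < p) (hp1 : p < 1) {Q : Distr n}
    (h : FormBound p Q) : MultIneq p Q := by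
  obtain ⟨C, -, hC⟩ := h
  refine ⟨2 * C, fun u => ?_⟩
  have hre : IsTest (fun x => (u x).re) :=
    ⟨Complex.reCLM.contDiff.comp u.contDiff, u.hasCompactSupport.comp_left (g := Complex.re) rfl⟩
  have him : IsTest (fun x => (u x).im) :=
    ⟨Complex.imCLM.contDiff.comp u.contDiff, u.hasCompactSupport.comp_left (g := Complex.im) rfl⟩
  have hu : ∀ x, DifferentiableAt ℝ u x := fun x => u.contDiff.differentiable (by simp) x
  have e1 : normSqTest u = mkTest _ hre.sq + mkTest _ him.sq := by
    ext x
    change ‖u x‖ ^ 2 = (u x).re ^ 2 + (u x).im ^ 2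
    rw [← Complex.normSq_eq_norm_sq, Complex.normSq_apply]; ring
  have hpre : ∀ x i, pd i (fun x => (u x).re) x = (fderiv ℝ u x (stdVec i)).re := by
    intro x i
    have : HasFDerivAt (fun x => (u x).re) (Complex.reCLM.comp (fderiv ℝ u x)) x :=
      Complex.reCLM.hasFDerivAt.comp x (hu x).hasFDerivAt
    rw [pd, this.fderiv]; rfl
  have hpim : ∀ x i, pd i (fun x => (u x).im) x = (fderiv ℝ u x (stdVec i)).im := by
    intro x i
    have : HasFDerivAt (fun x => (u x).im) (Complex.imCLM.comp (fderiv ℝ u x)) x :=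
      Complex.imCLM.hasFDerivAt.comp x (hu x).hasFDerivAt
    rw [pd, this.fderiv]; rfl
  have e2 : l2norm (cgrad u) ^ 2 =
      (∫ x, gradSq (fun x => (u x).re) x) + ∫ x, gradSq (fun x => (u x).im) x := by
    rw [l2norm_sq, ← integral_add hre.gradSq.integrable him.gradSq.integrable]
    congr 1; ext x
    rw [EuclideanSpace.norm_sq_eq, gradSq, gradSq, ← Finset.sum_add_distrib]
    refine Finset.sum_congr rfl fun i _ => ?_
    rw [hpre, hpim, ← Complex.normSq_eq_norm_sq, Complex.normSq_apply, cgrad]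
    ring
  have e3 : l2norm u ^ 2 = (∫ x, (u x).re ^ 2) + ∫ x, (u x).im ^ 2 := by
    rw [l2norm_sq, ← integral_add hre.sq.integrable him.sq.integrable]
    congr 1; ext x
    rw [← Complex.normSq_eq_norm_sq, Complex.normSq_apply]; ring
  refine le_rpow_mul_rpow_of_forall_scaled hp0 hp1 (l2norm_nonneg _) (l2norm_nonneg _)
    fun t ht => ?_
  rw [quadForm, e1, map_add, e2, e3]
  refine (norm_add_le _ _).trans ((add_le_add (hC _ hre t ht) (hC _ him t ht)).trans_eq ?_)
  simp only [energy]
  ring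

end

noncomputable section

/-! ### The kernel of `∇Δ⁻¹` -/

/-- The area of the unit sphere of `ℝⁿ`. -/
def sphereArea (n : ℕ) : ℝ := n * volume.real (ball (0 : Rn n) 1)

theorem volume_real_ball_pos {n : ℕ} (x : Rn n) {r : ℝ} (hr : 0 < r) :
    0 < volume.real (ball x r) := by
  rw [measureReal_def, ENNReal.toReal_pos_iff]
  exact ⟨measure_ball_pos _ _ hr, measure_ball_lt_top⟩

theorem sphereArea_pos {n : ℕ} (hn : 1 ≤ n) : 0 < sphereArea n :=
  mul_pos (by exact_mod_cast hn) (volume_real_ball_pos _ one_pos)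

theorem gradKernel_eq {n : ℕ} (i : Fin n) (x : Rn n) :
    gradKernel i x = x i / (sphereArea n * ‖x‖ ^ n) := rfl

theorem abs_gradKernel_le {n : ℕ} (i : Fin n) (x : Rn n) :
    |gradKernel i x| ≤ (sphereArea n)⁻¹ * (‖x‖ * (‖x‖ ^ n)⁻¹) := by
  have hs : 0 < sphereArea n := sphereArea_pos (Nat.one_le_of_lt i.isLt)
  rw [gradKernel_eq, abs_div, abs_mul, abs_of_pos hs, abs_pow, abs_norm, div_eq_mul_inv, mul_inv]
  have h : |x i| ≤ ‖x‖ := PiLp.norm_apply_le x i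
  calc |x i| * ((sphereArea n)⁻¹ * (‖x‖ ^ n)⁻¹)
      ≤ ‖x‖ * ((sphereArea n)⁻¹ * (‖x‖ ^ n)⁻¹) := by gcongr
    _ = _ := by ring

theorem integral_mul_pd {n : ℕ} (i : Fin n) {f g : Rn n → ℝ} (hf : ContDiff ℝ ∞ f)
    (hg : IsTest g) : ∫ x, f x * pd i g x = -∫ x, pd i f x * g x := by
  refine integral_mul_fderiv_eq_neg_fderiv_mul_of_integrable ?_ ?_ ?_ ?_ ?_
  · exact (IsTest.mul_left (contDiff_pd hf i) hg).integrable
  · exact (IsTest.mul_left hf (hg.pd i)).integrable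
  · exact (IsTest.mul_left hf hg).integrable
  · exact fun x _ => hf.differentiable (by simp) x
  · exact fun x _ => hg.differentiable x

/-- A smooth regularization of `gradKernel`. -/
def regKernel {n : ℕ} (ε : ℝ) (i : Fin n) (x : Rn n) : ℝ :=
  x i / sphereArea n * (‖x‖ ^ 2 + ε ^ 2) ^ (-(n : ℝ) / 2)

section regKernel

variable {n : ℕ} {ε : ℝ}

theorem contDiff_regKernel (hε : 0 < ε) (i : Fin n) : ContDiff ℝ ∞ (regKernel ε i) := by
  unfold regKernel
  refine ContDiff.mul ?_ ?_
  · exact ((EuclideanSpace.proj (𝕜 := ℝ) i).contDiff).div_const _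
  · refine ContDiff.rpow_const_of_ne ?_ fun x => ?_
    · exact (contDiff_norm_sq ℝ).add contDiff_const
    · positivity

theorem pd_regKernel (hε : 0 < ε) (i j : Fin n) (x : Rn n) :
    pd j (regKernel ε i) x = (sphereArea n)⁻¹ *
      ((if i = j then (‖x‖ ^ 2 + ε ^ 2) ^ (-(n : ℝ) / 2) else 0) -
        n * (x i * x j) * (‖x‖ ^ 2 + ε ^ 2) ^ (-(n : ℝ) / 2 - 1)) := by
  have h1 : HasFDerivAt (fun x : Rn n => x i / sphereArea n)
      ((sphereArea n)⁻¹ • (EuclideanSpace.proj (𝕜 := ℝ) i : Rn n →L[ℝ] ℝ)) x := by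
    have := ((EuclideanSpace.proj (𝕜 := ℝ) i : Rn n →L[ℝ] ℝ).hasFDerivAt (x := x)).const_mul
      (sphereArea n)⁻¹
    refine this.congr_of_eventuallyEq (Eventually.of_forall fun y => ?_)
    simp [div_eq_inv_mul]
  have h2 : HasFDerivAt (fun x : Rn n => ‖x‖ ^ 2 + ε ^ 2) (2 • (innerSL ℝ) x) x := by
    refine HasFDerivAt.add_const _ ?_
    rw [← fderiv_norm_sq_apply]
    exact ((contDiff_norm_sq ℝ (n := 1)).differentiable (by simp) x).hasFDerivAt
  have h3 := h2.rpow_const (p := -(n : ℝ) / 2) (Or.inl (by positivity))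
  have h4 := h1.mul h3
  have e : pd j (regKernel ε i) x = _ := congrArg (fun L => L (stdVec j)) h4.fderiv
  rw [e]
  simp only [stdVec, add_apply, smul_apply, innerSL_apply_apply,
    EuclideanSpace.inner_single_right, smul_eq_mul, nsmul_eq_mul]
  have : (EuclideanSpace.proj i : Rn n →L[ℝ] ℝ) (EuclideanSpace.single j (1 : ℝ)) =
      if i = j then 1 else 0 := by
    simp [EuclideanSpace.proj]
  rw [this]
  split_ifs <;> simp <;> ring

/-- The terms with |x|² cancel: n(|x|² + ε²) - n|x|² = nε². What is left is `bubble n` rescaled to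
width ε, hence an approximate identity. -/
theorem sum_pd_regKernel (hε : 0 < ε) (x : Rn n) :
    ∑ i, pd i (regKernel ε i) x =
      n / sphereArea n * ε ^ 2 * (‖x‖ ^ 2 + ε ^ 2) ^ (-(n : ℝ) / 2 - 1) := by
  simp only [pd_regKernel hε, if_true]
  rw [← Finset.mul_sum, Finset.sum_sub_distrib, ← Finset.sum_mul, ← Finset.mul_sum]
  have h : ∑ i, x i * x i = ‖x‖ ^ 2 := by
    rw [EuclideanSpace.norm_sq_eq]; simp [pow_two]
  have hq : 0 < ‖x‖ ^ 2 + ε ^ 2 := by positivity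
  have e : (‖x‖ ^ 2 + ε ^ 2) ^ (-(n : ℝ) / 2)
      = (‖x‖ ^ 2 + ε ^ 2) ^ (-(n : ℝ) / 2 - 1) * (‖x‖ ^ 2 + ε ^ 2) := by
    rw [Real.rpow_sub_one hq.ne']; field_simp
  rw [h, e]
  simp only [Finset.sum_const, Finset.card_univ, Fintype.card_fin, nsmul_eq_mul]
  ring

/-- A majorant that is locally integrable and independent of ε, for dominated convergence as ε → 0.
-/
theorem abs_regKernel_le (i : Fin n) (x : Rn n) :
    |regKernel ε i x| ≤ |gradKernel i x| := by
  rcases eq_or_ne x 0 with rfl | hx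
  · simp [regKernel]
  have hx : 0 < ‖x‖ := norm_pos_iff.2 hx
  rw [regKernel, gradKernel_eq, ← div_div, abs_mul, abs_div _ (‖x‖ ^ n), div_eq_mul_inv _ |‖x‖ ^ n|]
  gcongr
  rw [abs_of_nonneg (by positivity), abs_of_nonneg (by positivity)]
  have e : (‖x‖ ^ n)⁻¹ = (‖x‖ ^ 2) ^ (-(n : ℝ) / 2) := by
    rw [← Real.rpow_natCast, ← Real.rpow_natCast, ← Real.rpow_mul hx.le, ← Real.rpow_neg hx.le]
    congr 1; push_cast; ring
  rw [e]
  refine Real.rpow_le_rpow_of_nonpos (by positivity) (by linarith [sq_nonneg ε]) ?_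
  have : (0 : ℝ) ≤ n := Nat.cast_nonneg n
  linarith

theorem tendsto_regKernel (i : Fin n) (x : Rn n) :
    Tendsto (fun ε => regKernel ε i x) (𝓝[>] 0) (𝓝 (gradKernel i x)) := by
  rcases eq_or_ne x 0 with rfl | hx
  · simp [regKernel, gradKernel]
  have hx : 0 < ‖x‖ := norm_pos_iff.2 hx
  have e : gradKernel i x = x i / sphereArea n * (‖x‖ ^ 2 + 0 ^ 2) ^ (-(n : ℝ) / 2) := by
    have e : (‖x‖ ^ n)⁻¹ = (‖x‖ ^ 2) ^ (-(n : ℝ) / 2) := by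
      rw [← Real.rpow_natCast, ← Real.rpow_natCast, ← Real.rpow_mul hx.le, ← Real.rpow_neg hx.le]
      congr 1; push_cast; ring
    rw [gradKernel_eq, ← div_div, div_eq_mul_inv _ (‖x‖ ^ n), e]
    simp
  rw [e]
  refine Tendsto.mono_left (ContinuousAt.tendsto (f := fun ε => regKernel ε i x) ?_) nhdsWithin_le_nhds
  unfold regKernel
  refine continuousAt_const.mul (ContinuousAt.rpow_const (by fun_prop) (Or.inl ?_))
  positivity

end regKernel

section

variable {n : ℕ}

theorem integrable_gradKernel_mul (i : Fin n) {f : Rn n → ℝ} (hf : Continuous f)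
    (hc : HasCompactSupport f) : Integrable (fun x => gradKernel i x * f x) :=
  (gradKernel_locallyIntegrable i).integrable_smul_right_of_hasCompactSupport hf hc

theorem tendsto_integral_regKernel (i : Fin n) {f : Rn n → ℝ} (hf : Continuous f)
    (hc : HasCompactSupport f) :
    Tendsto (fun ε => ∫ x, regKernel ε i x * f x) (𝓝[>] 0) (𝓝 (∫ x, gradKernel i x * f x)) := by
  refine tendsto_integral_filter_of_dominated_convergence
    (fun x => ‖gradKernel i x * f x‖) ?_ ?_ (integrable_gradKernel_mul i hf hc).norm ?_
  · filter_upwards [self_mem_nhdsWithin] with ε hε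
    exact ((contDiff_regKernel hε i).continuous.mul hf).aestronglyMeasurable
  · refine Eventually.of_forall fun ε => Eventually.of_forall fun x => ?_
    rw [norm_mul, norm_mul]
    gcongr
    exact abs_regKernel_le i x
  · exact Eventually.of_forall fun x => (tendsto_regKernel i x).mul_const _

/-- The kernel is a gradient, so its Jacobian is symmetric. This is visible for `regKernel`, where
one may integrate by parts, and survives the limit ε → 0. -/
theorem integral_gradKernel_pd_comm (i j : Fin n) {f : Rn n → ℝ} (hf : IsTest f) :
    ∫ x, gradKernel i x * pd j f x = ∫ x, gradKernel j x * pd i f x := by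
  refine tendsto_nhds_unique (tendsto_integral_regKernel i (hf.pd j).continuous (hf.pd j).2) ?_
  refine (tendsto_integral_regKernel j (hf.pd i).continuous (hf.pd i).2).congr' ?_
  filter_upwards [self_mem_nhdsWithin] with ε hε
  rw [integral_mul_pd i (contDiff_regKernel hε j) hf, integral_mul_pd j (contDiff_regKernel hε i) hf]
  congr 2; ext x
  rw [pd_regKernel hε, pd_regKernel hε]
  congr 2
  by_cases h : i = j
  · subst h; rfl
  · rw [if_neg h, if_neg (Ne.symm h), mul_comm (x i)]

/-- The radial profile `n / σ (1 + |x|²)^(-n/2-1)` of an approximate identity. -/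
def bubble (n : ℕ) (x : Rn n) : ℝ := n / sphereArea n * (‖x‖ ^ 2 + 1) ^ (-(n : ℝ) / 2 - 1)

/-- In polar coordinates the radial integrand has the primitive y^n (y² + 1)^(-n/2) / n, which
increases from 0 to 1/n. -/
theorem integral_bubble (hn : 1 ≤ n) : ∫ x, bubble n x = 1 := by
  have : Nontrivial (Rn n) := by
    have : Nonempty (Fin n) := ⟨⟨0, hn⟩⟩
    infer_instance
  have h := integral_fun_norm_addHaar (volume : Measure (Rn n))
    (fun y : ℝ => n / sphereArea n * (y ^ 2 + 1) ^ (-(n : ℝ) / 2 - 1))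
  have hs := sphereArea_pos hn
  have hn' : (n : ℝ) ≠ 0 := by exact_mod_cast (by lia : n ≠ 0)
  have hI : ∫ y in Set.Ioi (0 : ℝ), y ^ (n - 1) * (y ^ 2 + 1) ^ (-(n : ℝ) / 2 - 1) =
      1 / (n : ℝ) - 0 := by
    have e0 : (0 : ℝ) = (fun y : ℝ => y ^ n * (y ^ 2 + 1) ^ (-(n : ℝ) / 2) / n) 0 := by
      simp [show n ≠ 0 by lia]
    conv_rhs => rw [e0]
    refine integral_Ioi_of_hasDerivAt_of_nonneg'
      (g := fun y : ℝ => y ^ n * (y ^ 2 + 1) ^ (-(n : ℝ) / 2) / n)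
      (g' := fun y : ℝ => y ^ (n - 1) * (y ^ 2 + 1) ^ (-(n : ℝ) / 2 - 1)) ?_ ?_ ?_
    · intro y hy
      have hy : (0 : ℝ) ≤ y := hy
      have hq : (0 : ℝ) < y ^ 2 + 1 := by positivity
      have h1 : HasDerivAt (fun y : ℝ => y ^ 2 + 1) (2 * y) y := by
        simpa using (hasDerivAt_pow 2 y).add_const (1 : ℝ)
      have h2 := ((hasDerivAt_pow n y).mul (h1.rpow_const (p := -(n : ℝ) / 2) (Or.inl hq.ne'))).div_const n
      refine h2.congr_deriv ?_
      rw [Real.rpow_sub_one hq.ne']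
      obtain ⟨m, rfl⟩ : ∃ m, n = m + 1 := ⟨n - 1, by lia⟩
      simp only [Nat.add_sub_cancel, pow_succ]
      field_simp
      ring
    · intro y hy
      have hy : (0 : ℝ) < y := hy
      positivity
    -- For the limit at infinity the primitive is rewritten as (1 - 1/(y² + 1))^(n/2) / n.
    · have h1 : Tendsto (fun y : ℝ => 1 - (y ^ 2 + 1)⁻¹) atTop (𝓝 (1 - 0)) := by
        refine tendsto_const_nhds.sub (tendsto_inv_atTop_zero.comp ?_)
        exact tendsto_atTop_add_const_right _ _ (tendsto_pow_atTop (by norm_num))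
      have h2 : Tendsto (fun y : ℝ => (1 - (y ^ 2 + 1)⁻¹) ^ ((n : ℝ) / 2) / (n : ℝ)) atTop
          (𝓝 (1 / (n : ℝ))) := by
        have := (h1.rpow_const (p := (n : ℝ) / 2) (Or.inl (by norm_num))).div_const (n : ℝ)
        simpa using this
      refine h2.congr' ?_
      filter_upwards [eventually_gt_atTop 0] with y hy
      have hq : (0 : ℝ) < y ^ 2 + 1 := by positivity
      have e1 : 1 - (y ^ 2 + 1)⁻¹ = y ^ 2 * (y ^ 2 + 1)⁻¹ := by field_simp; ring
      have e2 : (y ^ 2) ^ ((n : ℝ) / 2) = y ^ n := by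
        rw [← Real.rpow_natCast, ← Real.rpow_natCast, ← Real.rpow_mul hy.le]
        congr 1; push_cast; ring
      rw [e1, Real.mul_rpow (by positivity) (by positivity), e2, neg_div, Real.rpow_neg hq.le,
        Real.inv_rpow hq.le]
  simp only [bubble]
  rw [h]
  have e : ∀ y : ℝ, y ^ (Module.finrank ℝ (Rn n) - 1) • (n / sphereArea n * (y ^ 2 + 1) ^ (-(n : ℝ) / 2 - 1))
      = (n / sphereArea n) * (y ^ (n - 1) * (y ^ 2 + 1) ^ (-(n : ℝ) / 2 - 1)) := by
    intro y; rw [finrank_euclideanSpace_fin, smul_eq_mul]; ring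
  simp only [e]
  rw [integral_const_mul, hI, finrank_euclideanSpace_fin, nsmul_eq_mul, smul_eq_mul, ← mul_assoc]
  change sphereArea n * _ = _
  field_simp
  ring

/-- The divergence of the kernel is the Dirac mass: after regularising and integrating by parts, f
is tested against a bubble of width ε. -/
theorem sum_integral_gradKernel_pd (hn : 1 ≤ n) {f : Rn n → ℝ} (hf : IsTest f) :
    ∑ i, ∫ x, gradKernel i x * pd i f x = -f 0 := by
  have h1 : Tendsto (fun ε => ∑ i, ∫ x, regKernel ε i x * pd i f x) (𝓝[>] 0)
      (𝓝 (∑ i, ∫ x, gradKernel i x * pd i f x)) :=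
    tendsto_finsetSum _ fun i _ => tendsto_integral_regKernel i (hf.pd i).continuous (hf.pd i).2
  refine tendsto_nhds_unique h1 ?_
  have hb : Integrable (bubble n) := integrable_of_integral_eq_one (integral_bubble hn)
  obtain ⟨M, hM⟩ := hf.continuous.bounded_above_of_compact_support hf.2
  have h2 : Tendsto (fun ε : ℝ => -∫ z, bubble n z * f (ε • z)) (𝓝[>] 0)
      (𝓝 (-∫ z, bubble n z * f 0)) := by
    refine Tendsto.neg (tendsto_integral_filter_of_dominated_convergence
      (fun z => ‖bubble n z‖ * M) ?_ ?_ (hb.norm.mul_const M) ?_)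
    · refine Eventually.of_forall fun ε => ?_
      exact hb.1.mul (hf.continuous.comp (continuous_const_smul ε)).aestronglyMeasurable
    · refine Eventually.of_forall fun ε => Eventually.of_forall fun z => ?_
      rw [norm_mul]
      gcongr
      exact hM _
    · refine Eventually.of_forall fun z => Tendsto.const_mul _ ?_
      have : ContinuousAt (fun ε : ℝ => f (ε • z)) 0 :=
        (hf.continuous.comp (continuous_id.smul continuous_const)).continuousAt
      have h := this.tendsto
      simp only [zero_smul] at h
      exact h.mono_left nhdsWithin_le_nhds
  rw [integral_mul_const, integral_bubble hn, one_mul] at h2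
  refine h2.congr' ?_
  filter_upwards [self_mem_nhdsWithin] with ε hε
  have hε : 0 < ε := hε
  have h3 : ∀ i, ∫ x, regKernel ε i x * pd i f x = -∫ x, pd i (regKernel ε i) x * f x :=
    fun i => integral_mul_pd i (contDiff_regKernel hε i) hf
  simp only [h3]
  rw [Finset.sum_neg_distrib, ← integral_finsetSum _ fun i _ =>
    (IsTest.mul_left (contDiff_pd (contDiff_regKernel hε i) i) hf).integrable]
  simp only [← Finset.sum_mul, sum_pd_regKernel hε]
  -- Substituting x = εz moves the scale from the bubble to the argument of f.
  have h4 := Measure.integral_comp_smul (volume : Measure (Rn n))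
    (fun x => n / sphereArea n * ε ^ 2 * (‖x‖ ^ 2 + ε ^ 2) ^ (-(n : ℝ) / 2 - 1) * f x) ε
  rw [finrank_euclideanSpace_fin, abs_of_pos (by positivity), smul_eq_mul, eq_inv_mul_iff_mul_eq₀
    (by positivity)] at h4
  rw [← h4, ← integral_const_mul]
  congr 2; ext z
  rw [bubble, norm_smul, Real.norm_of_nonneg hε.le, mul_pow]
  have e1 : (ε ^ 2 * ‖z‖ ^ 2 + ε ^ 2) = ε ^ 2 * (‖z‖ ^ 2 + 1) := by ring
  have e2 : (ε ^ 2) ^ (-(n : ℝ) / 2 - 1) = (ε ^ n)⁻¹ * (ε ^ 2)⁻¹ := by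
    rw [← Real.rpow_natCast, ← Real.rpow_natCast, ← Real.rpow_mul hε.le, ← Real.rpow_neg hε.le,
      ← Real.rpow_neg hε.le, ← Real.rpow_add hε]
    congr 1; push_cast; ring
  rw [e1, Real.mul_rpow (by positivity) (by positivity), e2]
  field_simp

/-- `∂_i Δ⁻¹ f`. -/
def gradInvLap (i : Fin n) (f : Rn n → ℝ) : Rn n → ℝ :=
  gradKernel i ⋆[ContinuousLinearMap.mul ℝ ℝ, volume] f

theorem gradInvLap_apply (i : Fin n) (f : Rn n → ℝ) (x : Rn n) :
    gradInvLap i f x = ∫ y, gradKernel i y * f (x - y) := rfl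

theorem gradInvLap_apply' (i : Fin n) (f : Rn n → ℝ) (x : Rn n) :
    gradInvLap i f x = ∫ y, gradKernel i (x - y) * f y := by
  rw [gradInvLap_apply, ← integral_sub_left_eq_self _ _ x]
  simp

theorem contDiff_gradInvLap (i : Fin n) {f : Rn n → ℝ} (hf : IsTest f) :
    ContDiff ℝ ∞ (gradInvLap i f) :=
  hf.2.contDiff_convolution_right _ (gradKernel_locallyIntegrable i) hf.1

theorem pd_gradInvLap (i j : Fin n) {f : Rn n → ℝ} (hf : IsTest f) :
    pd j (gradInvLap i f) = gradInvLap i (pd j f) := by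
  ext x
  have h := hf.2.hasFDerivAt_convolution_right (ContinuousLinearMap.mul ℝ ℝ)
    (gradKernel_locallyIntegrable i) (hf.1.of_le (by simp)) x
  rw [pd, gradInvLap, h.fderiv, convolution_precompR_apply _ (gradKernel_locallyIntegrable i)
    (hf.2.fderiv (𝕜 := ℝ)) (hf.1.continuous_fderiv (by simp))]
  rfl

theorem isTest_comp_const_sub {f : Rn n → ℝ} (hf : IsTest f) (x : Rn n) :
    IsTest (fun y => f (x - y)) :=
  ⟨hf.1.comp (contDiff_const.sub contDiff_id), hf.2.comp_homeomorph (Homeomorph.subLeft x)⟩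

theorem pd_comp_const_sub {f : Rn n → ℝ} (hf : IsTest f) (x y : Rn n) (i : Fin n) :
    pd i (fun y => f (x - y)) y = -pd i f (x - y) := by
  have h : HasFDerivAt (fun y => f (x - y)) ((fderiv ℝ f (x - y)).comp
      (-(ContinuousLinearMap.id ℝ (Rn n)))) y :=
    (hf.differentiable (x - y)).hasFDerivAt.comp y ((hasFDerivAt_id y).const_sub x)
  rw [pd, h.fderiv]
  simp [pd]

theorem gradInvLap_pd_comm (i j : Fin n) {f : Rn n → ℝ} (hf : IsTest f) :
    gradInvLap i (pd j f) = gradInvLap j (pd i f) := by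
  ext x
  have h := integral_gradKernel_pd_comm i j (isTest_comp_const_sub hf x)
  simp only [pd_comp_const_sub hf, mul_neg, integral_neg, neg_inj] at h
  exact h

/-- The preceding distributional identity applied to the reflection y ↦ f(x - y), which also removes
the sign. This representation formula underlies both the trace inequality and Q = div Γ. -/
theorem sum_gradInvLap_pd (hn : 1 ≤ n) {f : Rn n → ℝ} (hf : IsTest f) (x : Rn n) :
    ∑ i, gradInvLap i (pd i f) x = f x := by
  have h := sum_integral_gradKernel_pd hn (isTest_comp_const_sub hf x)
  simp only [pd_comp_const_sub hf, mul_neg, integral_neg, Finset.sum_neg_distrib, neg_inj,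
    sub_zero] at h
  exact h

theorem pd_gradInvLap_comm (i j : Fin n) {f : Rn n → ℝ} (hf : IsTest f) :
    pd j (gradInvLap i f) = pd i (gradInvLap j f) := by
  rw [pd_gradInvLap i j hf, pd_gradInvLap j i hf, gradInvLap_pd_comm i j hf]

theorem sum_pd_gradInvLap (hn : 1 ≤ n) {f : Rn n → ℝ} (hf : IsTest f) (x : Rn n) :
    ∑ i, pd i (gradInvLap i f) x = f x := by
  simp only [pd_gradInvLap _ _ hf]
  exact sum_gradInvLap_pd hn hf x

end

end

noncomputable section

/-! ### Truncated Riesz potentials and the trace inequality -/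

open scoped ENNReal

/-- Decompose into dyadic shells: on the k-th one the integrand is at most (T 2^(-k-1))^(-s) and the
mass at most M (T 2^(-k))^b, so the contributions form a geometric series of ratio 2^(-(b-s)). -/
theorem lintegral_ball_norm_rpow_le {n : ℕ} {s b : ℝ} (hs : 0 ≤ s) (hsb : s < b) :
    ∃ C : ℝ, 0 ≤ C ∧ ∀ (μ : Measure (Rn n)) (M T : ℝ) (y : Rn n), 0 ≤ M → 0 < T →
      (∀ r, 0 < r → r ≤ T → μ (ball y r) ≤ ENNReal.ofReal (M * r ^ b)) →
      ∫⁻ x in ball y T, ENNReal.ofReal (‖x - y‖ ^ (-s)) ∂μ ≤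
        ENNReal.ofReal (C * M * T ^ (b - s)) := by
  have hq0 : (0 : ℝ) ≤ 2 ^ (-(b - s)) := by positivity
  have hq1 : (2 : ℝ) ^ (-(b - s)) < 1 :=
    Real.rpow_lt_one_of_one_lt_of_neg (by norm_num) (by linarith)
  refine ⟨2 ^ s * (1 - 2 ^ (-(b - s)))⁻¹, mul_nonneg (by positivity)
    (inv_nonneg.2 (by linarith)), fun μ M T y hM hT hμ => ?_⟩
  let c : ℕ → ℝ := fun k => (T * (2 : ℝ)⁻¹ ^ (k + 1)) ^ (-s)
  have hc : ∀ k, 0 ≤ c k := fun k => by positivity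
  have hpt : ∀ x ∈ ball y T, ENNReal.ofReal (‖x - y‖ ^ (-s)) ≤
      ∑' k, (ball y (T * (2 : ℝ)⁻¹ ^ k)).indicator (fun _ => ENNReal.ofReal (c k)) x := by
    intro x hx
    rw [mem_ball, dist_eq_norm] at hx
    -- At the centre the real power is 1 for s = 0, which the outermost shell dominates, and 0 for s
    -- > 0 by convention.
    rcases eq_or_ne x y with rfl | hxy
    · rcases hs.eq_or_lt with rfl | hs
      · refine le_trans ?_ (ENNReal.le_tsum 0)
        simp [hT, c]
      · simp [Real.zero_rpow (by linarith : -s ≠ 0)]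
    · have hpos : 0 < ‖x - y‖ := norm_pos_iff.2 (sub_ne_zero.2 hxy)
      obtain ⟨k, hk1, hk2⟩ := exists_nat_pow_near_of_lt_one (x := ‖x - y‖ / T) (y := (2 : ℝ)⁻¹)
        (by positivity) ((div_le_one hT).2 hx.le) (by norm_num) (by norm_num)
      rw [lt_div_iff₀ hT] at hk1
      rw [div_le_iff₀ hT] at hk2
      rcases hk2.eq_or_lt with hk2 | hk2
      · -- the boundary case falls into the previous shell
        cases k with
        | zero => simp at hk2; linarith
        | succ k =>
          refine le_trans ?_ (ENNReal.le_tsum k)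
          rw [Set.indicator_of_mem]
          · refine ENNReal.ofReal_le_ofReal ?_
            simp only [c]
            rw [mul_comm, ← hk2]
          · rw [mem_ball, dist_eq_norm, hk2, pow_succ]
            have : 0 < (2 : ℝ)⁻¹ ^ k * T := by positivity
            linarith
      · refine le_trans ?_ (ENNReal.le_tsum k)
        rw [Set.indicator_of_mem]
        · refine ENNReal.ofReal_le_ofReal ?_
          refine Real.rpow_le_rpow_of_nonpos (by positivity) ?_ (by linarith)
          rw [mul_comm]; exact hk1.le
        · rw [mem_ball, dist_eq_norm, mul_comm]; exact hk2
  calc ∫⁻ x in ball y T, ENNReal.ofReal (‖x - y‖ ^ (-s)) ∂μ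
      ≤ ∫⁻ x in ball y T, ∑' k,
          (ball y (T * (2 : ℝ)⁻¹ ^ k)).indicator (fun _ => ENNReal.ofReal (c k)) x ∂μ :=
        setLIntegral_mono' measurableSet_ball hpt
    _ ≤ ∫⁻ x, ∑' k,
          (ball y (T * (2 : ℝ)⁻¹ ^ k)).indicator (fun _ => ENNReal.ofReal (c k)) x ∂μ :=
        setLIntegral_le_lintegral _ _
    _ = ∑' k, ENNReal.ofReal (c k) * μ (ball y (T * (2 : ℝ)⁻¹ ^ k)) := by
        rw [lintegral_tsum fun k => (measurable_const.indicator measurableSet_ball).aemeasurable]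
        congr 1; ext k
        rw [lintegral_indicator_const measurableSet_ball]
    _ ≤ ∑' k, ENNReal.ofReal (2 ^ s * M * T ^ (b - s) * (2 ^ (-(b - s))) ^ k) := by
        refine ENNReal.tsum_le_tsum fun k => ?_
        have h2 : (0 : ℝ) < (2 : ℝ)⁻¹ ^ k := by positivity
        have h3 : (2 : ℝ)⁻¹ ^ k ≤ 1 := pow_le_one₀ (by norm_num) (by norm_num)
        have h1 := hμ (T * (2 : ℝ)⁻¹ ^ k) (by positivity) (by nlinarith)
        calc _ ≤ ENNReal.ofReal (c k) * ENNReal.ofReal (M * (T * (2 : ℝ)⁻¹ ^ k) ^ b) := by gcongr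
          _ = ENNReal.ofReal (c k * (M * (T * (2 : ℝ)⁻¹ ^ k) ^ b)) := by
            rw [ENNReal.ofReal_mul (hc k)]
          _ = _ := by
            congr 1
            have e : (2 : ℝ)⁻¹ ^ k = 2 ^ (-(k : ℝ)) := by
              rw [Real.rpow_neg (by norm_num), Real.rpow_natCast, inv_pow]
            have e' : (2 : ℝ)⁻¹ ^ (k + 1) = 2 ^ (-(k : ℝ) - 1) := by
              rw [Real.rpow_sub_one (by norm_num), ← e, pow_succ]; rfl
            simp only [c]
            rw [e, e', Real.mul_rpow hT.le (by positivity), Real.mul_rpow hT.le (by positivity),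
              ← Real.rpow_mul (by norm_num), ← Real.rpow_mul (by norm_num),
              ← Real.rpow_natCast, ← Real.rpow_mul (by norm_num)]
            have e1 : T ^ (b - s) = T ^ (-s) * T ^ b := by
              rw [← Real.rpow_add hT]; congr 1; ring
            have e2 : (2 : ℝ) ^ ((-(k : ℝ) - 1) * -s) * 2 ^ (-(k : ℝ) * b)
                = 2 ^ s * 2 ^ (-(b - s) * k) := by
              rw [← Real.rpow_add (by norm_num), ← Real.rpow_add (by norm_num)]
              congr 1; ring
            rw [e1]
            linear_combination (T ^ (-s) * T ^ b * M) * e2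
    _ = _ := by
        have hA : 0 ≤ 2 ^ s * M * T ^ (b - s) := by positivity
        rw [← ENNReal.ofReal_tsum_of_nonneg (fun k => mul_nonneg hA (pow_nonneg hq0 k))
          ((summable_geometric_of_lt_one hq0 hq1).mul_left _), tsum_mul_left,
          tsum_geometric_of_lt_one hq0 hq1]
        congr 1; ring

theorem sq_lintegral_mul_le {α : Type*} [MeasurableSpace α] (μ : Measure α) {f g : α → ℝ≥0∞}
    (hf : AEMeasurable f μ) (hg : AEMeasurable g μ) :
    (∫⁻ x, f x * g x ∂μ) ^ 2 ≤ (∫⁻ x, f x ^ 2 ∂μ) * ∫⁻ x, g x ^ 2 ∂μ := by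
  have h := ENNReal.lintegral_mul_le_Lp_mul_Lq μ Real.HolderConjugate.two_two hf hg
  calc _ ≤ _ := pow_le_pow_left' h 2
    _ = _ := by
      rw [mul_pow, ← ENNReal.rpow_natCast, ← ENNReal.rpow_natCast, ← ENNReal.rpow_mul,
        ← ENNReal.rpow_mul]
      simp

/-- The Riesz potential of order one, truncated at distance `T`. -/
def rieszPot {n : ℕ} (T : ℝ) (f : Rn n → ℝ≥0∞) (x : Rn n) : ℝ≥0∞ :=
  ∫⁻ y in ball x T, ENNReal.ofReal (‖y - x‖ ^ (1 - (n : ℝ))) * f y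

/-- A Schur test. Write 1 - n = -(n - a/2)/2 - (n - 2 + a/2)/2 and apply Cauchy–Schwarz. The first
factor squared is integrable for Lebesgue measure, of dimension n, and the second for μ, of
dimension n - 2 + a; each integration over a ball of radius T yields T^(a/2). -/
theorem lintegral_rieszPot_sq_le {n : ℕ} (hn : 2 ≤ n) {a : ℝ} (ha : 0 < a) (ha2 : a ≤ 2) :
    ∃ C : ℝ, 0 ≤ C ∧ ∀ (μ : Measure (Rn n)) [SFinite μ] (M T : ℝ), 0 ≤ M → 0 < T →
      (∀ y r, 0 < r → r ≤ T → μ (ball y r) ≤ ENNReal.ofReal (M * r ^ ((n : ℝ) - 2 + a))) →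
      ∀ f : Rn n → ℝ≥0∞, Measurable f →
        ∫⁻ x, rieszPot T f x ^ 2 ∂μ ≤ ENNReal.ofReal (C * M * T ^ a) * ∫⁻ y, f y ^ 2 := by
  have hn' : (2 : ℝ) ≤ n := by exact_mod_cast hn
  obtain ⟨C₁, hC₁, h₁⟩ := lintegral_ball_norm_rpow_le (n := n) (s := n - a / 2) (b := n)
    (by linarith) (by linarith)
  obtain ⟨C₂, hC₂, h₂⟩ := lintegral_ball_norm_rpow_le (n := n) (s := n - 2 + a / 2)
    (b := n - 2 + a) (by linarith) (by linarith)
  set V : ℝ := volume.real (ball (0 : Rn n) 1) with hV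
  have hV0 : 0 ≤ V := measureReal_nonneg
  have : Nontrivial (Rn n) := by
    have : Nonempty (Fin n) := ⟨⟨0, by lia⟩⟩
    infer_instance
  have hvol : ∀ (y : Rn n) (r : ℝ), 0 < r → volume (ball y r) ≤ ENNReal.ofReal (V * r ^ (n : ℝ)) := by
    intro y r hr
    rw [Measure.addHaar_ball _ _ hr.le, finrank_euclideanSpace_fin, mul_comm V, Real.rpow_natCast,
      ENNReal.ofReal_mul (by positivity), hV, ofReal_measureReal measure_ball_lt_top.ne]
  refine ⟨C₁ * V * C₂, by positivity, fun μ _ M T hM hT hμ f hf => ?_⟩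
  let k : Rn n → Rn n → ℝ≥0∞ := fun x y =>
    if dist y x < T then ENNReal.ofReal (‖y - x‖ ^ (-((n : ℝ) - 2 + a / 2))) else 0
  have hk : Measurable (Function.uncurry k) := by
    refine Measurable.ite ?_ ?_ measurable_const
    · exact measurableSet_lt (measurable_snd.dist measurable_fst) measurable_const
    · exact (((measurable_snd.sub measurable_fst).norm).pow_const _).ennreal_ofReal
  have hky : ∀ y, Measurable fun x => k x y := fun y => hk.of_uncurry_right
  have hkf : AEMeasurable (Function.uncurry fun x y => k x y * f y ^ 2) (μ.prod volume) :=
    (hk.mul ((hf.comp measurable_snd).pow_const 2)).aemeasurable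
  have hpt : ∀ x, rieszPot T f x ^ 2 ≤
      ENNReal.ofReal (C₁ * V * T ^ (a / 2)) * ∫⁻ y, k x y * f y ^ 2 := by
    intro x
    have hm : ∀ s : ℝ, Measurable fun y : Rn n => ENNReal.ofReal (‖y - x‖ ^ s) := fun s =>
      ((measurable_id.sub measurable_const).norm.pow_const s).ennreal_ofReal
    have h1 : rieszPot T f x ≤ ∫⁻ y in ball x T, ENNReal.ofReal (‖y - x‖ ^ (-((n : ℝ) - a / 2) / 2)) *
        (ENNReal.ofReal (‖y - x‖ ^ (-((n : ℝ) - 2 + a / 2) / 2)) * f y) := by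
      refine lintegral_mono fun y => ?_
      rw [← mul_assoc, ← ENNReal.ofReal_mul (by positivity)]
      gcongr
      rcases (norm_nonneg (y - x)).eq_or_lt with h | h
      · rw [← h, Real.zero_rpow (by linarith : (1 : ℝ) - n ≠ 0)]
        positivity
      · rw [← Real.rpow_add h]
        refine le_of_eq ?_
        congr 1; ring
    have h2 := sq_lintegral_mul_le (volume.restrict (ball x T))
      (hm (-((n : ℝ) - a / 2) / 2)).aemeasurable
      ((hm (-((n : ℝ) - 2 + a / 2) / 2)).mul hf).aemeasurable
    refine (pow_le_pow_left' h1 2).trans (h2.trans ?_)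
    have hsq : ∀ (s : ℝ) (y : Rn n), ENNReal.ofReal (‖y - x‖ ^ (-s / 2)) ^ 2
        = ENNReal.ofReal (‖y - x‖ ^ (-s)) := by
      intro s y
      rw [← ENNReal.ofReal_pow (by positivity), ← Real.rpow_natCast, ← Real.rpow_mul (norm_nonneg _)]
      congr 2; push_cast; ring
    refine mul_le_mul' ?_ ?_
    · simp only [hsq]
      refine (h₁ volume V T x hV0 hT fun r hr _ => hvol x r hr).trans_eq ?_
      congr 3; ring
    · simp only [Pi.mul_apply, mul_pow, hsq]
      rw [← lintegral_indicator measurableSet_ball]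
      refine lintegral_mono fun y => ?_
      simp only [Set.indicator, mem_ball, k]
      split_ifs <;> simp
  calc ∫⁻ x, rieszPot T f x ^ 2 ∂μ
      ≤ ∫⁻ x, ENNReal.ofReal (C₁ * V * T ^ (a / 2)) * (∫⁻ y, k x y * f y ^ 2) ∂μ := lintegral_mono hpt
    _ = ENNReal.ofReal (C₁ * V * T ^ (a / 2)) * ∫⁻ x, (∫⁻ y, k x y * f y ^ 2) ∂μ := by
        rw [lintegral_const_mul' _ _ ENNReal.ofReal_ne_top]
    _ = ENNReal.ofReal (C₁ * V * T ^ (a / 2)) * ∫⁻ y, (∫⁻ x, k x y ∂μ) * f y ^ 2 := by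
        rw [lintegral_lintegral_swap]
        · congr 1
          refine lintegral_congr fun y => ?_
          rw [lintegral_mul_const]
          exact hky y
        · exact hkf
    _ ≤ ENNReal.ofReal (C₁ * V * T ^ (a / 2)) *
          ∫⁻ y, ENNReal.ofReal (C₂ * M * T ^ (a / 2)) * f y ^ 2 := by
        gcongr with y
        have := h₂ μ M T y hM hT (fun r hr hrT => hμ y r hr hrT)
        rw [show (n : ℝ) - 2 + a - (n - 2 + a / 2) = a / 2 by ring] at this
        refine le_trans (le_of_eq ?_) this
        rw [← lintegral_indicator measurableSet_ball]
        refine lintegral_congr fun x => ?_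
        simp only [Set.indicator, mem_ball, k, dist_comm y x, norm_sub_rev y x]
    _ = _ := by
        rw [lintegral_const_mul' _ _ ENNReal.ofReal_ne_top, ← mul_assoc,
          ← ENNReal.ofReal_mul (by positivity)]
        congr 2
        have : T ^ a = T ^ (a / 2) * T ^ (a / 2) := by
          rw [← Real.rpow_add hT]; congr 1; ring
        rw [this]; ring

/-- A fixed smooth cutoff, equal to one on the unit ball and supported in the ball of radius two. -/
def unitBump (n : ℕ) : ContDiffBump (0 : Rn n) := ⟨1, 2, one_pos, one_lt_two⟩

/-- The cutoff `unitBump` transported to the ball with centre `x₀` and radius `R`. -/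
def cutoff {n : ℕ} (x₀ : Rn n) (R : ℝ) (x : Rn n) : ℝ := unitBump n (R⁻¹ • (x - x₀))

section cutoff

variable {n : ℕ} {x₀ x : Rn n} {R : ℝ}

theorem isTest_unitBump : IsTest (unitBump n : Rn n → ℝ) :=
  ⟨(unitBump n).contDiff, (unitBump n).hasCompactSupport⟩

theorem isTest_cutoff (hR : 0 < R) : IsTest (cutoff x₀ R) :=
  isTest_unitBump.comp_smul_sub (inv_ne_zero hR.ne') x₀

theorem cutoff_eq_one (hR : 0 < R) (hx : x ∈ closedBall x₀ R) : cutoff x₀ R x = 1 := by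
  refine (unitBump n).one_of_mem_closedBall ?_
  rw [mem_closedBall, dist_eq_norm] at hx
  rw [mem_closedBall_zero_iff, norm_smul, norm_inv, Real.norm_of_nonneg hR.le]
  change _ ≤ (1 : ℝ)
  rw [inv_mul_le_iff₀ hR]; simpa using hx

theorem tsupport_cutoff_subset (hR : 0 < R) : tsupport (cutoff x₀ R) ⊆ closedBall x₀ (2 * R) := by
  refine closure_minimal (fun x hx => ?_) isClosed_closedBall
  have : R⁻¹ • (x - x₀) ∈ Function.support (unitBump n) := hx
  rw [(unitBump n).support_eq, mem_ball_zero_iff, norm_smul, norm_inv,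
    Real.norm_of_nonneg hR.le] at this
  rw [mem_closedBall, dist_eq_norm]
  have h : R⁻¹ * ‖x - x₀‖ < 2 := this
  rw [inv_mul_lt_iff₀ hR] at h
  linarith

theorem cutoff_nonneg : 0 ≤ cutoff x₀ R x := (unitBump n).nonneg

theorem cutoff_le_one : cutoff x₀ R x ≤ 1 := (unitBump n).le_one

/-- By scaling and translation, a bound for the single function `unitBump n` serves all centres and
radii. -/
theorem exists_norm_fderiv_cutoff_le (n : ℕ) :
    ∃ A : ℝ, 0 ≤ A ∧ ∀ (x₀ x : Rn n) (R : ℝ), 0 < R → ‖fderiv ℝ (cutoff x₀ R) x‖ ≤ A / R := by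
  obtain ⟨A, hA⟩ := ((isTest_unitBump (n := n)).1.continuous_fderiv
    (by simp)).bounded_above_of_compact_support ((isTest_unitBump (n := n)).2.fderiv (𝕜 := ℝ))
  refine ⟨A, (norm_nonneg _).trans (hA 0), fun x₀ x R hR => ?_⟩
  have h : HasFDerivAt (cutoff x₀ R) ((fderiv ℝ (unitBump n) (R⁻¹ • (x - x₀))).comp
      (R⁻¹ • ContinuousLinearMap.id ℝ (Rn n))) x :=
    (isTest_unitBump.differentiable _).hasFDerivAt.comp x
      (((hasFDerivAt_id x).sub_const x₀).const_smul R⁻¹)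
  rw [h.fderiv]
  refine (ContinuousLinearMap.opNorm_comp_le _ _).trans ?_
  rw [norm_smul, norm_inv, Real.norm_of_nonneg hR.le, div_eq_mul_inv]
  have h1 : ‖ContinuousLinearMap.id ℝ (Rn n)‖ ≤ 1 := ContinuousLinearMap.norm_id_le
  refine mul_le_mul (hA _) ?_ (by positivity) ((norm_nonneg _).trans (hA 0))
  exact mul_le_of_le_one_right (by positivity) h1

end cutoff

theorem norm_mul_inv_pow_eq_rpow {n : ℕ} (hn : 2 ≤ n) {ρ : ℝ} (hρ : 0 ≤ ρ) :
    ρ * (ρ ^ n)⁻¹ = ρ ^ (1 - (n : ℝ)) := by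
  have hn' : (2 : ℝ) ≤ n := by exact_mod_cast hn
  rcases hρ.eq_or_lt with rfl | h
  · rw [Real.zero_rpow (by linarith), zero_mul]
  · rw [Real.rpow_sub h, Real.rpow_one, Real.rpow_natCast, div_eq_mul_inv]

/-- Pointwise domination of `∂_i Δ⁻¹ f` by a truncated Riesz potential. -/
theorem abs_gradInvLap_le_rieszPot {n : ℕ} (hn : 2 ≤ n) (i : Fin n) (f : Rn n → ℝ)
    (x : Rn n) (T : ℝ) (hf : ∀ y, y ∉ ball x T → f y = 0) :
    ENNReal.ofReal |gradInvLap i f x| ≤ ENNReal.ofReal (sphereArea n)⁻¹ *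
      rieszPot T (fun y => ENNReal.ofReal |f y|) x := by
  rw [gradInvLap_apply', ← Real.norm_eq_abs, ofReal_norm]
  refine (enorm_integral_le_lintegral_enorm _).trans ?_
  rw [rieszPot, ← lintegral_const_mul' _ _ ENNReal.ofReal_ne_top,
    ← lintegral_indicator measurableSet_ball]
  refine lintegral_mono fun y => ?_
  by_cases hy : y ∈ ball x T
  · rw [Set.indicator_of_mem hy, enorm_mul, ← mul_assoc, Real.enorm_eq_ofReal_abs,
      Real.enorm_eq_ofReal_abs]
    have hs := sphereArea_pos (by lia : 1 ≤ n)
    rw [← ENNReal.ofReal_mul (inv_nonneg.2 hs.le)]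
    refine mul_le_mul_left (ENNReal.ofReal_le_ofReal ?_) _
    refine (abs_gradKernel_le i (x - y)).trans_eq ?_
    rw [norm_mul_inv_pow_eq_rpow hn (norm_nonneg _), norm_sub_rev]
  · simp [Set.indicator_of_notMem hy, hf y hy]

/-- Cutting v off at distance comparable to t around the point of evaluation and using the
representation formula bounds |v| pointwise by the potential, truncated at 3t, of |∇v| + |v|/t. The
Schur bound `lintegral_rieszPot_sq_le` then finishes. Because of the truncation, only balls of
radius at most 3t enter. -/
theorem trace_inequality {n : ℕ} (hn : 2 ≤ n) {a : ℝ} (ha : 0 < a) (ha2 : a ≤ 2) :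
    ∃ C : ℝ, 0 ≤ C ∧ ∀ (μ : Measure (Rn n)) [SFinite μ] (M t : ℝ), 0 ≤ M → 0 < t →
      (∀ y r, 0 < r → r ≤ 3 * t → μ (ball y r) ≤ ENNReal.ofReal (M * r ^ ((n : ℝ) - 2 + a))) →
      ∀ v : Rn n → ℝ, IsTest v →
        ∫⁻ x, ENNReal.ofReal (v x ^ 2) ∂μ ≤ ENNReal.ofReal (C * M * t ^ (a - 2) * energy t v) := by
  obtain ⟨C, hC, h⟩ := lintegral_rieszPot_sq_le hn ha ha2
  obtain ⟨A, hA, hcut⟩ := exists_norm_fderiv_cutoff_le n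
  set σ := (sphereArea n)⁻¹ with hσ
  have hσ0 : 0 < σ := inv_pos.2 (sphereArea_pos (by lia : 1 ≤ n))
  refine ⟨σ ^ 2 * (C * 3 ^ a) * (2 * n + 2 * (n * A) ^ 2), by positivity,
    fun μ _ M t hM ht hμ v hv => ?_⟩
  let F : Rn n → ℝ := fun y => (∑ i, |pd i v y|) + n * A / t * |v y|
  have hF0 : ∀ y, 0 ≤ F y := fun y => by positivity
  have hFc : Continuous F := by
    refine (continuous_finsetSum _ fun i _ => (hv.pd i).continuous.abs).add ?_
    exact continuous_const.mul hv.continuous.abs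
  have hpt : ∀ x, ENNReal.ofReal (v x ^ 2) ≤ ENNReal.ofReal (σ ^ 2) *
      rieszPot (3 * t) (fun y => ENNReal.ofReal (F y)) x ^ 2 := by
    intro x
    -- The cutoff is centred at the point x itself, while the majorant F of the derivatives of g
    -- does not depend on x. Its support has radius 2t, so 3t allows an open ball.
    let g : Rn n → ℝ := fun y => v y * cutoff x t y
    have hg : IsTest g := hv.mul_right (isTest_cutoff ht).1
    have hgx : g x = v x := by
      simp only [g]
      rw [cutoff_eq_one ht (mem_closedBall_self ht.le), mul_one]
    have hsupp : ∀ i y, y ∉ ball x (3 * t) → pd i g y = 0 := by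
      intro i y hy
      have hy' : y ∉ tsupport g := by
        intro h'
        have h1 : y ∈ tsupport (cutoff x t) := tsupport_mul_subset_right h'
        have h2 := tsupport_cutoff_subset ht h1
        rw [mem_closedBall] at h2
        rw [mem_ball] at hy
        linarith
      rw [pd, image_eq_zero_of_notMem_tsupport (f := fderiv ℝ g)
        (fun h' => hy' (tsupport_fderiv_subset ℝ h'))]
      rfl
    have hle : ∀ i y, |pd i g y| ≤ |pd i v y| + A / t * |v y| := by
      intro i y
      rw [pd_mul i (hv.differentiable y) ((isTest_cutoff ht).differentiable y)]
      refine (abs_add_le _ _).trans ?_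
      rw [abs_mul, abs_mul, add_comm]
      refine add_le_add ?_ ?_
      · rw [abs_of_nonneg cutoff_nonneg]
        exact mul_le_of_le_one_right (abs_nonneg _) cutoff_le_one
      · rw [mul_comm]
        gcongr
        exact (abs_pd_le _ _ _).trans (hcut x y t ht)
    have h1 : ENNReal.ofReal |v x| ≤ ENNReal.ofReal σ *
        rieszPot (3 * t) (fun y => ENNReal.ofReal (F y)) x := by
      rw [← hgx, ← sum_gradInvLap_pd (by lia : 1 ≤ n) hg x]
      calc ENNReal.ofReal |∑ i, gradInvLap i (pd i g) x|
          ≤ ENNReal.ofReal (∑ i, |gradInvLap i (pd i g) x|) :=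
            ENNReal.ofReal_le_ofReal (Finset.abs_sum_le_sum_abs _ _)
        _ = ∑ i, ENNReal.ofReal |gradInvLap i (pd i g) x| :=
            ENNReal.ofReal_sum_of_nonneg fun _ _ => abs_nonneg _
        _ ≤ ∑ i, ENNReal.ofReal σ * rieszPot (3 * t) (fun y => ENNReal.ofReal |pd i g y|) x :=
            Finset.sum_le_sum fun i _ => abs_gradInvLap_le_rieszPot hn i _ x _ (hsupp i)
        _ = ENNReal.ofReal σ * ∑ i, rieszPot (3 * t) (fun y => ENNReal.ofReal |pd i g y|) x := by
            rw [Finset.mul_sum]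
        _ ≤ _ := by
            gcongr
            unfold rieszPot
            rw [← lintegral_finsetSum]
            · refine lintegral_mono fun y => ?_
              simp only []
              rw [← Finset.mul_sum, ← ENNReal.ofReal_sum_of_nonneg fun _ _ => abs_nonneg _]
              gcongr
              refine (Finset.sum_le_sum fun i _ => hle i y).trans_eq ?_
              rw [Finset.sum_add_distrib]
              simp only [F, Finset.sum_const, Finset.card_univ, Fintype.card_fin, nsmul_eq_mul]
              ring
            · intro i _
              refine Measurable.mul ?_ (hg.pd i).continuous.abs.measurable.ennreal_ofReal
              exact ((measurable_id.sub measurable_const).norm.pow_const _).ennreal_ofReal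
    calc ENNReal.ofReal (v x ^ 2) = ENNReal.ofReal |v x| ^ 2 := by
          rw [← ENNReal.ofReal_pow (abs_nonneg _), sq_abs]
      _ ≤ _ := pow_le_pow_left' h1 2
      _ = _ := by rw [mul_pow, ENNReal.ofReal_pow hσ0.le]
  have hFsq : ∫⁻ y, ENNReal.ofReal (F y) ^ 2 ≤
      ENNReal.ofReal ((2 * n + 2 * (n * A) ^ 2) * t ^ (-2 : ℝ) * energy t v) := by
    have hint : Integrable (fun y => 2 * n * gradSq v y + 2 * (n * A / t) ^ 2 * v y ^ 2) :=
      (hv.gradSq.integrable.const_mul _).add (hv.sq.integrable.const_mul _)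
    calc ∫⁻ y, ENNReal.ofReal (F y) ^ 2
        ≤ ∫⁻ y, ENNReal.ofReal (2 * n * gradSq v y + 2 * (n * A / t) ^ 2 * v y ^ 2) := by
          refine lintegral_mono fun y => ?_
          simp only []
          rw [← ENNReal.ofReal_pow (hF0 y)]
          refine ENNReal.ofReal_le_ofReal ?_
          have h1 : (∑ i, |pd i v y|) ^ 2 ≤ n * gradSq v y := by
            have := sq_sum_le_card_mul_sum_sq (s := Finset.univ) (f := fun i => |pd i v y|)
            simpa [gradSq] using this
          have h2 := add_sq_le (a := ∑ i, |pd i v y|) (b := n * A / t * |v y|)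
          have h3 : (n * A / t * |v y|) ^ 2 = (n * A / t) ^ 2 * v y ^ 2 := by
            rw [mul_pow, sq_abs]
          rw [h3] at h2
          simp only [F]
          linarith
      _ = ENNReal.ofReal (∫ y, 2 * n * gradSq v y + 2 * (n * A / t) ^ 2 * v y ^ 2) := by
          rw [ofReal_integral_eq_lintegral_ofReal hint]
          refine Eventually.of_forall fun y => ?_
          have := gradSq_nonneg v y
          positivity
      _ ≤ _ := by
          refine ENNReal.ofReal_le_ofReal ?_
          rw [integral_add (hv.gradSq.integrable.const_mul _) (hv.sq.integrable.const_mul _),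
            integral_const_mul, integral_const_mul, energy]
          have hE : 0 ≤ ∫ x, gradSq v x := integral_nonneg fun _ => gradSq_nonneg _ _
          have hL : 0 ≤ ∫ x, v x ^ 2 := integral_nonneg fun _ => sq_nonneg _
          have ht2 : t ^ (-2 : ℝ) = (t ^ 2)⁻¹ := by
            rw [Real.rpow_neg ht.le]; norm_cast
          rw [ht2]
          have e : (2 * (n : ℝ) + 2 * (n * A) ^ 2) * (t ^ 2)⁻¹ *
              (t ^ 2 * (∫ x, gradSq v x) + ∫ x, v x ^ 2) =
              2 * n * (∫ x, gradSq v x) + 2 * (n * A / t) ^ 2 * (∫ x, v x ^ 2) +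
              (2 * (n * A) ^ 2 * (∫ x, gradSq v x) + 2 * n * (t ^ 2)⁻¹ * ∫ x, v x ^ 2) := by
            field_simp
            ring
          rw [e]
          have : 0 ≤ 2 * ((n : ℝ) * A) ^ 2 * (∫ x, gradSq v x) + 2 * n * (t ^ 2)⁻¹ * ∫ x, v x ^ 2 := by
            positivity
          linarith
  calc ∫⁻ x, ENNReal.ofReal (v x ^ 2) ∂μ
      ≤ ∫⁻ x, ENNReal.ofReal (σ ^ 2) *
          rieszPot (3 * t) (fun y => ENNReal.ofReal (F y)) x ^ 2 ∂μ := lintegral_mono hpt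
    _ = ENNReal.ofReal (σ ^ 2) * ∫⁻ x, rieszPot (3 * t) (fun y => ENNReal.ofReal (F y)) x ^ 2 ∂μ := by
        rw [lintegral_const_mul' _ _ ENNReal.ofReal_ne_top]
    _ ≤ ENNReal.ofReal (σ ^ 2) * (ENNReal.ofReal (C * M * (3 * t) ^ a) *
          ENNReal.ofReal ((2 * n + 2 * (n * A) ^ 2) * t ^ (-2 : ℝ) * energy t v)) := by
        gcongr
        refine (h μ M (3 * t) hM (by positivity) hμ _ hFc.measurable.ennreal_ofReal).trans ?_
        gcongr
    _ = _ := by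
        rw [← ENNReal.ofReal_mul (by positivity), ← ENNReal.ofReal_mul (by positivity)]
        congr 1
        rw [Real.mul_rpow (by norm_num) ht.le, sub_eq_add_neg, Real.rpow_add ht]
        ring

end

noncomputable section

/-! ### Averages over balls and the `L²` form of the John–Nirenberg inequality -/

open scoped ENNReal

/-- The volume of the unit ball. -/
def unitVol (n : ℕ) : ℝ := volume.real (ball (0 : Rn n) 1)

theorem unitVol_pos (n : ℕ) : 0 < unitVol n := volume_real_ball_pos _ one_pos

theorem nontrivial_Rn {n : ℕ} (hn : 1 ≤ n) : Nontrivial (Rn n) := by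
  have : Nonempty (Fin n) := ⟨⟨0, hn⟩⟩
  infer_instance

theorem volume_real_ball {n : ℕ} (hn : 1 ≤ n) (x : Rn n) {r : ℝ} (hr : 0 ≤ r) :
    volume.real (ball x r) = unitVol n * r ^ n := by
  have := nontrivial_Rn hn
  rw [measureReal_def, Measure.addHaar_ball _ _ hr, finrank_euclideanSpace_fin, ENNReal.toReal_mul,
    ENNReal.toReal_ofReal (by positivity), mul_comm]
  rfl

theorem volume_ball_eq_ofReal {n : ℕ} (hn : 1 ≤ n) (x : Rn n) {r : ℝ} (hr : 0 ≤ r) :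
    volume (ball x r) = ENNReal.ofReal (unitVol n * r ^ n) := by
  rw [← volume_real_ball hn x hr, ofReal_measureReal measure_ball_lt_top.ne]

theorem closedBall_ae_eq_ball {n : ℕ} (hn : 1 ≤ n) (x : Rn n) (r : ℝ) :
    closedBall x r =ᵐ[volume] ball x r := by
  have := nontrivial_Rn hn
  refine (ae_eq_of_ae_subset_of_measure_ge (Eventually.of_forall ball_subset_closedBall) ?_
    measurableSet_ball.nullMeasurableSet measure_closedBall_lt_top.ne).symm
  exact (Measure.addHaar_closedBall_eq_addHaar_ball volume x r).le

theorem ae_tendsto_ball_average {n : ℕ} (hn : 1 ≤ n) {F : Type*} [NormedAddCommGroup F]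
    [NormedSpace ℝ F] [CompleteSpace F] {f : Rn n → F} (hf : LocallyIntegrable f) :
    ∀ᵐ x, Tendsto (fun r => ⨍ y in ball x r, f y) (𝓝[>] 0) (𝓝 (f x)) := by
  filter_upwards [IsUnifLocDoublingMeasure.ae_tendsto_average volume hf 1] with x hx
  have h := hx (fun _ : ℝ => x) id tendsto_id (by
    filter_upwards [self_mem_nhdsWithin] with r hr
    simpa using (le_of_lt hr : (0 : ℝ) ≤ r))
  refine h.congr fun r => ?_
  exact setAverage_congr (closedBall_ae_eq_ball hn x r)

section average

variable {n : ℕ} {F : Type*} [NormedAddCommGroup F] [NormedSpace ℝ F] [CompleteSpace F]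
  {f : Rn n → F} {x : Rn n} {r : ℝ}

theorem norm_setAverage_sub_le (hr : 0 < r) (hf : IntegrableOn f (ball x r)) (c : F) :
    ‖(⨍ y in ball x r, f y) - c‖ ≤ (volume.real (ball x r))⁻¹ * ∫ y in ball x r, ‖f y - c‖ := by
  have hv := volume_real_ball_pos x hr
  have hc : IntegrableOn (fun _ => c) (ball x r) :=
    integrableOn_const measure_ball_lt_top.ne
  have e : (⨍ y in ball x r, f y) - c
      = (volume.real (ball x r))⁻¹ • ∫ y in ball x r, (f y - c) := by
    rw [setAverage_eq, integral_sub hf hc, setIntegral_const, smul_sub, inv_smul_smul₀ hv.ne']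
  rw [e, norm_smul, norm_inv, Real.norm_of_nonneg hv.le]
  gcongr
  exact norm_integral_le_integral_norm _

/-- The average differs from c by at most the mean of |f - c|, so replacing c by the average costs a
factor two. -/
theorem setIntegral_norm_sub_average_le (hr : 0 < r) (hf : IntegrableOn f (ball x r)) (c : F) :
    ∫ y in ball x r, ‖f y - ⨍ z in ball x r, f z‖ ≤ 2 * ∫ y in ball x r, ‖f y - c‖ := by
  have hv := volume_real_ball_pos x hr
  have hc : ∀ c : F, IntegrableOn (fun _ => c) (ball x r) := fun c =>
    integrableOn_const measure_ball_lt_top.ne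
  have h1 := norm_setAverage_sub_le hr hf c
  calc ∫ y in ball x r, ‖f y - ⨍ z in ball x r, f z‖
      ≤ ∫ y in ball x r, (‖f y - c‖ + ‖(⨍ z in ball x r, f z) - c‖) := by
        refine integral_mono (hf.sub (hc _)).norm (((hf.sub (hc c)).norm).add
          (integrableOn_const measure_ball_lt_top.ne)) fun y => ?_
        rw [norm_sub_rev (⨍ z in ball x r, f z) c]
        exact norm_sub_le_norm_sub_add_norm_sub _ _ _
    _ = (∫ y in ball x r, ‖f y - c‖) + volume.real (ball x r) * ‖(⨍ z in ball x r, f z) - c‖ := by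
        have hi : IntegrableOn (fun y => ‖f y - c‖) (ball x r) := (hf.sub (hc c)).norm
        rw [integral_add hi (integrableOn_const measure_ball_lt_top.ne),
          setIntegral_const, smul_eq_mul]
    _ ≤ _ := by
        have := mul_le_mul_of_nonneg_left h1 hv.le
        rw [mul_inv_cancel_left₀ hv.ne'] at this
        linarith

end average

/-- In L² the average is the best constant: the two sides differ by (m - c)² times the volume. -/
theorem setIntegral_sq_sub_average_le {n : ℕ} {g : Rn n → ℝ} {x : Rn n} {r : ℝ} (hr : 0 < r)
    (hg : IntegrableOn g (ball x r)) (hg2 : IntegrableOn (fun y => g y ^ 2) (ball x r)) (c : ℝ) :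
    ∫ y in ball x r, (g y - ⨍ z in ball x r, g z) ^ 2 ≤ ∫ y in ball x r, (g y - c) ^ 2 := by
  have hv := volume_real_ball_pos x hr
  set m := ⨍ z in ball x r, g z with hm
  have hm' : ∫ y in ball x r, g y = volume.real (ball x r) * m := by
    rw [hm, setAverage_eq, smul_eq_mul, mul_inv_cancel_left₀ hv.ne']
  have e : ∀ c : ℝ, ∫ y in ball x r, (g y - c) ^ 2 =
      (∫ y in ball x r, g y ^ 2) - 2 * c * (volume.real (ball x r) * m) +
        volume.real (ball x r) * c ^ 2 := by
    intro c
    have : ∀ y, (g y - c) ^ 2 = (g y ^ 2 - 2 * c * g y) + c ^ 2 := fun y => by ring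
    simp only [this]
    have hi : IntegrableOn (fun y => g y ^ 2 - 2 * c * g y) (ball x r) := hg2.sub (hg.const_mul _)
    rw [integral_add hi (integrableOn_const measure_ball_lt_top.ne),
      integral_sub hg2 (hg.const_mul _), integral_const_mul, hm', setIntegral_const, smul_eq_mul]
  rw [e, e]
  nlinarith [mul_nonneg hv.le (sq_nonneg (m - c))]

/-- One step of the John–Nirenberg iteration: a bound `S` on all mean square oscillations improves
to `(S + 3 L²) / 2`, where `L` is a large multiple of the mean oscillation. -/
theorem meanSquareOscillation_improve {n : ℕ} (hn : 1 ≤ n) {g : Rn n → ℝ}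
    (hg : AEStronglyMeasurable g) {k : ℝ} (hk : ∀ x, |g x| ≤ k) {N : ℝ} (hN : 0 < N)
    (hosc : ∀ x r, 0 < r → ∫ y in ball x r, |g y - ⨍ z in ball x r, g z| ≤
      N * volume.real (ball x r)) {S : ℝ}
    (hS : ∀ x r, 0 < r → ∫ y in ball x r, (g y - ⨍ z in ball x r, g z) ^ 2 ≤
      S * volume.real (ball x r)) (x₀ : Rn n) {δ : ℝ} (hδ : 0 < δ) :
    ∫ y in ball x₀ δ, (g y - ⨍ z in ball x₀ δ, g z) ^ 2 ≤
      ((S + 3 * (4 * 12 ^ n * N) ^ 2) / 2) * volume.real (ball x₀ δ) := by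
  have hbd : ∀ (φ : Rn n → ℝ) (K : ℝ), AEStronglyMeasurable φ → (∀ y, |φ y| ≤ K) →
      ∀ x r, IntegrableOn φ (ball x r) := fun φ K hφ hK x r =>
    IntegrableOn.of_bound measure_ball_lt_top hφ.restrict K (Eventually.of_forall hK)
  have hgi : ∀ x r, IntegrableOn g (ball x r) := hbd g k hg hk
  have hgi2 : ∀ x r, IntegrableOn (fun y => g y ^ 2) (ball x r) := by
    refine hbd _ (k ^ 2) (hg.pow 2) fun y => ?_
    rw [abs_pow]
    exact pow_le_pow_left₀ (abs_nonneg _) (hk y) 2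
  -- 12 = 6 · 2, where 6 is the enlargement of the selected balls and 2 that of the reference ball.
  -- The factor 4 makes the coefficient of S in the final count equal to 1/2.
  set L : ℝ := 4 * 12 ^ n * N with hL
  have hL0 : 0 < L := by positivity
  -- The doubled ball contains every ball of radius at most δ centred in `ball x₀ δ`.
  set m := ⨍ z in ball x₀ (2 * δ), g z with hm
  set h : Rn n → ℝ := fun y => |g y - m| with hh
  have hh0 : ∀ y, 0 ≤ h y := fun y => abs_nonneg _
  have hhm : AEStronglyMeasurable h := (hg.sub aestronglyMeasurable_const).norm
  have hhb : ∀ y, |h y| ≤ k + |m| := fun y => by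
    rw [abs_of_nonneg (hh0 y)]
    exact (abs_sub _ _).trans (add_le_add_left (hk y) _)
  have hhi : ∀ x r, IntegrableOn h (ball x r) := hbd h _ hhm hhb
  have hhi2 : ∀ x r, IntegrableOn (fun y => h y ^ 2) (ball x r) := by
    refine hbd _ ((k + |m|) ^ 2) (hhm.pow 2) fun y => ?_
    rw [abs_pow]
    exact pow_le_pow_left₀ (abs_nonneg _) (hhb y) 2
  have htot : ∫ y in ball x₀ (2 * δ), h y ≤ N * (unitVol n * (2 * δ) ^ n) := by
    rw [← volume_real_ball hn x₀ (by positivity)]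
    exact hosc x₀ (2 * δ) (by positivity)
  -- With ratio 6, the ball one level above a selected ball is exactly its sixfold enlargement.
  let ρ : ℕ → ℝ := fun j => δ * (6 : ℝ)⁻¹ ^ j
  have hρ0 : ∀ j, 0 < ρ j := fun j => by positivity
  have hρ1 : ∀ j, ρ j ≤ δ := fun j =>
    mul_le_of_le_one_right hδ.le (pow_le_one₀ (by norm_num) (by norm_num))
  have hρs : ∀ j, ρ j = 6 * ρ (j + 1) := fun j => by simp only [ρ, pow_succ]; ring
  have hρt : Tendsto ρ atTop (𝓝[>] 0) := by
    refine tendsto_nhdsWithin_iff.2 ⟨?_, Eventually.of_forall hρ0⟩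
    have := (tendsto_pow_atTop_nhds_zero_of_lt_one (r := (6 : ℝ)⁻¹) (by norm_num)
      (by norm_num)).const_mul δ
    rwa [mul_zero] at this
  -- Off this set h ≤ L almost everywhere by Lebesgue differentiation.
  let X : Set (Rn n) := {x | x ∈ ball x₀ δ ∧ ∃ j, L < ⨍ y in ball x (ρ j), h y}
  have hae : ∀ᵐ x, x ∈ ball x₀ δ → x ∈ X ∨ h x ≤ L := by
    have hloc : LocallyIntegrable h := by
      intro x
      exact ⟨ball x 1, ball_mem_nhds x one_pos, hhi x 1⟩
    filter_upwards [ae_tendsto_ball_average hn hloc] with x hx hxB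
    by_cases hxL : h x ≤ L
    · exact Or.inr hxL
    · left
      refine ⟨hxB, ?_⟩
      have := (hx.comp hρt).eventually (lt_mem_nhds (not_le.1 hxL))
      exact this.exists
  classical
  -- Stopping time: take the first level at which the average exceeds L. It is not level 0, where
  -- the average is at most 2^n N, less than L.
  have hJ : ∀ x ∈ X, ∃ j, (L < ⨍ y in ball x (ρ (j + 1)), h y) ∧ (⨍ y in ball x (ρ j), h y) ≤ L := by
    rintro x ⟨hxB, hex⟩
    have hfind := Nat.find_spec hex
    cases hJ : Nat.find hex with
    | zero =>
      exfalso
      rw [hJ] at hfind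
      have hsub : ball x (ρ 0) ⊆ ball x₀ (2 * δ) := by
        refine ball_subset_ball' ?_
        rw [mem_ball] at hxB
        linarith [hρ1 0]
      have h1 : ∫ y in ball x (ρ 0), h y ≤ N * (unitVol n * (2 * δ) ^ n) :=
        (setIntegral_mono_set (hhi _ _) (Eventually.of_forall hh0) hsub.eventuallyLE).trans htot
      have hv := volume_real_ball hn x (hρ0 0).le
      have e0 : ρ 0 = δ := by simp [ρ]
      rw [setAverage_eq, smul_eq_mul, hv, e0, lt_inv_mul_iff₀ (mul_pos (unitVol_pos n) (by positivity))] at hfind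
      rw [e0] at h1
      have h2 : unitVol n * δ ^ n * L < N * (unitVol n * (2 * δ) ^ n) := hfind.trans_le h1
      rw [mul_pow] at h2
      have h3 : (2 : ℝ) ^ n ≤ 12 ^ n := pow_le_pow_left₀ (by norm_num) (by norm_num) n
      have h4 : 0 < unitVol n * δ ^ n * N := by have := unitVol_pos n; positivity
      have h5 : unitVol n * δ ^ n * N * (4 * 12 ^ n) < unitVol n * δ ^ n * N * 2 ^ n := by
        calc _ = unitVol n * δ ^ n * L := by rw [hL]; ring
          _ < _ := h2
          _ = _ := by ring
      have h6 := lt_of_mul_lt_mul_left h5 h4.le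
      have : (0 : ℝ) < 12 ^ n := by positivity
      linarith
    | succ j =>
      refine ⟨j, hJ ▸ hfind, ?_⟩
      have hlt : j < Nat.find hex := by rw [hJ]; exact Nat.lt_succ_self j
      have := Nat.find_min hex hlt
      exact not_lt.1 this
  choose! J hJ1 hJ2 using hJ
  let R : Rn n → ℝ := fun x => ρ (J x + 1)
  have hR0 : ∀ x, 0 < R x := fun x => hρ0 _
  -- The fivefold closed balls cover X, hence so do the sixfold open balls.
  obtain ⟨u, huX, hdisj, hcov⟩ := Vitali.exists_disjoint_subfamily_covering_enlargement_closedBall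
    X (fun x => x) R δ (fun x _ => hρ1 _) 5 (by norm_num)
  have hdisj' : u.PairwiseDisjoint fun x => ball x (R x) :=
    hdisj.mono fun x => ball_subset_closedBall
  have hcount : u.Countable := hdisj'.countable_of_isOpen (fun x _ => isOpen_ball)
    fun x _ => ⟨x, mem_ball_self (hR0 x)⟩
  have : Countable u := hcount.to_subtype
  have hS0 : 0 ≤ S := by
    have h1 := hS x₀ δ hδ
    have h2 : 0 ≤ ∫ y in ball x₀ δ, (g y - ⨍ z in ball x₀ δ, g z) ^ 2 :=
      integral_nonneg fun _ => sq_nonneg _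
    have hv := volume_real_ball_pos x₀ hδ
    exact nonneg_of_mul_nonneg_left (h2.trans h1) hv
  -- the square of `h` on the enlarged balls
  have hlarge : ∀ x ∈ X, ∫⁻ y in ball x (6 * R x), ENNReal.ofReal (h y ^ 2) ≤
      ENNReal.ofReal (2 * 6 ^ n * (S + L ^ 2)) * volume (ball x (R x)) := by
    intro x hx
    have e6 : 6 * R x = ρ (J x) := (hρs _).symm
    have hr6 : 0 < 6 * R x := by have := hR0 x; positivity
    have hm6 : |(⨍ z in ball x (6 * R x), g z) - m| ≤ L := by
      refine (norm_setAverage_sub_le hr6 (hgi _ _) m).trans ?_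
      have := hJ2 x hx
      rw [← e6, setAverage_eq] at this
      exact this
    rw [← ofReal_integral_eq_lintegral_ofReal (hhi2 _ _) (Eventually.of_forall fun _ => sq_nonneg _),
      volume_ball_eq_ofReal hn x (hR0 x).le, ← ENNReal.ofReal_mul (by positivity)]
    refine ENNReal.ofReal_le_ofReal ?_
    set m6 := ⨍ z in ball x (6 * R x), g z with hm6'
    have hi1 : IntegrableOn (fun y => (g y - m6) ^ 2) (ball x (6 * R x)) := by
      have : ∀ y, (g y - m6) ^ 2 = (g y ^ 2 - 2 * m6 * g y) + m6 ^ 2 := fun y => by ring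
      simp only [this]
      exact ((hgi2 _ _).sub ((hgi _ _).const_mul _)).add (integrableOn_const measure_ball_lt_top.ne)
    calc ∫ y in ball x (6 * R x), h y ^ 2
        ≤ ∫ y in ball x (6 * R x), (2 * (g y - m6) ^ 2 + 2 * L ^ 2) := by
          refine integral_mono (hhi2 _ _) ((hi1.const_mul 2).add
            (integrableOn_const measure_ball_lt_top.ne)) fun y => ?_
          simp only [hh, sq_abs]
          have h1 : (m6 - m) ^ 2 ≤ L ^ 2 := sq_le_sq' (abs_le.1 hm6).1 (abs_le.1 hm6).2
          nlinarith [sq_nonneg ((g y - m6) - (m6 - m))]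
      _ = 2 * (∫ y in ball x (6 * R x), (g y - m6) ^ 2) +
            volume.real (ball x (6 * R x)) * (2 * L ^ 2) := by
          rw [integral_add (hi1.const_mul 2) (integrableOn_const measure_ball_lt_top.ne),
            integral_const_mul, setIntegral_const, smul_eq_mul]
      _ ≤ 2 * (S * volume.real (ball x (6 * R x))) + volume.real (ball x (6 * R x)) * (2 * L ^ 2) := by
          gcongr
          exact hS x _ hr6
      _ = _ := by
          rw [volume_real_ball hn x hr6.le, mul_pow]; ring
  -- the total volume of the selected balls
  have hvol : ENNReal.ofReal L * ∑' x : u, volume (ball (x : Rn n) (R x)) ≤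
      ENNReal.ofReal (N * (unitVol n * (2 * δ) ^ n)) := by
    rw [← ENNReal.tsum_mul_left]
    calc ∑' x : u, ENNReal.ofReal L * volume (ball (x : Rn n) (R x))
        ≤ ∑' x : u, ∫⁻ y in ball (x : Rn n) (R x), ENNReal.ofReal (h y) := by
          refine ENNReal.tsum_le_tsum fun x => ?_
          have h1 := hJ1 x (huX x.2)
          have hv := volume_real_ball_pos (x : Rn n) (hR0 x)
          rw [setAverage_eq, smul_eq_mul, lt_inv_mul_iff₀ hv] at h1
          rw [← ofReal_integral_eq_lintegral_ofReal (hhi _ _) (Eventually.of_forall hh0),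
            ← ofReal_measureReal (measure_ball_lt_top (μ := volume) (x := (x : Rn n)) (r := R x)).ne,
            ← ENNReal.ofReal_mul hL0.le]
          refine ENNReal.ofReal_le_ofReal ?_
          rw [mul_comm]; exact h1.le
      _ = ∫⁻ y in ⋃ x ∈ u, ball x (R x), ENNReal.ofReal (h y) :=
          (lintegral_biUnion hcount (fun _ _ => measurableSet_ball) hdisj' _).symm
      _ ≤ ∫⁻ y in ball x₀ (2 * δ), ENNReal.ofReal (h y) := by
          refine lintegral_mono_set (Set.iUnion₂_subset fun x hx => ?_)
          have hxB := (huX hx).1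
          refine ball_subset_ball' ?_
          rw [mem_ball] at hxB
          have : R x ≤ δ := hρ1 _
          linarith
      _ ≤ _ := by
          rw [← ofReal_integral_eq_lintegral_ofReal (hhi _ _) (Eventually.of_forall hh0)]
          exact ENNReal.ofReal_le_ofReal htot
  have hvol' : ∑' x : u, volume (ball (x : Rn n) (R x)) ≤
      ENNReal.ofReal (L⁻¹ * (N * (unitVol n * (2 * δ) ^ n))) := by
    have hLe : ENNReal.ofReal L ≠ 0 := by simpa using hL0
    rw [ENNReal.ofReal_mul (inv_nonneg.2 hL0.le), ENNReal.ofReal_inv_of_pos hL0]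
    rw [← one_mul (∑' x : u, volume (ball (x : Rn n) (R x))),
      ← ENNReal.inv_mul_cancel hLe ENNReal.ofReal_ne_top, mul_assoc]
    gcongr
  have hmain : ∫⁻ y in ball x₀ δ, ENNReal.ofReal (h y ^ 2) ≤
      ENNReal.ofReal (((S + 3 * L ^ 2) / 2) * volume.real (ball x₀ δ)) := by
    have hV := unitVol_pos n
    calc ∫⁻ y in ball x₀ δ, ENNReal.ofReal (h y ^ 2)
        ≤ ∫⁻ y in ball x₀ δ, (ENNReal.ofReal (L ^ 2) +
            (⋃ x : u, ball (x : Rn n) (6 * R x)).indicator (fun y => ENNReal.ofReal (h y ^ 2)) y) := by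
          refine lintegral_mono_ae ?_
          rw [ae_restrict_iff' measurableSet_ball]
          filter_upwards [hae] with y hy hyB
          rcases hy hyB with hyX | hyL
          · obtain ⟨b, hb, hsub⟩ := hcov y hyX
            have hyb : y ∈ ⋃ x : u, ball (x : Rn n) (6 * R x) := by
              refine Set.mem_iUnion.2 ⟨⟨b, hb⟩, ?_⟩
              have := hsub (mem_closedBall_self (hR0 y).le)
              rw [mem_closedBall] at this
              rw [mem_ball]
              have := hR0 b
              simp only
              linarith
            rw [Set.indicator_of_mem hyb]
            exact le_add_self
          · refine le_trans (ENNReal.ofReal_le_ofReal ?_) le_self_add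
            exact pow_le_pow_left₀ (hh0 y) hyL 2
      _ ≤ ENNReal.ofReal (L ^ 2) * volume (ball x₀ δ) +
            ∫⁻ y in ⋃ x : u, ball (x : Rn n) (6 * R x), ENNReal.ofReal (h y ^ 2) := by
          rw [lintegral_add_left measurable_const, setLIntegral_const,
            ← lintegral_indicator (MeasurableSet.iUnion fun _ => measurableSet_ball)]
          gcongr
          exact Measure.restrict_le_self
      _ ≤ ENNReal.ofReal (L ^ 2) * volume (ball x₀ δ) +
            ENNReal.ofReal (2 * 6 ^ n * (S + L ^ 2)) * ENNReal.ofReal (L⁻¹ * (N * (unitVol n * (2 * δ) ^ n))) := by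
          gcongr
          refine (lintegral_iUnion_le _ _).trans ?_
          refine (ENNReal.tsum_le_tsum fun x : u => hlarge x (huX x.2)).trans ?_
          rw [ENNReal.tsum_mul_left]
          gcongr
      _ = _ := by
          rw [volume_ball_eq_ofReal hn x₀ hδ.le, volume_real_ball hn x₀ hδ.le,
            ← ENNReal.ofReal_mul (by positivity), ← ENNReal.ofReal_mul (by positivity),
            ← ENNReal.ofReal_add (by positivity) (by positivity)]
          congr 1
          have e12 : (12 : ℝ) ^ n = 6 ^ n * 2 ^ n := by rw [← mul_pow]; norm_num
          have eL : 2 * 6 ^ n * 2 ^ n * N * L⁻¹ = 1 / 2 := by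
            rw [hL, e12]; field_simp; norm_num
          rw [mul_pow]
          linear_combination ((S + L ^ 2) * unitVol n * δ ^ n) * eL
  refine (setIntegral_sq_sub_average_le hδ (hgi _ _) (hgi2 _ _) m).trans ?_
  rw [← ofReal_integral_eq_lintegral_ofReal (hhi2 _ _) (Eventually.of_forall fun _ => sq_nonneg _)]
    at hmain
  have hpos : 0 ≤ ((S + 3 * L ^ 2) / 2) * volume.real (ball x₀ δ) := by positivity
  have := (ENNReal.ofReal_le_ofReal_iff hpos).1 hmain
  simpa only [hh, sq_abs] using this

/-- For the supremum S of all mean square oscillations the improvement reads S ≤ (S + 3L²)/2, that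
is S ≤ 3L². Boundedness of g serves only to make S finite; the bound k does not enter the constant.
-/
theorem meanSquareOscillation_le_of_bounded {n : ℕ} (hn : 1 ≤ n) {g : Rn n → ℝ}
    (hg : AEStronglyMeasurable g) {k : ℝ} (hk : ∀ x, |g x| ≤ k) {N : ℝ} (hN : 0 < N)
    (hosc : ∀ x r, 0 < r → ∫ y in ball x r, |g y - ⨍ z in ball x r, g z| ≤
      N * volume.real (ball x r)) (x₀ : Rn n) {δ : ℝ} (hδ : 0 < δ) :
    ∫ y in ball x₀ δ, (g y - ⨍ z in ball x₀ δ, g z) ^ 2 ≤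
      (3 * (4 * 12 ^ n * N) ^ 2) * volume.real (ball x₀ δ) := by
  let D : Rn n × Set.Ioi (0 : ℝ) → ℝ := fun q =>
    (volume.real (ball q.1 q.2))⁻¹ * ∫ y in ball q.1 q.2, (g y - ⨍ z in ball q.1 q.2, g z) ^ 2
  have hk0 : 0 ≤ k := (abs_nonneg _).trans (hk 0)
  have hgi : ∀ x r, IntegrableOn g (ball x r) := fun x r =>
    IntegrableOn.of_bound measure_ball_lt_top hg.restrict k (Eventually.of_forall hk)
  have hgi2 : ∀ x r, IntegrableOn (fun y => g y ^ 2) (ball x r) := fun x r => by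
    refine IntegrableOn.of_bound measure_ball_lt_top (hg.pow 2).restrict (k ^ 2)
      (Eventually.of_forall fun y => ?_)
    rw [norm_pow]
    exact pow_le_pow_left₀ (abs_nonneg _) (hk y) 2
  have hDb : BddAbove (Set.range D) := by
    refine ⟨k ^ 2, ?_⟩
    rintro _ ⟨⟨x, r, hr⟩, rfl⟩
    have hv := volume_real_ball_pos x hr
    simp only [D]
    rw [inv_mul_le_iff₀ hv]
    refine (setIntegral_sq_sub_average_le hr (hgi _ _) (hgi2 _ _) 0).trans ?_
    have h1 : ∫ y in ball x r, (g y - 0) ^ 2 ≤ ∫ y in ball x r, k ^ 2 := by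
      simp only [sub_zero]
      refine integral_mono (hgi2 _ _) (integrableOn_const measure_ball_lt_top.ne) fun y => ?_
      exact sq_le_sq' (abs_le.1 (hk y)).1 (abs_le.1 (hk y)).2
    rwa [setIntegral_const, smul_eq_mul] at h1
  have hS : ∀ x r, 0 < r → ∫ y in ball x r, (g y - ⨍ z in ball x r, g z) ^ 2 ≤
      (⨆ q, D q) * volume.real (ball x r) := by
    intro x r hr
    have hv := volume_real_ball_pos x hr
    have := le_ciSup hDb (⟨x, r, hr⟩ : Rn n × Set.Ioi (0 : ℝ))
    simp only [D] at this
    rw [inv_mul_le_iff₀ hv] at this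
    rw [mul_comm]; exact this
  have hne : Nonempty (Rn n × Set.Ioi (0 : ℝ)) := ⟨⟨0, 1, Set.mem_Ioi.2 one_pos⟩⟩
  have h2 : (⨆ q, D q) ≤ ((⨆ q, D q) + 3 * (4 * 12 ^ n * N) ^ 2) / 2 := by
    refine ciSup_le ?_
    rintro ⟨x, r, hr⟩
    have hv := volume_real_ball_pos x hr
    have := meanSquareOscillation_improve hn hg hk hN hosc hS x hr
    simp only [D]
    rw [inv_mul_le_iff₀ hv, mul_comm]
    exact this
  refine (hS x₀ δ hδ).trans ?_
  have hv := volume_real_ball_pos x₀ hδ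
  gcongr
  linarith

/-- The `L²` form of the John–Nirenberg inequality. -/
theorem johnNirenberg_sq {n : ℕ} (hn : 1 ≤ n) {g : Rn n → ℝ} (hg : LocallyIntegrable g) {N : ℝ}
    (hosc : ∀ x r, 0 < r → ∃ c, ∫ y in ball x r, |g y - c| ≤ N * volume.real (ball x r)) :
    ∃ C : ℝ, 0 ≤ C ∧ ∀ x r, 0 < r →
      ∃ c, ∫⁻ y in ball x r, ENNReal.ofReal ((g y - c) ^ 2) ≤ ENNReal.ofReal (C * r ^ n) := by
  -- The 2 pays for passing from an arbitrary constant to the average, the 1 for strict positivity.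
  set N' : ℝ := 2 * |N| + 1 with hN'
  have hN0 : 0 < N' := by positivity
  have hgi : ∀ x r, IntegrableOn g (ball x r) := fun x r =>
    (hg.integrableOn_isCompact (isCompact_closedBall x r)).mono_set ball_subset_closedBall
  refine ⟨3 * (4 * 12 ^ n * N') ^ 2 * unitVol n, by have := unitVol_pos n; positivity,
    fun x r hr => ⟨⨍ z in ball x r, g z, ?_⟩⟩
  -- Truncation is 1-Lipschitz, so it does not increase oscillation around a constant. The truncated
  -- functions are bounded with a common oscillation bound, and Fatou's lemma removes the
  -- truncation.
  let τ : ℕ → ℝ → ℝ := fun k s => max (-(k : ℝ)) (min s k)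
  have hτb : ∀ k s, |τ k s| ≤ k := by
    intro k s
    have hk : (0 : ℝ) ≤ k := Nat.cast_nonneg k
    refine abs_le.2 ⟨le_max_left _ _, max_le (by linarith) (min_le_right _ _)⟩
  have hτl : ∀ k s s', |τ k s - τ k s'| ≤ |s - s'| := by
    intro k s s'
    have h1 := abs_max_sub_max_le_max (-(k : ℝ)) (min s k) (-(k : ℝ)) (min s' k)
    have h2 := abs_min_sub_min_le_max s (k : ℝ) s' k
    rw [sub_self, abs_zero, max_eq_right (abs_nonneg (min s k - min s' k))] at h1
    rw [sub_self, abs_zero, max_eq_left (abs_nonneg (s - s'))] at h2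
    exact h1.trans h2
  have hτc : ∀ k, Continuous (τ k) := fun k => by fun_prop
  have hτ0 : ∀ k s, |τ k s| ≤ |s| := by
    intro k s
    have := hτl k s 0
    simpa [τ] using this
  have hτt : ∀ s, ∀ᶠ k in atTop, τ k s = s := by
    intro s
    obtain ⟨k₀, hk₀⟩ := exists_nat_ge |s|
    filter_upwards [eventually_ge_atTop k₀] with k hk
    have hk' : |s| ≤ k := hk₀.trans (by exact_mod_cast hk)
    simp only [τ]
    rw [min_eq_left (abs_le.1 hk').2, max_eq_right (abs_le.1 hk').1]
  have hτm : ∀ k, AEStronglyMeasurable (fun y => τ k (g y)) := fun k =>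
    (hτc k).comp_aestronglyMeasurable hg.aestronglyMeasurable
  have hτi : ∀ k x r, IntegrableOn (fun y => τ k (g y)) (ball x r) := fun k x r =>
    IntegrableOn.of_bound measure_ball_lt_top (hτm k).restrict k (Eventually.of_forall fun y => hτb k _)
  have hbdd : ∀ k : ℕ, ∫ y in ball x r, (τ k (g y) - ⨍ z in ball x r, τ k (g z)) ^ 2 ≤
      (3 * (4 * 12 ^ n * N') ^ 2) * volume.real (ball x r) := by
    intro k
    refine meanSquareOscillation_le_of_bounded hn (hτm k) (fun y => hτb k _) hN0 ?_ x hr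
    intro x r hr
    obtain ⟨c, hc⟩ := hosc x r hr
    have hv := volume_real_ball_pos x hr
    refine (setIntegral_norm_sub_average_le hr (hτi k x r) (τ k c)).trans ?_
    have h1 : ∫ y in ball x r, ‖τ k (g y) - τ k c‖ ≤ ∫ y in ball x r, |g y - c| := by
      refine integral_mono ((hτi k x r).sub (integrableOn_const measure_ball_lt_top.ne)).norm
        ((hgi x r).sub (integrableOn_const measure_ball_lt_top.ne)).norm fun y => hτl k _ _
    have h2 : N * volume.real (ball x r) ≤ |N| * volume.real (ball x r) := by
      gcongr; exact le_abs_self N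
    rw [hN']
    nlinarith
  have hmt : Tendsto (fun k : ℕ => ⨍ z in ball x r, τ k (g z)) atTop (𝓝 (⨍ z in ball x r, g z)) := by
    simp only [setAverage_eq]
    refine Tendsto.const_smul ?_ _
    refine tendsto_integral_of_dominated_convergence (fun y => |g y|) (fun k => (hτm k).restrict)
      (hgi x r).norm (fun k => Eventually.of_forall fun y => hτ0 k _)
      (Eventually.of_forall fun y => ?_)
    exact tendsto_const_nhds.congr' ((hτt (g y)).mono fun k hk => hk.symm)
  have hpt : ∀ y, liminf (fun k : ℕ => ENNReal.ofReal
      ((τ k (g y) - ⨍ z in ball x r, τ k (g z)) ^ 2)) atTop =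
      ENNReal.ofReal ((g y - ⨍ z in ball x r, g z) ^ 2) := by
    intro y
    refine Tendsto.liminf_eq ?_
    refine ENNReal.tendsto_ofReal (Tendsto.pow (Tendsto.sub ?_ hmt) 2)
    exact tendsto_const_nhds.congr' ((hτt (g y)).mono fun k hk => hk.symm)
  simp only [← hpt]
  refine (lintegral_liminf_le' fun k => ?_).trans ?_
  · exact (((hτm k).restrict.sub aestronglyMeasurable_const).pow 2).aemeasurable.ennreal_ofReal
  · refine liminf_le_of_le (by isBoundedDefault) fun b hb => ?_
    obtain ⟨k, hk⟩ := hb.exists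
    refine hk.trans ?_
    have hi2 : IntegrableOn (fun y => (τ k (g y) - ⨍ z in ball x r, τ k (g z)) ^ 2) (ball x r) := by
      refine IntegrableOn.of_bound measure_ball_lt_top
        (((hτm k).restrict.sub aestronglyMeasurable_const).pow 2)
        ((k + |⨍ z in ball x r, τ k (g z)|) ^ 2) (Eventually.of_forall fun y => ?_)
      rw [norm_pow]
      refine pow_le_pow_left₀ (norm_nonneg _) ?_ 2
      exact (abs_sub _ _).trans (add_le_add_left (hτb k _) _)
    rw [← ofReal_integral_eq_lintegral_ofReal hi2 (Eventually.of_forall fun _ => sq_nonneg _)]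
    refine ENNReal.ofReal_le_ofReal ((hbdd k).trans_eq ?_)
    rw [volume_real_ball hn x hr.le]; ring

end

noncomputable section

/-! ### Sufficiency: form bounds for divergences -/

open scoped ENNReal

theorem integrableOn_ball_of_locallyIntegrable {n : ℕ} {F : Type*} [NormedAddCommGroup F]
    {g : Rn n → F} (hg : LocallyIntegrable g) (x : Rn n) (r : ℝ) : IntegrableOn g (ball x r) :=
  (hg.integrableOn_isCompact (isCompact_closedBall x r)).mono_set ball_subset_closedBall

/-- ∂_i(v²) = 2v ∂_i v and 2ab ≤ s b² + a²/s with a = hv. The parameter s is left free, to be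
balanced against the scale t later. -/
theorem abs_integral_mul_pd_sq_le {n : ℕ} {h : Rn n → ℝ} (hh : AEStronglyMeasurable h)
    {v : Rn n → ℝ} (hv : IsTest v) {B : ℝ} (hB : 0 ≤ B)
    (hle : ∫⁻ x, ENNReal.ofReal (h x ^ 2 * v x ^ 2) ≤ ENNReal.ofReal B) (i : Fin n) {s : ℝ}
    (hs : 0 < s) :
    |∫ x, h x * pd i (fun y => v y ^ 2) x| ≤ s * (∫ x, gradSq v x) + s⁻¹ * B := by
  have hi : Integrable (fun x => h x ^ 2 * v x ^ 2) := by
    refine ⟨(hh.pow 2).mul hv.sq.continuous.aestronglyMeasurable, ?_⟩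
    rw [hasFiniteIntegral_iff_ofReal (Eventually.of_forall fun x => by positivity)]
    exact hle.trans_lt ENNReal.ofReal_lt_top
  have hI : ∫ x, h x ^ 2 * v x ^ 2 ≤ B := by
    rw [← ofReal_integral_eq_lintegral_ofReal hi (Eventually.of_forall fun x => by positivity)] at hle
    exact (ENNReal.ofReal_le_ofReal_iff hB).1 hle
  have h1 : |∫ x, h x * pd i (fun y => v y ^ 2) x| ≤
      ∫ x, (s * gradSq v x + s⁻¹ * (h x ^ 2 * v x ^ 2)) := by
    rw [← Real.norm_eq_abs]
    refine norm_integral_le_of_norm_le ((hv.gradSq.integrable.const_mul s).add (hi.const_mul _))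
      (Eventually.of_forall fun x => ?_)
    rw [pd_sq i (hv.differentiable x), Real.norm_eq_abs]
    have h2 := pd_sq_le_gradSq i v x
    have h3 : s * pd i v x ^ 2 ≤ s * gradSq v x := by gcongr
    have h4 : ∀ a b : ℝ, |a * (2 * b)| ≤ s * b ^ 2 + s⁻¹ * a ^ 2 := by
      intro a b
      have e : s * b ^ 2 + s⁻¹ * a ^ 2 - 2 * (a * b) = s⁻¹ * (a - s * b) ^ 2 := by
        field_simp; ring
      have e' : s * b ^ 2 + s⁻¹ * a ^ 2 + 2 * (a * b) = s⁻¹ * (a + s * b) ^ 2 := by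
        field_simp; ring
      have p1 : 0 ≤ s⁻¹ * (a - s * b) ^ 2 := by positivity
      have p2 : 0 ≤ s⁻¹ * (a + s * b) ^ 2 := by positivity
      rw [abs_le]
      constructor <;> linarith
    have h5 := h4 (h x * v x) (pd i v x)
    rw [show h x * (2 * (v x * pd i v x)) = h x * v x * (2 * pd i v x) by ring]
    refine h5.trans ?_
    rw [mul_pow]
    linarith
  refine h1.trans ?_
  rw [integral_add (hv.gradSq.integrable.const_mul s) (hi.const_mul _), integral_const_mul,
    integral_const_mul]
  gcongr

/-- The trace inequality for the weight `h²`. -/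
theorem trace_inequality_sq_weight {n : ℕ} (hn : 2 ≤ n) {a : ℝ} (ha : 0 < a) (ha2 : a ≤ 2) :
    ∃ C : ℝ, 0 ≤ C ∧ ∀ (h : Rn n → ℝ), AEStronglyMeasurable h →
      LocallyIntegrable (fun x => h x ^ 2) → ∀ (M t : ℝ), 0 ≤ M → 0 < t →
      (∀ y r, 0 < r → r ≤ 3 * t → ∫ x in ball y r, h x ^ 2 ≤ M * r ^ ((n : ℝ) - 2 + a)) →
      ∀ v : Rn n → ℝ, IsTest v → ∫⁻ x, ENNReal.ofReal (h x ^ 2 * v x ^ 2) ≤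
        ENNReal.ofReal (C * M * t ^ (a - 2) * energy t v) := by
  obtain ⟨C, hC, H⟩ := trace_inequality hn ha ha2
  refine ⟨C, hC, fun h hh hh2 M t hM ht hle v hv => ?_⟩
  have hm : AEMeasurable (fun x => ENNReal.ofReal (h x ^ 2)) volume :=
    (hh.pow 2).aemeasurable.ennreal_ofReal
  have := H (volume.withDensity fun x => ENNReal.ofReal (h x ^ 2)) M t hM ht ?_ v hv
  · refine le_trans (le_of_eq ?_) this
    rw [lintegral_withDensity_eq_lintegral_mul₀ hm
      hv.sq.continuous.measurable.ennreal_ofReal.aemeasurable]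
    refine lintegral_congr fun x => ?_
    rw [Pi.mul_apply, ENNReal.ofReal_mul (sq_nonneg _)]
  · intro y r hr hrt
    rw [withDensity_apply _ measurableSet_ball, ← ofReal_integral_eq_lintegral_ofReal
      (integrableOn_ball_of_locallyIntegrable hh2 y r) (Eventually.of_forall fun _ => sq_nonneg _)]
    exact ENNReal.ofReal_le_ofReal (hle y r hr hrt)

/-- `g ∂_i` is form bounded with the scaling of exponent `p`. -/
def ScalarFormBound {n : ℕ} (p : ℝ) (g : Rn n → ℝ) : Prop :=
  ∃ C : ℝ, 0 ≤ C ∧ ∀ (i : Fin n) (v : Rn n → ℝ), IsTest v → ∀ t : ℝ, 0 < t →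
    |∫ x, g x * pd i (fun y => v y ^ 2) x| ≤ C * t ^ (-2 * p) * energy t v

theorem integral_gradSq_le_energy {n : ℕ} {t : ℝ} (ht : 0 < t) (v : Rn n → ℝ) :
    ∫ x, gradSq v x ≤ t ^ (-2 : ℝ) * energy t v := by
  have hL : 0 ≤ ∫ x, v x ^ 2 := integral_nonneg fun _ => sq_nonneg _
  have ht2 : t ^ (-2 : ℝ) = (t ^ 2)⁻¹ := by rw [Real.rpow_neg ht.le]; norm_cast
  rw [ht2, energy, mul_add, inv_mul_cancel_left₀ (by positivity)]
  have : 0 ≤ (t ^ 2)⁻¹ * ∫ x, v x ^ 2 := by positivity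
  linarith

theorem integral_sq_le_energy {n : ℕ} (t : ℝ) (v : Rn n → ℝ) :
    ∫ x, v x ^ 2 ≤ energy t v := by
  have hE : 0 ≤ ∫ x, gradSq v x := integral_nonneg fun _ => gradSq_nonneg _ _
  have : 0 ≤ t ^ 2 * ∫ x, gradSq v x := by positivity
  rw [energy]; linarith

/-- The Morrey exponent is n - 2 + a with a = 4 - 4p, which lies in (0, 2) precisely for 1/2 < p <
1. The choice s = t^(2-2p) turns both terms into t^(-2p) times the energy. -/
theorem scalarFormBound_of_morrey {n : ℕ} (hn : 2 ≤ n) {p : ℝ} (hp : 1 / 2 < p) (hp1 : p < 1)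
    {g : Rn n → ℝ} (hg : AEStronglyMeasurable g) (hg2 : LocallyIntegrable (fun x => g x ^ 2))
    {M : ℝ} (hM : 0 ≤ M)
    (hle : ∀ y r, 0 < r → ∫ x in ball y r, g x ^ 2 ≤ M * r ^ ((n : ℝ) + 2 - 4 * p)) :
    ScalarFormBound p g := by
  obtain ⟨C, hC, H⟩ := trace_inequality_sq_weight hn (a := 4 - 4 * p) (by linarith) (by linarith)
  refine ⟨1 + C * M, by positivity, fun i v hv t ht => ?_⟩
  have h1 := H g hg hg2 M t hM ht (fun y r hr _ => by
    rw [show (n : ℝ) - 2 + (4 - 4 * p) = n + 2 - 4 * p by ring]; exact hle y r hr) v hv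
  have hE := energy_nonneg t v
  have h2 := abs_integral_mul_pd_sq_le hg hv (by positivity) h1 i (s := t ^ (2 - 2 * p))
    (Real.rpow_pos_of_pos ht _)
  refine h2.trans ?_
  have e1 : t ^ (2 - 2 * p) * t ^ (-2 : ℝ) = t ^ (-2 * p) := by
    rw [← Real.rpow_add ht]; congr 1; ring
  have e2 : (t ^ (2 - 2 * p))⁻¹ * t ^ (4 - 4 * p - 2) = t ^ (-2 * p) := by
    rw [← Real.rpow_neg ht.le, ← Real.rpow_add ht]; congr 1; ring
  calc t ^ (2 - 2 * p) * (∫ x, gradSq v x) +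
        (t ^ (2 - 2 * p))⁻¹ * (C * M * t ^ (4 - 4 * p - 2) * energy t v)
      ≤ t ^ (2 - 2 * p) * (t ^ (-2 : ℝ) * energy t v) +
        (t ^ (2 - 2 * p))⁻¹ * (C * M * t ^ (4 - 4 * p - 2) * energy t v) := by
        gcongr
        exact integral_gradSq_le_energy ht v
    _ = _ := by linear_combination (energy t v) * e1 + (C * M * energy t v) * e2

/-- The integral of the standard cutoff. -/
def bumpMass (n : ℕ) : ℝ := ∫ x, unitBump n x

theorem bumpMass_pos (n : ℕ) : 0 < bumpMass n := (unitBump n).integral_pos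

/-- The standard mollifier at scale `t`. -/
def mollifier {n : ℕ} (t : ℝ) (x : Rn n) : ℝ := (bumpMass n * t ^ n)⁻¹ * cutoff 0 t x

theorem isTest_mollifier {n : ℕ} {t : ℝ} (ht : 0 < t) : IsTest (mollifier t : Rn n → ℝ) :=
  (isTest_cutoff ht).const_mul _

theorem integral_mollifier {n : ℕ} {t : ℝ} (ht : 0 < t) : ∫ x : Rn n, mollifier t x = 1 := by
  have hb := bumpMass_pos n
  simp only [mollifier, cutoff, sub_zero]
  rw [integral_const_mul, Measure.integral_comp_smul, finrank_euclideanSpace_fin,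
    abs_of_pos (by positivity), smul_eq_mul]
  change _ * (_ * bumpMass n) = 1
  rw [inv_pow, inv_inv, mul_comm (t ^ n)]
  exact inv_mul_cancel₀ (by positivity)

theorem cutoff_zero_of_notMem {n : ℕ} {t : ℝ} (ht : 0 < t) {x : Rn n} (hx : x ∉ ball 0 (3 * t)) :
    x ∉ tsupport (cutoff (0 : Rn n) t) := by
  intro h
  have h2 := tsupport_cutoff_subset ht h
  rw [mem_closedBall] at h2
  rw [mem_ball] at hx
  linarith

/-! ### Form bounds from L² oscillation. -/

section campanato

variable {n : ℕ} {g : Rn n → ℝ} {α M : ℝ} {c : Rn n → ℝ → ℝ}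

theorem integrableOn_sub_sq (hg : LocallyIntegrable g)
    (hg2 : LocallyIntegrable (fun x => g x ^ 2)) (a : ℝ) (x : Rn n) (r : ℝ) :
    IntegrableOn (fun y => (g y - a) ^ 2) (ball x r) := by
  have h : ∀ y, (g y - a) ^ 2 = (g y ^ 2 - 2 * a * g y) + a ^ 2 := fun y => by ring
  simp only [h]
  exact ((integrableOn_ball_of_locallyIntegrable hg2 x r).sub
    ((integrableOn_ball_of_locallyIntegrable hg x r).const_mul _)).add
    (integrableOn_const measure_ball_lt_top.ne)

theorem integrableOn_sub_const (hg : LocallyIntegrable g) (a : ℝ) (x : Rn n) (r : ℝ) :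
    IntegrableOn (fun y => g y - a) (ball x r) :=
  (integrableOn_ball_of_locallyIntegrable hg x r).sub (integrableOn_const measure_ball_lt_top.ne)

/-- Cauchy–Schwarz in additive form, |z| ≤ r^α/2 + r^(-α) z²/2: the expected size r^α of the
oscillation is the balancing weight. -/
theorem setIntegral_abs_sub_le (hn : 1 ≤ n) (hg : LocallyIntegrable g)
    (hg2 : LocallyIntegrable (fun x => g x ^ 2))
    (hc : ∀ x r, 0 < r → ∫ y in ball x r, (g y - c x r) ^ 2 ≤ M * r ^ ((n : ℝ) + 2 * α))
    (x : Rn n) {r : ℝ} (hr : 0 < r) :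
    ∫ y in ball x r, |g y - c x r| ≤ (unitVol n + M) / 2 * r ^ ((n : ℝ) + α) := by
  have hsq := integrableOn_sub_sq hg hg2 (c x r) x r
  have hrα : 0 < r ^ α := Real.rpow_pos_of_pos hr _
  calc ∫ y in ball x r, |g y - c x r|
      ≤ ∫ y in ball x r, (r ^ α / 2 + (r ^ α)⁻¹ / 2 * (g y - c x r) ^ 2) := by
        refine integral_mono (integrableOn_sub_const hg _ x r).norm
          ((integrableOn_const measure_ball_lt_top.ne).add (hsq.const_mul _)) fun y => ?_
        have e : r ^ α / 2 + (r ^ α)⁻¹ / 2 * (g y - c x r) ^ 2 - |g y - c x r| =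
            (r ^ α)⁻¹ / 2 * (|g y - c x r| - r ^ α) ^ 2 := by
          rw [← sq_abs (g y - c x r)]; field_simp; ring
        have p : 0 ≤ (r ^ α)⁻¹ / 2 * (|g y - c x r| - r ^ α) ^ 2 := by positivity
        simp only
        linarith
    _ = volume.real (ball x r) * (r ^ α / 2) +
          (r ^ α)⁻¹ / 2 * ∫ y in ball x r, (g y - c x r) ^ 2 := by
        have hi : IntegrableOn (fun _ => r ^ α / 2) (ball x r) :=
          integrableOn_const measure_ball_lt_top.ne
        rw [integral_add hi (hsq.const_mul _), setIntegral_const, integral_const_mul, smul_eq_mul]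
    _ ≤ volume.real (ball x r) * (r ^ α / 2) +
          (r ^ α)⁻¹ / 2 * (M * r ^ ((n : ℝ) + 2 * α)) := by
        gcongr
        exact hc x r hr
    _ = _ := by
        rw [volume_real_ball hn x hr.le, Real.rpow_add hr, Real.rpow_add hr, Real.rpow_natCast,
          show 2 * α = α + α by ring, Real.rpow_add hr]
        field_simp

/-- On the smaller ball g is close in mean to both constants, so these are close to each other. The
centres may differ, which lets constants be chained both in scale and in space. -/
theorem abs_sub_le_of_ball_subset (hn : 1 ≤ n) (hM : 0 ≤ M) (hα : 0 ≤ α)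
    (hg : LocallyIntegrable g) (hg2 : LocallyIntegrable (fun x => g x ^ 2))
    (hc : ∀ x r, 0 < r → ∫ y in ball x r, (g y - c x r) ^ 2 ≤ M * r ^ ((n : ℝ) + 2 * α))
    {x y : Rn n} {r : ℝ} (hr : 0 < r) (hsub : ball x r ⊆ ball y (2 * r)) :
    |c x r - c y (2 * r)| ≤ (unitVol n)⁻¹ * (unitVol n + M) * 2 ^ n * (2 * r) ^ α := by
  have hV := unitVol_pos n
  have h1 := setIntegral_abs_sub_le hn hg hg2 hc x hr
  have h2 := setIntegral_abs_sub_le hn hg hg2 hc y (r := 2 * r) (by positivity)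
  have h3 : ∫ z in ball x r, |g z - c y (2 * r)| ≤ ∫ z in ball y (2 * r), |g z - c y (2 * r)| :=
    setIntegral_mono_set (integrableOn_sub_const hg _ _ _).norm
      (Eventually.of_forall fun _ => abs_nonneg _) hsub.eventuallyLE
  have h4 : volume.real (ball x r) * |c x r - c y (2 * r)| ≤
      (∫ z in ball x r, |g z - c x r|) + ∫ z in ball x r, |g z - c y (2 * r)| := by
    have hi1 : IntegrableOn (fun z => |g z - c x r|) (ball x r) :=
      (integrableOn_sub_const hg _ _ _).norm
    have hi2 : IntegrableOn (fun z => |g z - c y (2 * r)|) (ball x r) :=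
      (integrableOn_sub_const hg _ _ _).norm
    rw [← integral_add hi1 hi2, ← smul_eq_mul, ← setIntegral_const]
    refine integral_mono (integrableOn_const measure_ball_lt_top.ne) (hi1.add hi2) fun z => ?_
    have := abs_sub_le (c x r) (g z) (c y (2 * r))
    rw [abs_sub_comm (c x r) (g z)] at this
    exact this
  have h5 : r ^ ((n : ℝ) + α) ≤ (2 * r) ^ ((n : ℝ) + α) :=
    Real.rpow_le_rpow hr.le (by linarith) (by positivity)
  have h6 : volume.real (ball x r) * |c x r - c y (2 * r)| ≤
      (unitVol n + M) * (2 * r) ^ ((n : ℝ) + α) := by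
    have : (unitVol n + M) / 2 * r ^ ((n : ℝ) + α) ≤ (unitVol n + M) / 2 * (2 * r) ^ ((n : ℝ) + α) := by
      gcongr
    linarith
  rw [volume_real_ball hn x hr.le, Real.rpow_add (by positivity), Real.rpow_natCast, mul_pow] at h6
  have h7 : r ^ n * (unitVol n * |c x r - c y (2 * r)|) ≤
      r ^ n * ((unitVol n + M) * 2 ^ n * (2 * r) ^ α) := by linarith
  have h8 := le_of_mul_le_mul_left h7 (by positivity)
  rw [mul_assoc, mul_assoc, le_inv_mul_iff₀ hV]
  linarith

/-- Absorbs the square of the logarithmic drift of averages over k halvings into one power of the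
ratio of radii. -/
theorem sq_le_two_mul_two_pow (k : ℕ) : (k : ℝ) ^ 2 ≤ 2 * 2 ^ k := by
  induction k with
  | zero => simp
  | succ k ih =>
    have h : (k : ℝ) + 1 ≤ 2 ^ k := by exact_mod_cast Nat.lt_two_pow_self
    have e : (2 : ℝ) * 2 ^ (k + 1) = 2 * 2 ^ k + 2 * 2 ^ k := by rw [pow_succ]; ring
    rw [e]
    push_cast
    linarith [add_sq (k : ℝ) 1]

/-- The oscillation around the constant of a large ball grows at most like a small power. -/
theorem setIntegral_sq_sub_large_le (hn : 1 ≤ n) (hM : 0 ≤ M) (hα : 0 ≤ α)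
    (hg : LocallyIntegrable g) (hg2 : LocallyIntegrable (fun x => g x ^ 2))
    (hc : ∀ x r, 0 < r → ∫ y in ball x r, (g y - c x r) ^ 2 ≤ M * r ^ ((n : ℝ) + 2 * α)) :
    ∃ A : ℝ, 0 ≤ A ∧ ∀ (y : Rn n) (r T : ℝ), 0 < r → r ≤ T →
      ∫ x in ball y r, (g x - c y T) ^ 2 ≤ A * T ^ (1 + 2 * α) * r ^ ((n : ℝ) - 1) := by
  have hV := unitVol_pos n
  set D := (unitVol n)⁻¹ * (unitVol n + M) * 2 ^ n with hD
  have hD0 : 0 ≤ D := by positivity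
  -- Telescoping over k halvings. For α = 0 the steps do not decay, so the bound grows linearly in
  -- k.
  have hscale : ∀ (y : Rn n) (T : ℝ), 0 < T → ∀ k : ℕ,
      |c y (T * (2 : ℝ)⁻¹ ^ k) - c y T| ≤ k * (D * T ^ α) := by
    intro y T hT k
    induction k with
    | zero => simp
    | succ k ih =>
      have hr : 0 < T * (2 : ℝ)⁻¹ ^ (k + 1) := by positivity
      have e : 2 * (T * (2 : ℝ)⁻¹ ^ (k + 1)) = T * (2 : ℝ)⁻¹ ^ k := by rw [pow_succ]; ring
      have h1 := abs_sub_le_of_ball_subset hn hM hα hg hg2 hc hr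
        (ball_subset_ball (x := y) (by linarith : T * (2 : ℝ)⁻¹ ^ (k + 1) ≤ 2 * (T * (2 : ℝ)⁻¹ ^ (k + 1))))
      rw [e] at h1
      have h2 : (T * (2 : ℝ)⁻¹ ^ k) ^ α ≤ T ^ α :=
        Real.rpow_le_rpow (by positivity)
          (mul_le_of_le_one_right hT.le (pow_le_one₀ (by norm_num) (by norm_num))) hα
      have h3 := abs_sub_le (c y (T * (2 : ℝ)⁻¹ ^ (k + 1))) (c y (T * (2 : ℝ)⁻¹ ^ k)) (c y T)
      have h4 : D * (T * (2 : ℝ)⁻¹ ^ k) ^ α ≤ D * T ^ α := by gcongr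
      push_cast
      linarith
  refine ⟨(2 * M + 4 * unitVol n * D ^ 2) * 2 ^ n, by positivity, fun y r T hr hrT => ?_⟩
  have hT : 0 < T := hr.trans_le hrT
  obtain ⟨k, hk1, hk2⟩ := exists_nat_pow_near_of_lt_one (x := r / T) (y := (2 : ℝ)⁻¹)
    (by positivity) ((div_le_one hT).2 hrT) (by norm_num) (by norm_num)
  rw [lt_div_iff₀ hT] at hk1
  rw [div_le_iff₀ hT] at hk2
  set R := T * (2 : ℝ)⁻¹ ^ k with hR
  have hR0 : 0 < R := by positivity
  have hRT : R ≤ T := mul_le_of_le_one_right hT.le (pow_le_one₀ (by norm_num) (by norm_num))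
  have hrR : r ≤ R := by rw [hR, mul_comm]; exact hk2
  have hR2 : R ≤ 2 * r := by rw [hR]; rw [pow_succ] at hk1; linarith
  have h2k : (2 : ℝ) ^ k * R = T := by
    rw [hR, mul_left_comm, ← mul_pow]; norm_num
  have hTα : T ^ (2 * α) = T ^ α * T ^ α := by rw [← Real.rpow_add hT]; congr 1; ring
  calc ∫ x in ball y r, (g x - c y T) ^ 2
      ≤ ∫ x in ball y R, (g x - c y T) ^ 2 :=
        setIntegral_mono_set (integrableOn_sub_sq hg hg2 _ _ _)
          (Eventually.of_forall fun _ => sq_nonneg _) (ball_subset_ball hrR).eventuallyLE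
    _ ≤ ∫ x in ball y R, (2 * (g x - c y R) ^ 2 + 2 * (k * (D * T ^ α)) ^ 2) := by
        refine integral_mono (integrableOn_sub_sq hg hg2 _ _ _)
          (((integrableOn_sub_sq hg hg2 _ _ _).const_mul 2).add
            (integrableOn_const measure_ball_lt_top.ne)) fun x => ?_
        have h1 := hscale y T hT k
        have h2 : (c y R - c y T) ^ 2 ≤ (k * (D * T ^ α)) ^ 2 :=
          sq_le_sq' (abs_le.1 h1).1 (abs_le.1 h1).2
        simp only
        nlinarith [sq_nonneg ((g x - c y R) - (c y R - c y T))]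
    _ = 2 * (∫ x in ball y R, (g x - c y R) ^ 2) +
          volume.real (ball y R) * (2 * (k * (D * T ^ α)) ^ 2) := by
        rw [integral_add ((integrableOn_sub_sq hg hg2 _ _ _).const_mul 2)
          (integrableOn_const measure_ball_lt_top.ne), integral_const_mul, setIntegral_const,
          smul_eq_mul]
    -- The factor k² is traded for 2^k = T / R. This costs one power of the radius, and the exponent
    -- n - 1 is what the trace inequality requires for a = 1.
    _ ≤ 2 * (M * R ^ ((n : ℝ) + 2 * α)) + unitVol n * R ^ n * (2 * (2 * 2 ^ k * (D ^ 2 * T ^ (2 * α)))) := by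
        rw [volume_real_ball hn y hR0.le]
        gcongr
        · exact hc y R hR0
        · rw [mul_pow, mul_pow, hTα, ← pow_two]
          gcongr
          exact sq_le_two_mul_two_pow k
    _ ≤ (2 * M + 4 * unitVol n * D ^ 2) * (2 ^ k * R ^ n * T ^ (2 * α)) := by
        have h1 : R ^ ((n : ℝ) + 2 * α) ≤ 2 ^ k * R ^ n * T ^ (2 * α) := by
          rw [Real.rpow_add hR0, Real.rpow_natCast]
          have : R ^ (2 * α) ≤ T ^ (2 * α) := Real.rpow_le_rpow hR0.le hRT (by positivity)
          have h2 : (1 : ℝ) ≤ 2 ^ k := one_le_pow₀ (by norm_num)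
          calc R ^ n * R ^ (2 * α) ≤ R ^ n * T ^ (2 * α) := by gcongr
            _ = 1 * R ^ n * T ^ (2 * α) := by ring
            _ ≤ _ := by gcongr
        have h3 : 2 * M * R ^ ((n : ℝ) + 2 * α) ≤ 2 * M * (2 ^ k * R ^ n * T ^ (2 * α)) := by gcongr
        linarith
    _ = (2 * M + 4 * unitVol n * D ^ 2) * (T ^ (1 + 2 * α) * R ^ ((n : ℝ) - 1)) := by
        rw [Real.rpow_add hT, Real.rpow_one, Real.rpow_sub_one hR0.ne', Real.rpow_natCast, ← h2k]
        field_simp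
    _ ≤ (2 * M + 4 * unitVol n * D ^ 2) * (T ^ (1 + 2 * α) * (2 ^ n * r ^ ((n : ℝ) - 1))) := by
        gcongr
        have hn' : (1 : ℝ) ≤ n := by exact_mod_cast hn
        calc R ^ ((n : ℝ) - 1) ≤ (2 * r) ^ ((n : ℝ) - 1) :=
              Real.rpow_le_rpow hR0.le hR2 (by linarith)
          _ = 2 ^ ((n : ℝ) - 1) * r ^ ((n : ℝ) - 1) := Real.mul_rpow (by norm_num) hr.le
          _ ≤ _ := by
            gcongr
            rw [← Real.rpow_natCast]
            exact Real.rpow_le_rpow_of_exponent_le (by norm_num) (by linarith)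
    _ = _ := by ring

/-- Subtracting a ∫ ψ replaces g by g - a under the convolution. It serves for the mollifier, of
integral one, and for its derivatives, of integral zero. -/
theorem abs_convolution_sub_le (hg : LocallyIntegrable g) {ψ : Rn n → ℝ} (hψ : IsTest ψ) {B t : ℝ}
    (hB : ∀ z, |ψ z| ≤ B) (hsupp : ∀ z, z ∉ ball (0 : Rn n) (3 * t) → ψ z = 0) (a : ℝ) (x y : Rn n)
    (T : ℝ) (hsub : ball x (3 * t) ⊆ ball y T) :
    |(g ⋆[ContinuousLinearMap.mul ℝ ℝ, volume] ψ) x - a * ∫ z, ψ z| ≤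
      B * ∫ z in ball y T, |g z - a| := by
  have hψx : IsTest (fun z => ψ (x - z)) := isTest_comp_const_sub hψ x
  have hi1 : Integrable (fun z => g z * ψ (x - z)) :=
    hg.integrable_smul_right_of_hasCompactSupport hψx.continuous hψx.2
  have e : (g ⋆[ContinuousLinearMap.mul ℝ ℝ, volume] ψ) x - a * ∫ z, ψ z
      = ∫ z, (g z - a) * ψ (x - z) := by
    have h1 : ∫ z, ψ z = ∫ z, ψ (x - z) := (integral_sub_left_eq_self ψ volume x).symm
    rw [h1, ← integral_const_mul, convolution_def]
    simp only [ContinuousLinearMap.mul_apply']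
    rw [← integral_sub hi1 (hψx.integrable.const_mul a)]
    congr 1; ext z; ring
  have hB0 : 0 ≤ B := (abs_nonneg _).trans (hB 0)
  rw [e, ← integral_const_mul, ← integral_indicator measurableSet_ball, ← Real.norm_eq_abs]
  refine norm_integral_le_of_norm_le ?_ (Eventually.of_forall fun z => ?_)
  · have hi : IntegrableOn (fun z => B * |g z - a|) (ball y T) :=
      ((integrableOn_sub_const hg a y T).norm).const_mul B
    exact hi.integrable_indicator measurableSet_ball
  · rw [norm_mul, Real.norm_eq_abs, Real.norm_eq_abs]
    by_cases hz : z ∈ ball y T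
    · rw [Set.indicator_of_mem hz, mul_comm]
      gcongr
      exact hB _
    · have : x - z ∉ ball (0 : Rn n) (3 * t) := by
        intro h
        refine hz (hsub ?_)
        rw [mem_ball_zero_iff] at h
        rw [mem_ball, dist_eq_norm, norm_sub_rev]
        exact h
      rw [hsupp _ this]
      simp [Set.indicator_of_notMem hz]

/-- Split g = G + (g - G) with G the mollification at scale t. The smooth part is integrated by
parts, using |∂_i G| ≤ const · t^(α-1); the rough part goes through the trace inequality with weight
(g - G)², whose mass on balls of radius r ≤ 3t is at most const · t^(1+2α) r^(n-1). -/
theorem scalarFormBound_of_campanato (hn : 2 ≤ n) (hM : 0 ≤ M) (hα : 0 ≤ α)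
    (hg : LocallyIntegrable g) (hg2 : LocallyIntegrable (fun x => g x ^ 2))
    (hc : ∀ x r, 0 < r → ∫ y in ball x r, (g y - c x r) ^ 2 ≤ M * r ^ ((n : ℝ) + 2 * α)) :
    ScalarFormBound ((1 - α) / 2) g := by
  have hn1 : 1 ≤ n := by lia
  have hV := unitVol_pos n
  have hκ := bumpMass_pos n
  obtain ⟨C, hC, H⟩ := trace_inequality_sq_weight hn (a := 1) (by norm_num) (by norm_num)
  obtain ⟨A₀, hA₀, hcut⟩ := exists_norm_fderiv_cutoff_le n
  obtain ⟨A₁, hA₁, hlarge⟩ := setIntegral_sq_sub_large_le hn1 hM hα hg hg2 hc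
  -- bound for the mollified function minus the constant of a comparable ball
  set A₂ := (bumpMass n)⁻¹ * ((unitVol n + M) / 2) * 6 ^ ((n : ℝ) + α) with hA₂
  have hA₂0 : 0 ≤ A₂ := by positivity
  set A₃ := (A₁ * 6 ^ (1 + 2 * α) * 2 + 6 * A₂ ^ 2 * unitVol n) with hA₃
  have hA₃0 : 0 ≤ A₃ := by positivity
  refine ⟨1 + C * A₃ + A₀ * A₂, by positivity, fun i v hv t ht => ?_⟩
  let G : Rn n → ℝ := g ⋆[ContinuousLinearMap.mul ℝ ℝ, volume] (mollifier t)
  have hmt := isTest_mollifier (n := n) ht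
  have hG : ContDiff ℝ ∞ G := hmt.2.contDiff_convolution_right _ hg hmt.1
  have hmass : 0 < bumpMass n * t ^ n := by positivity
  have hosc : ∀ y : Rn n, ∀ K, 0 ≤ K → (K * (bumpMass n * t ^ n)⁻¹) * ∫ z in ball y (6 * t), |g z - c y (6 * t)| ≤
      K * (A₂ * t ^ α) := by
    intro y K hK
    have h1 := setIntegral_abs_sub_le hn1 hg hg2 hc y (r := 6 * t) (by positivity)
    rw [mul_assoc]
    refine mul_le_mul_of_nonneg_left ?_ hK
    rw [inv_mul_le_iff₀ hmass]
    refine h1.trans_eq ?_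
    rw [Real.mul_rpow (by norm_num) ht.le, Real.rpow_add ht, Real.rpow_natCast, hA₂]
    field_simp
  -- Radius 6t = 3t + 3t: distance to the reference centre plus the radius that contains the support
  -- of the mollifier.
  have hG1 : ∀ x y : Rn n, dist x y ≤ 3 * t → |G x - c y (6 * t)| ≤ A₂ * t ^ α := by
    intro x y hxy
    have h1 := abs_convolution_sub_le hg hmt (B := (bumpMass n * t ^ n)⁻¹) (t := t) (fun z => ?_)
      (fun z hz => ?_) (c y (6 * t)) x y (6 * t) (ball_subset_ball' (by linarith))
    · rw [integral_mollifier ht, mul_one] at h1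
      have := hosc y 1 zero_le_one
      simp only [one_mul] at this
      exact h1.trans this
    · rw [mollifier, abs_mul, abs_of_pos (by positivity), abs_of_nonneg cutoff_nonneg]
      exact mul_le_of_le_one_right (by positivity) cutoff_le_one
    · rw [mollifier, image_eq_zero_of_notMem_tsupport (cutoff_zero_of_notMem ht hz), mul_zero]
  have hG2 : ∀ x, |pd i G x| ≤ A₀ / t * (A₂ * t ^ α) := by
    intro x
    have e : pd i G x = (g ⋆[ContinuousLinearMap.mul ℝ ℝ, volume] (pd i (mollifier t))) x := by
      have h := hmt.2.hasFDerivAt_convolution_right (ContinuousLinearMap.mul ℝ ℝ) hg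
        (hmt.1.of_le (by simp)) x
      rw [pd, h.fderiv, convolution_precompR_apply _ hg
        (hmt.2.fderiv (𝕜 := ℝ)) (hmt.1.continuous_fderiv (by simp))]
      rfl
    have e2 : ∀ z, pd i (mollifier t) z = (bumpMass n * t ^ n)⁻¹ * pd i (cutoff (0 : Rn n) t) z :=
      fun z => pd_const_mul i _ ((isTest_cutoff ht).differentiable z)
    -- Because the derivative has mean zero, ∂_i G sees only the oscillation of g, not its size.
    have h0 : ∫ z, pd i (mollifier t : Rn n → ℝ) z = 0 := by
      have := integral_mul_pd i (f := fun _ => (1 : ℝ)) contDiff_const hmt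
      simpa [pd] using this
    have h1 := abs_convolution_sub_le hg (hmt.pd i) (B := A₀ / t * (bumpMass n * t ^ n)⁻¹) (t := t)
      (fun z => ?_) (fun z hz => ?_) (c x (6 * t)) x x (6 * t) (ball_subset_ball (by linarith))
    · rw [h0, mul_zero, sub_zero, ← e] at h1
      exact h1.trans (hosc x (A₀ / t) (by positivity))
    · rw [e2, abs_mul, abs_of_pos (by positivity), mul_comm]
      gcongr
      exact (abs_pd_le _ _ _).trans (hcut 0 z t ht)
    · rw [e2, pd, image_eq_zero_of_notMem_tsupport (f := fderiv ℝ (cutoff (0 : Rn n) t))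
        (fun h => cutoff_zero_of_notMem ht hz (tsupport_fderiv_subset ℝ h))]
      simp
  have hdm : AEStronglyMeasurable (fun x => g x - G x) :=
    hg.aestronglyMeasurable.sub hG.continuous.aestronglyMeasurable
  have hd2 : LocallyIntegrable (fun x => (g x - G x) ^ 2) := by
    have : (fun x => (g x - G x) ^ 2) = fun x => (g x ^ 2 - g x * (2 * G x)) + G x ^ 2 := by
      ext x; ring
    rw [this]
    refine (hg2.sub ?_).add (hG.continuous.pow 2).locallyIntegrable
    rw [locallyIntegrable_iff]
    intro K hK
    exact (hg.integrableOn_isCompact hK).mul_continuousOn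
      (continuous_const.mul hG.continuous).continuousOn hK
  have hw : ∀ y r, 0 < r → r ≤ 3 * t → ∫ x in ball y r, (g x - G x) ^ 2 ≤
      (A₃ * t ^ (1 + 2 * α)) * r ^ ((n : ℝ) - 2 + 1) := by
    intro y r hr hrt
    have h1 := hlarge y r (6 * t) hr (by linarith)
    have htα : t ^ (2 * α) = t ^ α * t ^ α := by rw [← Real.rpow_add ht]; congr 1; ring
    calc ∫ x in ball y r, (g x - G x) ^ 2
        ≤ ∫ x in ball y r, (2 * (g x - c y (6 * t)) ^ 2 + 2 * (A₂ * t ^ α) ^ 2) := by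
          refine setIntegral_mono_on (integrableOn_ball_of_locallyIntegrable hd2 _ _)
            (((integrableOn_sub_sq hg hg2 _ _ _).const_mul 2).add
              (integrableOn_const measure_ball_lt_top.ne)) measurableSet_ball fun x hx => ?_
          have h2 := hG1 x y ((mem_ball.1 hx).le.trans hrt)
          have h3 : (G x - c y (6 * t)) ^ 2 ≤ (A₂ * t ^ α) ^ 2 :=
            sq_le_sq' (abs_le.1 h2).1 (abs_le.1 h2).2
          nlinarith [sq_nonneg ((g x - c y (6 * t)) + (G x - c y (6 * t)))]
      _ = 2 * (∫ x in ball y r, (g x - c y (6 * t)) ^ 2) +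
            volume.real (ball y r) * (2 * (A₂ * t ^ α) ^ 2) := by
          rw [integral_add ((integrableOn_sub_sq hg hg2 _ _ _).const_mul 2)
            (integrableOn_const measure_ball_lt_top.ne), integral_const_mul, setIntegral_const,
            smul_eq_mul]
      _ ≤ 2 * (A₁ * (6 * t) ^ (1 + 2 * α) * r ^ ((n : ℝ) - 1)) +
            unitVol n * (3 * t * r ^ ((n : ℝ) - 1)) * (2 * (A₂ * t ^ α) ^ 2) := by
          rw [volume_real_ball hn1 y hr.le]
          gcongr
          rw [Real.rpow_sub_one hr.ne', Real.rpow_natCast]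
          have : r ^ n = r * (r ^ n / r) := by field_simp
          calc r ^ n = r * (r ^ n / r) := this
            _ ≤ _ := by gcongr
      _ = _ := by
          rw [show (n : ℝ) - 2 + 1 = n - 1 by ring, Real.mul_rpow (by norm_num) ht.le,
            Real.rpow_add ht, Real.rpow_one, htα, hA₃]
          ring
  have hE := energy_nonneg t v
  have h1 := H _ hdm hd2 (A₃ * t ^ (1 + 2 * α)) t (by positivity) ht hw v hv
  -- This s balances the two terms: both scale like t^(α-1) = t^(-2p) with p = (1 - α)/2.
  have h2 := abs_integral_mul_pd_sq_le hdm hv (by positivity) h1 i (s := t ^ (1 + α))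
    (Real.rpow_pos_of_pos ht _)
  have hip : IsTest (pd i fun y => v y ^ 2) := hv.sq.pd i
  have hs1 : Integrable (fun x => g x * pd i (fun y => v y ^ 2) x) :=
    hg.integrable_smul_right_of_hasCompactSupport hip.continuous hip.2
  have hs2 : Integrable (fun x => G x * pd i (fun y => v y ^ 2) x) :=
    (IsTest.mul_left hG hip).integrable
  have h3 : |∫ x, G x * pd i (fun y => v y ^ 2) x| ≤ A₀ / t * (A₂ * t ^ α) * energy t v := by
    rw [integral_mul_pd i hG hv.sq, abs_neg]
    refine le_trans ?_ (mul_le_mul_of_nonneg_left (integral_sq_le_energy t v) (by positivity))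
    rw [← integral_const_mul, ← Real.norm_eq_abs]
    refine norm_integral_le_of_norm_le (hv.sq.integrable.const_mul _)
      (Eventually.of_forall fun x => ?_)
    rw [norm_mul, Real.norm_of_nonneg (sq_nonneg (v x))]
    gcongr
    exact hG2 x
  have e0 : ∫ x, g x * pd i (fun y => v y ^ 2) x =
      (∫ x, (g x - G x) * pd i (fun y => v y ^ 2) x) + ∫ x, G x * pd i (fun y => v y ^ 2) x := by
    rw [← integral_add ?_ hs2]
    · congr 1; ext x; ring
    · have : (fun x => (g x - G x) * pd i (fun y => v y ^ 2) x) =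
          fun x => g x * pd i (fun y => v y ^ 2) x - G x * pd i (fun y => v y ^ 2) x := by
        ext x; ring
      rw [this]
      exact hs1.sub hs2
  rw [e0]
  refine (abs_add_le _ _).trans ((add_le_add h2 h3).trans ?_)
  rw [show -2 * ((1 - α) / 2) = α - 1 by ring]
  have e1 : t ^ (1 + α) * t ^ (-2 : ℝ) = t ^ (α - 1) := by
    rw [← Real.rpow_add ht]; congr 1; ring
  have e2 : (t ^ (1 + α))⁻¹ * (t ^ (1 + 2 * α) * t ^ ((1 : ℝ) - 2)) = t ^ (α - 1) := by
    rw [← Real.rpow_neg ht.le, ← Real.rpow_add ht, ← Real.rpow_add ht]; congr 1; ring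
  have e3 : t ^ α / t = t ^ (α - 1) := (Real.rpow_sub_one ht.ne' α).symm
  have h4 : t ^ (1 + α) * (∫ x, gradSq v x) ≤ t ^ (1 + α) * (t ^ (-2 : ℝ) * energy t v) := by
    gcongr
    exact integral_gradSq_le_energy ht v
  calc _ ≤ t ^ (1 + α) * (t ^ (-2 : ℝ) * energy t v) +
        (t ^ (1 + α))⁻¹ * (C * (A₃ * t ^ (1 + 2 * α)) * t ^ ((1 : ℝ) - 2) * energy t v) +
        A₀ / t * (A₂ * t ^ α) * energy t v := by gcongr
    _ = _ := by
      rw [show A₀ / t * (A₂ * t ^ α) = A₀ * A₂ * (t ^ α / t) by ring, e3]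
      linear_combination (energy t v) * e1 + (C * A₃ * energy t v) * e2

end campanato

end

noncomputable section

open scoped ENNReal

/-! ### Sufficiency for distributions in divergence form -/

section scalar

variable {n : ℕ} {g : Rn n → ℝ}

theorem locallyIntegrable_of_memLp {F : Type*} [NormedAddCommGroup F] {g : Rn n → F}
    (hg : ∀ K : Set (Rn n), IsCompact K → MemLp g 2 (volume.restrict K)) : LocallyIntegrable g := by
  rw [locallyIntegrable_iff]
  intro K hK
  have : IsFiniteMeasure (volume.restrict K) := ⟨by simpa using hK.measure_lt_top⟩
  exact (hg K hK).integrable (by norm_num)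

theorem locallyIntegrable_sq_of_memLp
    (hg : ∀ K : Set (Rn n), IsCompact K → MemLp g 2 (volume.restrict K)) :
    LocallyIntegrable (fun x => g x ^ 2) := by
  rw [locallyIntegrable_iff]
  intro K hK
  exact (hg K hK).integrable_sq

/-- The Campanato bound with α = 1 - 2p holds with the value at the centre as the constant on every
ball. -/
theorem scalarFormBound_of_lip (hn : 2 ≤ n) {p : ℝ} (hp : p < 1 / 2)
    (hg : LocallyIntegrable g) (hg2 : LocallyIntegrable (fun x => g x ^ 2)) {C : ℝ}
    (hC : ∀ x y, |g x - g y| ≤ C * ‖x - y‖ ^ (1 - 2 * p)) : ScalarFormBound p g := by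
  have hα : 0 < 1 - 2 * p := by linarith
  have key := scalarFormBound_of_campanato (α := 1 - 2 * p) (M := C ^ 2 * unitVol n)
    (c := fun x _ => g x) hn (by have := unitVol_pos n; positivity) hα.le hg hg2 ?_
  · rwa [show (1 - (1 - 2 * p)) / 2 = p by ring] at key
  · intro x r hr
    have hr2 : (r ^ (1 - 2 * p)) ^ 2 = r ^ (2 * (1 - 2 * p)) := by
      rw [← Real.rpow_natCast, ← Real.rpow_mul hr.le]; congr 1; push_cast; ring
    calc ∫ y in ball x r, (g y - g x) ^ 2
        ≤ ∫ y in ball x r, (C * r ^ (1 - 2 * p)) ^ 2 := by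
          refine setIntegral_mono_on (integrableOn_sub_sq hg hg2 _ _ _)
            (integrableOn_const measure_ball_lt_top.ne) measurableSet_ball fun y hy => ?_
          rw [← sq_abs]
          refine pow_le_pow_left₀ (abs_nonneg _) ?_ 2
          -- Seen by comparing g at the origin and at a unit vector.
          have h0 : 0 ≤ C := by
            by_contra hneg
            have h1 := hC 0 (EuclideanSpace.single ⟨0, by lia⟩ 1)
            simp only [zero_sub, norm_neg] at h1
            rw [show ‖(EuclideanSpace.single ⟨0, by lia⟩ 1 : Rn n)‖ = 1 from norm_stdVec _,
              Real.one_rpow, mul_one] at h1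
            exact hneg ((abs_nonneg _).trans h1)
          refine (hC y x).trans ?_
          gcongr
          rw [← dist_eq_norm]
          exact (mem_ball.1 hy).le
      _ = _ := by
          rw [setIntegral_const, smul_eq_mul, volume_real_ball (by lia) x hr.le, mul_pow, hr2,
            Real.rpow_add hr, Real.rpow_natCast]
          ring

/-- The case α = 0; John–Nirenberg upgrades mean oscillation to mean square oscillation. -/
theorem scalarFormBound_of_bmo (hn : 2 ≤ n)
    (hg : LocallyIntegrable g) (hg2 : LocallyIntegrable (fun x => g x ^ 2)) {N : ℝ}
    (hosc : ∀ x r, 0 < r → ∃ c, ∫ y in ball x r, |g y - c| ≤ N * volume.real (ball x r)) :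
    ScalarFormBound (1 / 2) g := by
  obtain ⟨M, hM, h⟩ := johnNirenberg_sq (by lia) hg hosc
  choose! c hc using h
  have key := scalarFormBound_of_campanato (α := 0) (c := c) hn hM le_rfl hg hg2 ?_
  · rwa [sub_zero] at key
  · intro x r hr
    have h1 := hc x r hr
    rw [← ofReal_integral_eq_lintegral_ofReal (integrableOn_sub_sq hg hg2 _ _ _)
      (Eventually.of_forall fun _ => sq_nonneg _), ENNReal.ofReal_le_ofReal_iff (by positivity)] at h1
    simpa using h1

end scalar

theorem integrable_mul_ofReal_test {n : ℕ} {f : Rn n → ℂ} (hf : LocallyIntegrable f)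
    {φ : Rn n → ℝ} (hφ : IsTest φ) : Integrable fun x => f x * (φ x : ℂ) :=
  hf.integrable_smul_right_of_hasCompactSupport
    (Complex.continuous_ofReal.comp hφ.continuous) (hφ.2.comp_left Complex.ofReal_zero)

theorem norm_integral_mul_ofReal_le {n : ℕ} {f : Rn n → ℂ} (hf : LocallyIntegrable f)
    {φ : Rn n → ℝ} (hφ : IsTest φ) :
    ‖∫ x, f x * (φ x : ℂ)‖ ≤ |∫ x, (f x).re * φ x| + |∫ x, (f x).im * φ x| := by
  have hint := integrable_mul_ofReal_test hf hφ
  refine (Complex.norm_le_abs_re_add_abs_im _).trans (le_of_eq ?_)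
  have e1 : (∫ x, f x * (φ x : ℂ)).re = ∫ x, (f x).re * φ x := by
    have := Complex.reCLM.integral_comp_comm hint
    simp only [Complex.reCLM_apply, Complex.re_mul_ofReal] at this
    exact this.symm
  have e2 : (∫ x, f x * (φ x : ℂ)).im = ∫ x, (f x).im * φ x := by
    have := Complex.imCLM.integral_comp_comm hint
    simp only [Complex.imCLM_apply, Complex.im_mul_ofReal] at this
    exact this.symm
  rw [e1, e2]

theorem isDiv_apply {n : ℕ} {Q : Distr n} {Γ : Rn n → EuclideanSpace ℂ (Fin n)}
    (hL : IsL2Loc Γ) (hdiv : IsDiv Q Γ) {φ : Rn n → ℝ} (hφ : IsTest φ) :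
    Q (mkTest φ hφ) = -∑ i, ∫ x, Γ x i * (pd i φ x : ℂ) := by
  have hloc : ∀ i, LocallyIntegrable fun x => Γ x i := fun i =>
    locallyIntegrable_of_memLp fun K hK => (hL K hK).eval_piLp i
  rw [hdiv, ← integral_finsetSum _ fun i _ => integrable_mul_ofReal_test (hloc i) (hφ.pd i)]
  rfl

theorem formBound_of_isDiv_of_scalar {n : ℕ} {p : ℝ} {Q : Distr n}
    {Γ : Rn n → EuclideanSpace ℂ (Fin n)} (hL : IsL2Loc Γ) (hdiv : IsDiv Q Γ)
    (hre : ∀ i, ScalarFormBound p fun x => (Γ x i).re)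
    (him : ∀ i, ScalarFormBound p fun x => (Γ x i).im) : FormBound p Q := by
  choose A hA0 hA using hre
  choose B hB0 hB using him
  refine ⟨∑ i, (A i + B i), Finset.sum_nonneg fun i _ => add_nonneg (hA0 i) (hB0 i),
    fun v hv t ht => ?_⟩
  have hloc : ∀ i, LocallyIntegrable fun x => Γ x i := fun i =>
    locallyIntegrable_of_memLp fun K hK => (hL K hK).eval_piLp i
  rw [isDiv_apply hL hdiv, norm_neg]
  refine (norm_sum_le _ _).trans ?_
  rw [Finset.sum_mul, Finset.sum_mul]
  refine Finset.sum_le_sum fun i _ => ?_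
  refine (norm_integral_mul_ofReal_le (hloc i) (hv.sq.pd i)).trans ?_
  refine (add_le_add (hA i i v hv t ht) (hB i i v hv t ht)).trans_eq ?_
  ring

theorem formBound_of_isDiv {n : ℕ} (hn : 2 ≤ n) {p : ℝ} (hp1 : p < 1) {Q : Distr n}
    {Γ : Rn n → EuclideanSpace ℂ (Fin n)} (hL : IsL2Loc Γ) (hdiv : IsDiv Q Γ)
    (hΓ : SpaceCond p Γ) : FormBound p Q := by
  -- each real linear functional of norm at most one transfers the condition to a scalar function
  have key : ∀ ℓ : EuclideanSpace ℂ (Fin n) →L[ℝ] ℝ, (∀ z, |ℓ z| ≤ ‖z‖) →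
      ScalarFormBound p fun x => ℓ (Γ x) := by
    intro ℓ hℓ
    have hmem : ∀ K : Set (Rn n), IsCompact K → MemLp (fun x => ℓ (Γ x)) 2 (volume.restrict K) :=
      fun K hK => ℓ.comp_memLp' (hL K hK)
    have hg := locallyIntegrable_of_memLp hmem
    have hg2 := locallyIntegrable_sq_of_memLp hmem
    rcases lt_trichotomy p (1 / 2) with hp | hp | hp
    · obtain ⟨C, hC⟩ := hΓ.2.1 hp
      refine scalarFormBound_of_lip hn hp hg hg2 (C := C) fun x y => ?_
      rw [← map_sub]
      exact (hℓ _).trans (hC x y)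
    · obtain ⟨hloc, C, hC⟩ := hΓ.1 hp
      subst hp
      refine scalarFormBound_of_bmo hn hg hg2 (N := C) fun x r hr => ?_
      refine ⟨ℓ (⨍ y in ball x r, Γ y), ?_⟩
      have hv := volume_real_ball_pos x hr
      have h1 := hC x r hr
      rw [setAverage_eq, smul_eq_mul, inv_mul_le_iff₀ hv, mul_comm] at h1
      refine le_trans (integral_mono ?_ ?_ fun y => ?_) h1
      · exact (integrableOn_sub_const hg _ x r).norm
      · exact ((integrableOn_ball_of_locallyIntegrable hloc x r).sub
          (integrableOn_const measure_ball_lt_top.ne)).norm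
      · simp only
        rw [← map_sub]
        exact hℓ _
    · obtain ⟨C, hC⟩ := hΓ.2.2 hp
      refine scalarFormBound_of_morrey hn hp hp1 hg.aestronglyMeasurable hg2 (M := |C|)
        (abs_nonneg _) fun x r hr => ?_
      have hm : IntegrableOn (fun y => ‖Γ y‖ ^ 2) (ball x r) := by
        have := (hL _ (isCompact_closedBall x r)).integrable_norm_pow (by norm_num)
        exact IntegrableOn.mono_set this ball_subset_closedBall
      calc ∫ y in ball x r, ℓ (Γ y) ^ 2 ≤ ∫ y in ball x r, ‖Γ y‖ ^ 2 := by
            refine integral_mono (integrableOn_ball_of_locallyIntegrable hg2 x r) hm fun y => ?_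
            simp only
            rw [← sq_abs]
            exact pow_le_pow_left₀ (abs_nonneg _) (hℓ _) 2
        _ ≤ C * r ^ ((n : ℝ) + 2 - 4 * p) := hC x r hr
        _ ≤ _ := by gcongr; exact le_abs_self C
  have hnorm : ∀ (i : Fin n) (z : EuclideanSpace ℂ (Fin n)), ‖z i‖ ≤ ‖z‖ := fun i z =>
    PiLp.norm_apply_le z i
  refine formBound_of_isDiv_of_scalar hL hdiv (fun i => ?_) (fun i => ?_)
  · exact key (Complex.reCLM.comp ((EuclideanSpace.proj (𝕜 := ℂ) i).restrictScalars ℝ))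
      fun z => (Complex.abs_re_le_norm _).trans (hnorm i z)
  · exact key (Complex.imCLM.comp ((EuclideanSpace.proj (𝕜 := ℂ) i).restrictScalars ℝ))
      fun z => (Complex.abs_im_le_norm _).trans (hnorm i z)

end

noncomputable section

/-! ### Necessity: local bounds and truncated pairings -/

open scoped ENNReal

/-- Minimise at s = √b / √a. If a = 0 and X were positive, s = 2b / X would give X ≤ X / 2. -/
theorem le_two_mul_sqrt_mul_sqrt {X a b : ℝ} (ha : 0 ≤ a) (hb : 0 < b)
    (h : ∀ s : ℝ, 0 < s → X ≤ s * a + s⁻¹ * b) : X ≤ 2 * √a * √b := by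
  rcases ha.eq_or_lt with rfl | ha
  · simp only [Real.sqrt_zero, mul_zero, zero_mul]
    by_contra hX
    push Not at hX
    have := h (2 * b / X) (by positivity)
    have e : (2 * b / X)⁻¹ * b = X / 2 := by field_simp
    rw [e] at this
    linarith
  · have h1 := h (√b / √a) (by positivity)
    have e1 : √b / √a * a = √a * √b := by
      rw [div_mul_eq_mul_div, div_eq_iff (by positivity)]
      nth_rewrite 1 [← Real.mul_self_sqrt ha.le]; ring
    have e2 : (√b / √a)⁻¹ * b = √a * √b := by
      rw [inv_div, div_mul_eq_mul_div, div_eq_iff (by positivity)]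
      linear_combination (-√a) * Real.mul_self_sqrt hb.le
    rw [e1, e2] at h1
    linarith

theorem energy_add_add_energy_sub {n : ℕ} (t : ℝ) {f g : Rn n → ℝ} (hf : IsTest f)
    (hg : IsTest g) :
    energy t (fun x => f x + g x) + energy t (fun x => f x - g x) =
      2 * energy t f + 2 * energy t g := by
  have e1 : (∫ x, gradSq (fun x => f x + g x) x) + (∫ x, gradSq (fun x => f x - g x) x) =
      2 * (∫ x, gradSq f x) + 2 * ∫ x, gradSq g x := by
    rw [← integral_add (hf.add hg).gradSq.integrable (hf.sub hg).gradSq.integrable,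
      ← integral_const_mul, ← integral_const_mul,
      ← integral_add (hf.gradSq.integrable.const_mul _) (hg.gradSq.integrable.const_mul _)]
    congr 1; ext x
    simp only [gradSq, Finset.mul_sum]
    rw [← Finset.sum_add_distrib, ← Finset.sum_add_distrib]
    refine Finset.sum_congr rfl fun i _ => ?_
    rw [pd_add i (hf.differentiable x) (hg.differentiable x),
      pd_sub i (hf.differentiable x) (hg.differentiable x)]
    ring
  have e2 : (∫ x, (f x + g x) ^ 2) + (∫ x, (f x - g x) ^ 2) =
      2 * (∫ x, f x ^ 2) + 2 * ∫ x, g x ^ 2 := by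
    rw [← integral_add (hf.add hg).sq.integrable (hf.sub hg).sq.integrable,
      ← integral_const_mul, ← integral_const_mul,
      ← integral_add (hf.sq.integrable.const_mul _) (hg.sq.integrable.const_mul _)]
    congr 1; ext x; ring
  simp only [energy]
  linear_combination t ^ 2 * e1 + e2

theorem energy_const_mul {n : ℕ} (t c : ℝ) {f : Rn n → ℝ} (hf : IsTest f) :
    energy t (fun x => c * f x) = c ^ 2 * energy t f := by
  have e1 : ∫ x, gradSq (fun x => c * f x) x = c ^ 2 * ∫ x, gradSq f x := by
    rw [← integral_const_mul]
    congr 1; ext x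
    simp only [gradSq, Finset.mul_sum]
    refine Finset.sum_congr rfl fun i _ => ?_
    rw [pd_const_mul i c (hf.differentiable x)]; ring
  have e2 : ∫ x, (c * f x) ^ 2 = c ^ 2 * ∫ x, f x ^ 2 := by
    rw [← integral_const_mul]
    congr 1; ext x; ring
  simp only [energy]
  rw [e1, e2]; ring

theorem energy_le_of_bounds {n : ℕ} (hn : 1 ≤ n) {f : Rn n → ℝ} (hf : IsTest f) {x₀ : Rn n}
    {r a d : ℝ} (hr : 0 < r) (hsupp : tsupport f ⊆ closedBall x₀ r) (ha : ∀ x, |f x| ≤ a)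
    (hd : ∀ x, ‖fderiv ℝ f x‖ ≤ d) :
    energy r f ≤ unitVol n * r ^ n * (n * (r * d + a)) ^ 2 := by
  have ha0 : 0 ≤ a := (abs_nonneg _).trans (ha 0)
  have hd0 : 0 ≤ d := (norm_nonneg _).trans (hd 0)
  have hV := unitVol_pos n
  have hvol : volume.real (closedBall x₀ r) = unitVol n * r ^ n := by
    rw [← volume_real_ball hn x₀ hr.le]
    exact measureReal_congr (closedBall_ae_eq_ball hn x₀ r)
  have key : ∀ (F : Rn n → ℝ) (K : ℝ), IsTest F → (∀ x, x ∉ closedBall x₀ r → F x = 0) →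
      (∀ x, F x ≤ K) → ∫ x, F x ≤ unitVol n * r ^ n * K := by
    intro F K hF h0 hK
    rw [← setIntegral_eq_integral_of_forall_compl_eq_zero h0, ← hvol, ← smul_eq_mul,
      ← setIntegral_const]
    exact integral_mono hF.integrable.integrableOn
      (integrableOn_const measure_closedBall_lt_top.ne) hK
  have h1 : ∫ x, gradSq f x ≤ unitVol n * r ^ n * (n * d ^ 2) := by
    refine key _ _ hf.gradSq (fun x hx => ?_) fun x => ?_
    · simp only [gradSq, pd]
      rw [image_eq_zero_of_notMem_tsupport (f := fderiv ℝ f)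
        (fun h => hx (hsupp (tsupport_fderiv_subset ℝ h)))]
      simp
    · refine (gradSq_le f x).trans ?_
      gcongr
      exact hd x
  have h2 : ∫ x, f x ^ 2 ≤ unitVol n * r ^ n * a ^ 2 := by
    refine key _ _ hf.sq (fun x hx => ?_) fun x => ?_
    · rw [image_eq_zero_of_notMem_tsupport (fun h => hx (hsupp h))]; simp
    · exact sq_le_sq' (abs_le.1 (ha x)).1 (abs_le.1 (ha x)).2
  have hn' : (1 : ℝ) ≤ n := by exact_mod_cast hn
  have h3 : r ^ 2 * (n * d ^ 2) + a ^ 2 ≤ (n * (r * d + a)) ^ 2 := by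
    have p1 : 0 ≤ r * d * a := by positivity
    have p2 : (n : ℝ) ≤ n ^ 2 := by nlinarith
    have p3 : (n : ℝ) * (r * d) ^ 2 ≤ n ^ 2 * (r * d) ^ 2 := by gcongr
    have p4 : 1 * a ^ 2 ≤ (n : ℝ) ^ 2 * a ^ 2 := by gcongr; nlinarith
    have p5 : 0 ≤ (n : ℝ) ^ 2 * (r * d * a) := by positivity
    nlinarith
  calc energy r f ≤ r ^ 2 * (unitVol n * r ^ n * (n * d ^ 2)) + unitVol n * r ^ n * a ^ 2 := by
        rw [energy]; gcongr
    _ = unitVol n * r ^ n * (r ^ 2 * (n * d ^ 2) + a ^ 2) := by ring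
    _ ≤ _ := by gcongr

/-- `Q` is locally in the dual of the energy space, with the scaling of exponent `p`. -/
def LocalBound {n : ℕ} (p : ℝ) (Q : Distr n) (C : ℝ) : Prop :=
  0 ≤ C ∧ ∀ (x₀ : Rn n) (r : ℝ), 0 < r → ∀ (f : Rn n → ℝ) (hf : IsTest f),
    tsupport f ⊆ closedBall x₀ r →
      ‖Q (mkTest f hf)‖ ≤ C * r ^ ((n : ℝ) / 2 - 2 * p) * √(energy r f)

/-- Polarisation against a cutoff η equal to one on the support of f: 4f = (σf + η/σ)² - (σf -
η/σ)². The parallelogram law adds the two energies, that of η is at most const · r^n, and optimising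
in s = σ² produces the geometric mean. -/
theorem exists_localBound {n : ℕ} (hn : 1 ≤ n) {p : ℝ} {Q : Distr n} (h : FormBound p Q) :
    ∃ C, LocalBound p Q C := by
  obtain ⟨C, hC, H⟩ := h
  obtain ⟨A, hA, hcut⟩ := exists_norm_fderiv_cutoff_le n
  have hV := unitVol_pos n
  have hn' : (1 : ℝ) ≤ n := by exact_mod_cast hn
  set K : ℝ := unitVol n * 2 ^ n * (n * (2 * A + 1)) ^ 2 with hK
  have hK0 : 0 < K := by positivity
  refine ⟨C * √K, by positivity, fun x₀ r hr f hf hsupp => ?_⟩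
  set η := cutoff x₀ r with hη
  have hηt : IsTest η := isTest_cutoff hr
  have hEη : energy r η ≤ K * r ^ n := by
    have h1 := energy_le_of_bounds hn hηt (r := 2 * r) (by positivity) (tsupport_cutoff_subset hr)
      (a := 1) (fun x => by rw [abs_of_nonneg cutoff_nonneg]; exact cutoff_le_one)
      (fun x => hcut x₀ x r hr)
    have h2 : energy r η ≤ energy (2 * r) η := by
      have hE : 0 ≤ ∫ x, gradSq η x := integral_nonneg fun _ => gradSq_nonneg _ _
      simp only [energy]
      have : r ^ 2 ≤ (2 * r) ^ 2 := by nlinarith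
      gcongr
    refine h2.trans (h1.trans_eq ?_)
    rw [hK, mul_pow, show 2 * r * (A / r) = 2 * A by field_simp]
    ring
  have hfη : ∀ x, f x = f x * η x := by
    intro x
    by_cases hx : x ∈ closedBall x₀ r
    · rw [hη, cutoff_eq_one hr hx, mul_one]
    · rw [image_eq_zero_of_notMem_tsupport (fun h => hx (hsupp h)), zero_mul]
  have hE := energy_nonneg r f
  have hEη0 := energy_nonneg r η
  have hrp : 0 < r ^ (-2 * p) := Real.rpow_pos_of_pos hr _
  have key : ‖Q (mkTest f hf)‖ ≤ C * r ^ (-2 * p) * (2 * √(energy r f / 2) * √(K * r ^ n / 2)) := by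
    -- The general argument divides by C; for C = 0 polarisation gives Q f = 0 directly.
    rcases hC.eq_or_lt with rfl | hC
    · have h1 := H _ (hf.add hηt) r hr
      have h2 := H _ (hf.sub hηt) r hr
      simp only [zero_mul] at h1 h2 ⊢
      have e : (4 : ℝ) • mkTest f hf =
          mkTest _ (hf.add hηt).sq - mkTest _ (hf.sub hηt).sq := by
        ext x
        change 4 * f x = (f x + η x) ^ 2 - (f x - η x) ^ 2
        linear_combination 4 * hfη x
      have h3 : Q ((4 : ℝ) • mkTest f hf) = 0 := by
        rw [e, map_sub, norm_le_zero_iff.1 h1, norm_le_zero_iff.1 h2, sub_zero]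
      rw [map_smul, smul_eq_zero] at h3
      rcases h3 with h3 | h3
      · norm_num at h3
      · rw [h3, norm_zero]
    rw [← div_le_iff₀' (by positivity)]
    refine le_two_mul_sqrt_mul_sqrt (by positivity) (by positivity) fun s hs => ?_
    rw [div_le_iff₀' (by positivity)]
    set σ := √s with hσ
    have hσ0 : 0 < σ := Real.sqrt_pos.2 hs
    have hσs : σ ^ 2 = s := Real.sq_sqrt hs.le
    have ha := hf.const_mul σ
    have hb := hηt.const_mul σ⁻¹
    have h1 := H _ (ha.add hb) r hr
    have h2 := H _ (ha.sub hb) r hr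
    have e : (4 : ℝ) • mkTest f hf =
        mkTest _ (ha.add hb).sq - mkTest _ (ha.sub hb).sq := by
      ext x
      change 4 * f x = (σ * f x + σ⁻¹ * η x) ^ 2 - (σ * f x - σ⁻¹ * η x) ^ 2
      have : σ * σ⁻¹ = 1 := mul_inv_cancel₀ hσ0.ne'
      linear_combination 4 * hfη x - 4 * f x * η x * this
    have h3 : 4 * ‖Q (mkTest f hf)‖ ≤ C * r ^ (-2 * p) *
        (2 * (s * energy r f) + 2 * (s⁻¹ * energy r η)) := by
      have : 4 * ‖Q (mkTest f hf)‖ = ‖Q ((4 : ℝ) • mkTest f hf)‖ := by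
        rw [map_smul, norm_smul]; norm_num
      rw [this, e, map_sub]
      refine (norm_sub_le _ _).trans ((add_le_add h1 h2).trans_eq ?_)
      rw [← mul_add, energy_add_add_energy_sub r ha hb, energy_const_mul r σ hf,
        energy_const_mul r σ⁻¹ hηt, inv_pow, hσs]
    have h4 : s⁻¹ * energy r η ≤ s⁻¹ * (K * r ^ n) := by gcongr
    have h5 : C * r ^ (-2 * p) * (2 * (s * energy r f) + 2 * (s⁻¹ * energy r η)) ≤
        C * r ^ (-2 * p) * (2 * (s * energy r f) + 2 * (s⁻¹ * (K * r ^ n))) := by gcongr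
    linarith
  refine key.trans_eq ?_
  have e1 : √(energy r f / 2) * √(K * r ^ n / 2) = √(energy r f) * (√K * r ^ ((n : ℝ) / 2)) / 2 := by
    rw [Real.sqrt_div' _ (by norm_num), Real.sqrt_div' _ (by norm_num), div_mul_div_comm,
      Real.mul_self_sqrt (by norm_num), Real.sqrt_mul hK0.le, Real.sqrt_eq_rpow (r ^ n),
      ← Real.rpow_natCast, ← Real.rpow_mul hr.le]
    congr 4; ring
  have e2 : r ^ ((n : ℝ) / 2 - 2 * p) = r ^ (-2 * p) * r ^ ((n : ℝ) / 2) := by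
    rw [← Real.rpow_add hr]; congr 1; ring
  rw [mul_assoc 2, e1, e2]
  ring

theorem LocalBound.le_of_bounds {n : ℕ} (hn : 1 ≤ n) {p C : ℝ} {Q : Distr n}
    (hQ : LocalBound p Q C) {f : Rn n → ℝ} (hf : IsTest f) {x₀ : Rn n}
    {r a d : ℝ} (hr : 0 < r) (hsupp : tsupport f ⊆ closedBall x₀ r) (ha : ∀ x, |f x| ≤ a)
    (hd : ∀ x, ‖fderiv ℝ f x‖ ≤ d) :
    ‖Q (mkTest f hf)‖ ≤ C * √(unitVol n) * n * r ^ ((n : ℝ) - 2 * p) * (r * d + a) := by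
  have ha0 : 0 ≤ a := (abs_nonneg _).trans (ha 0)
  have hd0 : 0 ≤ d := (norm_nonneg _).trans (hd 0)
  have hC := hQ.1
  refine (hQ.2 x₀ r hr f hf hsupp).trans ?_
  have h1 : √(energy r f) ≤ √(unitVol n) * r ^ ((n : ℝ) / 2) * (n * (r * d + a)) := by
    refine (Real.sqrt_le_sqrt (energy_le_of_bounds hn hf hr hsupp ha hd)).trans_eq ?_
    rw [Real.sqrt_mul (by have := unitVol_pos n; positivity), Real.sqrt_mul (unitVol_pos n).le,
      Real.sqrt_sq (by positivity), Real.sqrt_eq_rpow (r ^ n), ← Real.rpow_natCast,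
      ← Real.rpow_mul hr.le]
    congr 3; ring
  have e2 : r ^ ((n : ℝ) - 2 * p) = r ^ ((n : ℝ) / 2 - 2 * p) * r ^ ((n : ℝ) / 2) := by
    rw [← Real.rpow_add hr]; congr 1; ring
  calc C * r ^ ((n : ℝ) / 2 - 2 * p) * √(energy r f)
      ≤ C * r ^ ((n : ℝ) / 2 - 2 * p) * (√(unitVol n) * r ^ ((n : ℝ) / 2) * (n * (r * d + a))) := by
        gcongr
    _ = _ := by rw [e2]; ring

/-! ### Estimates of Q on far shells. -/

/-- `v` and its gradient decay away from the ball `B(x₀, 8 r)`. -/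
def DecayAway {n : ℕ} (b : ℕ) (x₀ : Rn n) (r D : ℝ) (v : Rn n → ℝ) : Prop :=
  ∀ x, 8 * r ≤ ‖x - x₀‖ → |v x| ≤ D * (‖x - x₀‖ * (‖x - x₀‖ ^ b)⁻¹) ∧
    ‖fderiv ℝ v x‖ ≤ D * (‖x - x₀‖ ^ b)⁻¹

theorem mul_inv_pow_le_of_le {b : ℕ} (hb : 1 ≤ b) {σ x : ℝ} (hσ : 0 < σ) (hx : σ ≤ x) :
    x * (x ^ b)⁻¹ ≤ σ * (σ ^ b)⁻¹ := by
  obtain ⟨m, rfl⟩ : ∃ m, b = m + 1 := ⟨b - 1, by lia⟩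
  have hx0 : 0 < x := hσ.trans_le hx
  have e : ∀ y : ℝ, 0 < y → y * (y ^ (m + 1))⁻¹ = (y ^ m)⁻¹ := fun y hy => by
    rw [pow_succ]; field_simp
  rw [e x hx0, e σ hσ]
  gcongr

/-- θv lives between the radii σ and ρ, where v and its gradient are at most D σ^(1-b) and D σ^(-b).
For ρ comparable to σ the result is of order ρ^(n+1-2p-b), a negative power once b is large enough.
-/
theorem LocalBound.norm_apply_mul_le {n : ℕ} (hn : 1 ≤ n) {p C : ℝ} {Q : Distr n}
    (hQ : LocalBound p Q C) {b : ℕ} (hb : 1 ≤ b) {x₀ : Rn n} {r D : ℝ} (hr : 0 < r) (hD : 0 ≤ D)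
    {v : Rn n → ℝ} (hv : ContDiff ℝ ∞ v) (hdec : DecayAway b x₀ r D v) {θ : Rn n → ℝ}
    (hθ : IsTest θ) {A σ ρ : ℝ} (hσr : 8 * r ≤ σ) (hσρ : σ ≤ ρ)
    (hzero : ∀ x ∈ ball x₀ σ, θ x = 0) (hsupp : tsupport θ ⊆ closedBall x₀ ρ)
    (hA : ∀ x, |θ x| ≤ A) (hA' : ∀ x, ‖fderiv ℝ θ x‖ ≤ A / ρ) :
    ‖Q (mkTest (fun x => θ x * v x) (hθ.mul_right hv))‖ ≤
      C * √(unitVol n) * n * 3 * A * D * (ρ ^ ((n : ℝ) + 1 - 2 * p) * (σ ^ b)⁻¹) := by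
  have hA0 : 0 ≤ A := (abs_nonneg _).trans (hA 0)
  have hσ0 : 0 < σ := by linarith
  have hρ0 : 0 < ρ := by linarith
  have hC := hQ.1
  set a := A * D * (σ * (σ ^ b)⁻¹) with ha
  set d := A / ρ * (D * (σ * (σ ^ b)⁻¹)) + A * (D * (σ ^ b)⁻¹) with hd
  have hfar : ∀ x, x ∉ ball x₀ σ → |v x| ≤ D * (σ * (σ ^ b)⁻¹) ∧ ‖fderiv ℝ v x‖ ≤ D * (σ ^ b)⁻¹ := by
    intro x hx
    rw [mem_ball, not_lt, dist_eq_norm] at hx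
    obtain ⟨h1, h2⟩ := hdec x (hσr.trans hx)
    refine ⟨h1.trans ?_, h2.trans ?_⟩
    · exact mul_le_mul_of_nonneg_left (mul_inv_pow_le_of_le hb hσ0 hx) hD
    · gcongr
  have h1 := hQ.le_of_bounds hn (hθ.mul_right hv) hρ0
    ((tsupport_mul_subset_left).trans hsupp) (a := a) (d := d) (fun x => ?_) (fun x => ?_)
  · refine h1.trans ?_
    have e1 : ρ * d + a ≤ 3 * A * D * ρ * (σ ^ b)⁻¹ := by
      have e : ρ * d + a = A * D * (σ ^ b)⁻¹ * (2 * σ + ρ) := by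
        rw [hd, ha]; field_simp; ring
      rw [e]
      have : A * D * (σ ^ b)⁻¹ * (2 * σ + ρ) ≤ A * D * (σ ^ b)⁻¹ * (3 * ρ) := by gcongr; linarith
      linarith
    have e2 : ρ ^ ((n : ℝ) + 1 - 2 * p) = ρ ^ ((n : ℝ) - 2 * p) * ρ := by
      rw [← Real.rpow_add_one hρ0.ne']; congr 1; ring
    calc _ ≤ C * √(unitVol n) * n * ρ ^ ((n : ℝ) - 2 * p) * (3 * A * D * ρ * (σ ^ b)⁻¹) := by gcongr
      _ = _ := by rw [e2]; ring
  · by_cases hx : x ∈ ball x₀ σ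
    · rw [hzero x hx, zero_mul, abs_zero]; positivity
    · rw [abs_mul, ha, mul_assoc]
      gcongr
      · exact hA x
      · exact (hfar x hx).1
  · by_cases hx : x ∈ ball x₀ σ
    · have : (fun x => θ x * v x) =ᶠ[𝓝 x] fun _ => 0 := by
        filter_upwards [isOpen_ball.mem_nhds hx] with y hy
        rw [hzero y hy, zero_mul]
      rw [this.fderiv_eq]
      simp only [fderiv_fun_const, Pi.zero_apply, norm_zero]
      positivity
    · rw [fderiv_fun_mul (hθ.differentiable x) (hv.differentiable (by simp) x)]
      refine (norm_add_le _ _).trans ?_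
      rw [norm_smul, norm_smul, Real.norm_eq_abs, Real.norm_eq_abs, hd, add_comm]
      refine add_le_add ?_ ?_
      · rw [mul_comm]
        exact mul_le_mul (hA' x) (hfar x hx).1 (abs_nonneg _) (by positivity)
      · exact mul_le_mul (hA x) (hfar x hx).2 (norm_nonneg _) hA0

end

/-! ### Convergence of the truncated pairings. -/

noncomputable section

open scoped ENNReal

theorem rpow_mul_inv_pow_eq {s κ l m x : ℝ} {b : ℕ} (hκ : κ = b - s) (hl : 0 ≤ l) (hx : 0 < x) :
    (l * x) ^ s * ((m * x) ^ b)⁻¹ = l ^ s * (m ^ b)⁻¹ * x ^ (-κ) := by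
  rw [Real.mul_rpow hl hx.le, mul_pow, mul_inv, hκ, neg_sub, Real.rpow_sub hx, Real.rpow_natCast]
  field_simp

theorem mkTest_sub_eq {n : ℕ} (Q : Distr n) {f g h : Rn n → ℝ} (hf : IsTest f) (hg : IsTest g)
    (hh : IsTest h) (e : ∀ x, h x = f x - g x) :
    Q (mkTest h hh) = Q (mkTest f hf) - Q (mkTest g hg) := by
  rw [← map_sub]
  congr 1
  ext x
  exact e x

theorem norm_fderiv_comp_smul_le {n : ℕ} {χ : Rn n → ℝ} (hχ : Differentiable ℝ χ) {B c : ℝ}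
    (hc : 0 ≤ c) (hB : ∀ x, ‖fderiv ℝ χ x‖ ≤ B) (x : Rn n) :
    ‖fderiv ℝ (fun x => χ (c • x)) x‖ ≤ B * c := by
  have h : HasFDerivAt (fun x => χ (c • x)) ((fderiv ℝ χ (c • x)).comp
      (c • ContinuousLinearMap.id ℝ (Rn n))) x :=
    (hχ _).hasFDerivAt.comp x ((hasFDerivAt_id x).const_smul c)
  rw [h.fderiv]
  refine (ContinuousLinearMap.opNorm_comp_le _ _).trans ?_
  rw [norm_smul, Real.norm_of_nonneg hc]
  have h0 : 0 ≤ B := (norm_nonneg _).trans (hB 0)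
  calc _ ≤ B * (c * 1) := by
        gcongr
        · exact hB _
        · exact ContinuousLinearMap.norm_id_le
    _ = _ := by ring

theorem norm_fderiv_sub_le_add {n : ℕ} {f g : Rn n → ℝ} (hf : Differentiable ℝ f)
    (hg : Differentiable ℝ g) (x : Rn n) :
    ‖fderiv ℝ (fun x => f x - g x) x‖ ≤ ‖fderiv ℝ f x‖ + ‖fderiv ℝ g x‖ := by
  rw [fderiv_fun_sub (hf x) (hg x)]
  exact norm_sub_le _ _

-- Two consecutive dyadic cutoffs differ by a function living on a shell, so the shell estimate
-- gives increments bounded by a geometric series, of ratio 2^(-κ). Any other cutoff χ(·/R) differs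
-- from a dyadic one of radius comparable to R by a function living at distance of order R, which
-- contributes O(R^(-κ)); hence the limit does not depend on χ.
set_option maxHeartbeats 1000000 in
theorem LocalBound.exists_limit {n : ℕ} (hn : 1 ≤ n) {p C : ℝ} {Q : Distr n}
    (hQ : LocalBound p Q C) {b : ℕ} (hb : 1 ≤ b) {κ : ℝ} (hκ : 0 < κ)
    (hκb : κ = b - ((n : ℝ) + 1 - 2 * p)) :
    ∃ C₂ : ℝ, 0 ≤ C₂ ∧ ∀ (x₀ : Rn n) (r D : ℝ) (v : Rn n → ℝ) (hv : ContDiff ℝ ∞ v) (hr : 0 < r),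
      0 ≤ D → DecayAway b x₀ r D v → ∃ L : ℂ,
        (∀ (χ : Rn n → ℝ) (hχ : IsTest χ), (∀ᶠ x in 𝓝 0, χ x = 1) →
          Tendsto (fun R : Set.Ioi (0 : ℝ) => Q (mkTest (fun x => χ ((R : ℝ)⁻¹ • x) * v x)
            (IsTest.mul_right ⟨hχ.1.comp (contDiff_id.const_smul _),
              hχ.2.comp_smul (inv_ne_zero (ne_of_gt R.2))⟩ hv))) atTop (𝓝 L)) ∧
        ‖L - Q (mkTest (fun x => cutoff x₀ (8 * r) x * v x)
          ((isTest_cutoff (by positivity)).mul_right hv))‖ ≤ C₂ * D * r ^ (-κ) := by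
  obtain ⟨A₀, hA₀, hcut⟩ := exists_norm_fderiv_cutoff_le n
  have hC := hQ.1
  set s : ℝ := (n : ℝ) + 1 - 2 * p with hs
  set q : ℝ := 2 ^ (-κ) with hq
  have hq0 : 0 < q := by positivity
  have hq1 : q < 1 := Real.rpow_lt_one_of_one_lt_of_neg (by norm_num) (by linarith)
  set K : ℝ := C * √(unitVol n) * n * 3 with hK
  have hK0 : 0 ≤ K := by positivity
  set c : ℝ := K * (1 + 8 * A₀) * 4 ^ s with hc
  have hc0 : 0 ≤ c := by positivity
  have h1q : 0 < 1 - q := by linarith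
  refine ⟨c / (1 - q), by positivity, fun x₀ r D v hv hr hD hdec => ?_⟩
  have hRpos : ∀ k : ℕ, 0 < 8 * r * 2 ^ k := fun k => by positivity
  have hct : ∀ k : ℕ, IsTest (cutoff x₀ (8 * r * 2 ^ k)) := fun k => isTest_cutoff (hRpos k)
  set a : ℕ → ℂ := fun k => Q (mkTest _ ((hct k).mul_right hv)) with ha
  have hpow : ∀ k : ℕ, (8 * r * 2 ^ k) ^ (-κ) = (8 * r) ^ (-κ) * q ^ k := by
    intro k
    rw [Real.mul_rpow (by positivity) (by positivity), hq, ← Real.rpow_natCast 2,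
      ← Real.rpow_mul (by norm_num), ← Real.rpow_natCast (2 ^ (-κ)), ← Real.rpow_mul (by norm_num)]
    congr 2; ring
  have hstep : ∀ k, dist (a k) (a (k + 1)) ≤ c * D * (8 * r) ^ (-κ) * q ^ k := by
    intro k
    have h8 : 8 * r ≤ 8 * r * 2 ^ k := by
      have : (1 : ℝ) ≤ 2 ^ k := one_le_pow₀ (by norm_num)
      nlinarith
    set ρ := 8 * r * 2 ^ k with hρ
    have hρ0 : 0 < ρ := hRpos k
    have hρ2 : 8 * r * 2 ^ (k + 1) = 2 * ρ := by rw [hρ]; ring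
    have h1 := hQ.norm_apply_mul_le hn hb hr hD hv hdec ((hct (k + 1)).sub (hct k))
      (A := 1 + 8 * A₀) (σ := ρ) (ρ := 4 * ρ) h8 (by linarith) ?_ ?_ ?_ ?_
    · rw [dist_comm, dist_eq_norm, ha]
      refine (le_of_eq ?_).trans (h1.trans_eq ?_)
      · congr 1
        refine (mkTest_sub_eq Q _ _ _ fun x => ?_).symm
        ring
      · have := rpow_mul_inv_pow_eq (m := 1) hκb (by norm_num : (0 : ℝ) ≤ 4) hρ0
        rw [one_mul] at this
        rw [this, one_pow, inv_one, mul_one, hpow k, hc]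
        ring
    · intro x hx
      have hx' : dist x x₀ < ρ := hx
      rw [cutoff_eq_one (hRpos _) (by rw [mem_closedBall, hρ2]; linarith),
        cutoff_eq_one (hRpos _) (by rw [mem_closedBall]; linarith), sub_self]
    · refine (tsupport_sub _ _).trans (Set.union_subset ?_ ?_)
      · refine (tsupport_cutoff_subset (hRpos _)).trans (closedBall_subset_closedBall ?_)
        rw [hρ2]; linarith
      · refine (tsupport_cutoff_subset (hRpos _)).trans (closedBall_subset_closedBall ?_)
        linarith
    · intro x
      rw [abs_le]
      have e1 : 0 ≤ cutoff x₀ (8 * r * 2 ^ (k + 1)) x := cutoff_nonneg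
      have e2 : 0 ≤ cutoff x₀ ρ x := cutoff_nonneg
      have e3 : cutoff x₀ (8 * r * 2 ^ (k + 1)) x ≤ 1 := cutoff_le_one
      have e4 : cutoff x₀ ρ x ≤ 1 := cutoff_le_one
      constructor <;> linarith
    · intro x
      refine (norm_fderiv_sub_le_add (hct _).differentiable (hct _).differentiable x).trans ?_
      refine (add_le_add (hcut x₀ x _ (hRpos _)) (hcut x₀ x _ (hRpos _))).trans ?_
      rw [hρ2, ← hρ, div_add_div _ _ (by positivity) (by positivity),
        div_le_div_iff₀ (by positivity) (by positivity)]
      nlinarith [mul_nonneg hA₀ (pow_nonneg hρ0.le 3), pow_nonneg hρ0.le 2,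
        mul_nonneg hA₀ (pow_nonneg hρ0.le 2)]
  obtain ⟨L, hL⟩ := cauchySeq_tendsto_of_complete (cauchySeq_of_le_geometric q _ hq1 hstep)
  refine ⟨L, fun χ hχ hχ1 => ?_, ?_⟩
  · obtain ⟨ε, hε, hεχ⟩ := Metric.eventually_nhds_iff.1 hχ1
    obtain ⟨M₀, hM₀⟩ := hχ.2.isCompact.isBounded.subset_closedBall 0
    obtain ⟨B, hB⟩ := hχ.continuous.bounded_above_of_compact_support hχ.2
    obtain ⟨B', hB'⟩ := (hχ.1.continuous_fderiv (by simp)).bounded_above_of_compact_support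
      (hχ.2.fderiv (𝕜 := ℝ))
    have hB0 : 0 ≤ B := (norm_nonneg _).trans (hB 0)
    have hB'0 : 0 ≤ B' := (norm_nonneg _).trans (hB' 0)
    -- For |x - x₀| < eR and R large both cutoffs equal one: ε/2 leaves room for the shift by x₀ in
    -- χ, and 1/2 matches the dyadic radius, which exceeds R/2.
    set e : ℝ := min (ε / 2) (1 / 2) with he
    have he0 : 0 < e := by positivity
    have heε : e ≤ ε / 2 := min_le_left _ _
    have he2 : e ≤ 1 / 2 := min_le_right _ _
    set M : ℝ := |M₀| + ε + 2 with hM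
    have hM1 : 2 ≤ M := by have := abs_nonneg M₀; linarith
    have hM0 : 0 < M := by linarith
    set A : ℝ := B + 1 + (B' + 2 * A₀) * M with hA
    have hAM : 0 ≤ (B' + 2 * A₀) * M := by positivity
    set K₁ : ℝ := K * A * D * (M ^ s * (e ^ b)⁻¹) +
      c * D * (8 * r) ^ (-κ) / (1 - q) * (16 * r) ^ κ with hK₁
    rw [tendsto_iff_norm_sub_tendsto_zero]
    have hlim : Tendsto (fun R : Set.Ioi (0 : ℝ) => K₁ * (R : ℝ) ^ (-κ)) atTop (𝓝 0) := by
      rw [tendsto_comp_val_Ioi_atTop (f := fun R : ℝ => K₁ * R ^ (-κ))]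
      simpa using (tendsto_rpow_neg_atTop hκ).const_mul K₁
    refine squeeze_zero' (Eventually.of_forall fun _ => norm_nonneg _) ?_ hlim
    have hev : ∀ᶠ R : Set.Ioi (0 : ℝ) in atTop, 8 * r / e ≤ (R : ℝ) ∧ ‖x₀‖ / e ≤ (R : ℝ) := by
      have h1 : Tendsto (fun R : Set.Ioi (0 : ℝ) => (R : ℝ)) atTop atTop := by
        rw [tendsto_comp_val_Ioi_atTop (f := fun R : ℝ => R)]
        exact tendsto_id
      exact (h1.eventually_ge_atTop _).and (h1.eventually_ge_atTop _)
    filter_upwards [hev] with R hR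
    obtain ⟨hR1, hR2⟩ := hR
    have hR0 : 0 < (R : ℝ) := R.2
    rw [div_le_iff₀ he0] at hR1 hR2
    set t : ℝ := (R : ℝ) with ht
    have h8t : 8 * r ≤ t := by nlinarith
    -- The dyadic radius ρ = 8r · 2^k with ρ ≤ t < 2ρ.
    obtain ⟨k, hk1, hk2⟩ := exists_nat_pow_near (x := t / (8 * r)) (y := 2)
      (by rw [le_div_iff₀ (by positivity)]; linarith) (by norm_num)
    rw [le_div_iff₀ (by positivity)] at hk1
    rw [div_lt_iff₀ (by positivity)] at hk2
    set ρ := 8 * r * 2 ^ k with hρ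
    have hρ0 : 0 < ρ := hRpos k
    have hρt : ρ ≤ t := by rw [hρ]; linarith
    have htρ : t < 2 * ρ := by rw [hρ]; rw [pow_succ] at hk2; linarith
    have hχt : IsTest (fun x => χ (t⁻¹ • x)) := ⟨hχ.1.comp (contDiff_id.const_smul _),
              hχ.2.comp_smul (inv_ne_zero (ne_of_gt R.2))⟩
    have h1 := hQ.norm_apply_mul_le hn hb hr hD hv hdec (hχt.sub (hct k))
      (A := A) (σ := e * t) (ρ := M * t) (by linarith) (by gcongr; linarith) ?_ ?_ ?_ ?_
    · have h2 := dist_le_of_le_geometric_of_tendsto q _ hq1 hstep hL k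
      rw [dist_eq_norm] at h2
      have h3 : q ^ k ≤ (16 * r) ^ κ * t ^ (-κ) := by
        have h4 : ρ ^ (-κ) ≤ (t / 2) ^ (-κ) :=
          Real.rpow_le_rpow_of_nonpos (by positivity) (by linarith) (by linarith)
        rw [hρ, hpow k, Real.div_rpow hR0.le (by norm_num)] at h4
        have h5 : (16 * r) ^ κ = (8 * r) ^ κ * 2 ^ κ := by
          rw [← Real.mul_rpow (by positivity) (by norm_num)]; congr 1; ring
        rw [h5]
        rw [Real.rpow_neg (by positivity), Real.rpow_neg (by norm_num : (0 : ℝ) ≤ 2), div_inv_eq_mul,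
          inv_mul_le_iff₀ (by positivity)] at h4
        linarith
      have e1 : Q (mkTest (fun x => χ (t⁻¹ • x) * v x) (hχt.mul_right hv)) - L =
          Q (mkTest (fun x => (χ (t⁻¹ • x) - cutoff x₀ ρ x) * v x)
            ((hχt.sub (hct k)).mul_right hv)) + (a k - L) := by
        rw [mkTest_sub_eq Q (hχt.mul_right hv) ((hct k).mul_right hv)
          ((hχt.sub (hct k)).mul_right hv) fun x => by ring]
        ring
      change ‖Q (mkTest (fun x => χ (t⁻¹ • x) * v x) (hχt.mul_right hv)) - L‖ ≤ _
      rw [e1]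
      refine (norm_add_le _ _).trans ((add_le_add h1 h2).trans ?_)
      rw [rpow_mul_inv_pow_eq hκb hM0.le hR0, ← hK]
      have e2 : c * D * (8 * r) ^ (-κ) * q ^ k / (1 - q) ≤
          c * D * (8 * r) ^ (-κ) * ((16 * r) ^ κ * t ^ (-κ)) / (1 - q) := by gcongr
      refine (add_le_add le_rfl e2).trans_eq ?_
      rw [hK₁]; ring
    · intro x hx
      have hx' : ‖x - x₀‖ < e * t := by rwa [mem_ball, dist_eq_norm] at hx
      have hxn : ‖x‖ ≤ ‖x - x₀‖ + ‖x₀‖ := by simpa using norm_add_le (x - x₀) x₀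
      have e1 : χ (t⁻¹ • x) = 1 := by
        refine hεχ ?_
        rw [dist_zero_right, norm_smul, norm_inv, Real.norm_of_nonneg hR0.le, inv_mul_lt_iff₀ hR0]
        nlinarith
      rw [e1, cutoff_eq_one hρ0, sub_self]
      rw [mem_closedBall, dist_eq_norm]
      nlinarith
    · refine (tsupport_sub _ _).trans (Set.union_subset ?_ ?_)
      · refine closure_minimal (fun x hx => ?_) isClosed_closedBall
        have h2 : t⁻¹ • x ∈ closedBall (0 : Rn n) M₀ := hM₀ (subset_tsupport χ hx)
        rw [mem_closedBall_zero_iff, norm_smul, norm_inv, Real.norm_of_nonneg hR0.le,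
          inv_mul_le_iff₀ hR0] at h2
        rw [mem_closedBall, dist_eq_norm]
        have h3 : ‖x - x₀‖ ≤ ‖x‖ + ‖x₀‖ := norm_sub_le _ _
        have h4 := le_abs_self M₀
        rw [hM]
        nlinarith
      · refine (tsupport_cutoff_subset hρ0).trans (closedBall_subset_closedBall ?_)
        nlinarith
    · intro x
      have e2 : 0 ≤ cutoff x₀ ρ x := cutoff_nonneg
      have e4 : cutoff x₀ ρ x ≤ 1 := cutoff_le_one
      have e5 := abs_le.1 (hB (t⁻¹ • x))
      rw [abs_le]
      constructor <;> linarith [e5.1, e5.2]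
    · intro x
      refine (norm_fderiv_sub_le_add hχt.differentiable (hct _).differentiable x).trans ?_
      refine (add_le_add (norm_fderiv_comp_smul_le hχ.differentiable (inv_nonneg.2 hR0.le) hB' x)
        (hcut x₀ x _ (hRpos _))).trans ?_
      have e1 : A₀ / ρ ≤ A₀ / (t / 2) := by gcongr; linarith
      have e2 : A / (M * t) = (B + 1) / (M * t) + (B' + 2 * A₀) / t := by
        rw [hA]; field_simp
      have e3 : 0 ≤ (B + 1) / (M * t) := by positivity
      have e4 : A₀ / (t / 2) = 2 * A₀ / t := by field_simp
      have e5 : B' * t⁻¹ + 2 * A₀ / t = (B' + 2 * A₀) / t := by field_simp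
      rw [← hρ]
      linarith
  · have h2 := dist_le_of_le_geometric_of_tendsto₀ q _ hq1 hstep hL
    rw [dist_comm, dist_eq_norm] at h2
    have e0 : a 0 = Q (mkTest (fun x => cutoff x₀ (8 * r) x * v x)
          ((isTest_cutoff (by positivity)).mul_right hv)) := by
      simp only [ha, pow_zero, mul_one]
    rw [← e0]
    refine h2.trans ?_
    have e1 : (8 * r) ^ (-κ) ≤ r ^ (-κ) :=
      Real.rpow_le_rpow_of_nonpos hr (by linarith) (by linarith)
    calc c * D * (8 * r) ^ (-κ) / (1 - q) ≤ c * D * r ^ (-κ) / (1 - q) := by gcongr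
      _ = _ := by ring

end

noncomputable section

/-! ### Decay of `∂_i Δ⁻¹ φ` away from the support of `φ` -/

open scoped ENNReal

theorem gradKernel_smul {n : ℕ} (i : Fin n) {s : ℝ} (hs : 0 < s) (x : Rn n) :
    gradKernel i (s • x) = s * (s ^ n)⁻¹ * gradKernel i x := by
  rw [gradKernel_eq, gradKernel_eq, norm_smul, Real.norm_of_nonneg hs.le, mul_pow, PiLp.smul_apply,
    smul_eq_mul]
  simp only [div_eq_mul_inv, mul_inv]
  ring

theorem contDiffOn_gradKernel {n : ℕ} (i : Fin n) :
    ContDiffOn ℝ ∞ (gradKernel i : Rn n → ℝ) {0}ᶜ := by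
  intro x hx
  have hx : x ≠ 0 := hx
  have hs := sphereArea_pos (Nat.one_le_of_lt i.isLt)
  have hx' := norm_pos_iff.2 hx
  refine ContDiffAt.contDiffWithinAt ?_
  change ContDiffAt ℝ ∞ (fun x : Rn n => x i / (sphereArea n * ‖x‖ ^ n)) x
  refine ContDiffAt.div (EuclideanSpace.proj (𝕜 := ℝ) i).contDiff.contDiffAt
    (contDiffAt_const.mul ((contDiffAt_norm ℝ hx).pow n)) (by positivity)

/-- The first two derivatives of the kernel are bounded on the compact annulus 1/2 ≤ |x| ≤ 3/2,
which contains all the points involved. One mean value inequality gives the first difference, two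
give the second. -/
theorem exists_gradKernel_sub_le_of_norm_eq_one {n : ℕ} (i : Fin n) :
    ∃ C : ℝ, 0 ≤ C ∧ ∀ z a b : Rn n, ‖z‖ = 1 → ‖a‖ ≤ 1 / 4 → ‖b‖ ≤ 1 / 4 →
      |gradKernel i (z + a + b) - gradKernel i (z + a)| ≤ C * ‖b‖ ∧
      |gradKernel i (z + a + b) - gradKernel i (z + a) -
        (gradKernel i (z + b) - gradKernel i z)| ≤ C * (‖a‖ * ‖b‖) := by
  set K : Rn n → ℝ := gradKernel i with hK
  set S : Set (Rn n) := closedBall 0 (3 / 2) \ ball 0 (1 / 2) with hS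
  have hSc : IsCompact S := (isCompact_closedBall _ _).diff isOpen_ball
  have hS0 : S ⊆ {0}ᶜ := by
    rintro x ⟨-, hx⟩ rfl
    exact hx (by simp)
  have hK1 := contDiffOn_gradKernel i
  have hopen : IsOpen ({0}ᶜ : Set (Rn n)) := isOpen_compl_singleton
  have hK2 : ContDiffOn ℝ ∞ (fderiv ℝ K) {0}ᶜ := hK1.fderiv_of_isOpen hopen (by simp)
  obtain ⟨C₁, hC₁⟩ := hSc.exists_bound_of_continuousOn
    ((hK1.continuousOn_fderiv_of_isOpen hopen (by simp)).mono hS0)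
  obtain ⟨C₂, hC₂⟩ := hSc.exists_bound_of_continuousOn
    ((hK2.continuousOn_fderiv_of_isOpen hopen (by simp)).mono hS0)
  have hd1 : ∀ x ∈ S, DifferentiableAt ℝ K x := fun x hx =>
    (hK1.contDiffAt (hopen.mem_nhds (hS0 hx))).differentiableAt (by simp)
  have hd2 : ∀ x ∈ S, DifferentiableAt ℝ (fderiv ℝ K) x := fun x hx =>
    (hK2.contDiffAt (hopen.mem_nhds (hS0 hx))).differentiableAt (by simp)
  refine ⟨max (max C₁ C₂) 0, le_max_right _ _, fun z a b hz ha hb => ?_⟩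
  have hball : closedBall z (1 / 2) ⊆ S := by
    intro w hw
    rw [mem_closedBall, dist_eq_norm] at hw
    refine ⟨?_, ?_⟩
    · rw [mem_closedBall_zero_iff]
      have : ‖w‖ ≤ ‖w - z‖ + ‖z‖ := by simpa using norm_add_le (w - z) z
      linarith
    · rw [mem_ball_zero_iff, not_lt]
      have : ‖z‖ ≤ ‖w‖ + ‖w - z‖ := by simpa using norm_sub_le w (w - z)
      linarith
  have hcv : Convex ℝ (closedBall z (1 / 2)) := convex_closedBall _ _
  have m1 : ∀ a b : Rn n, ‖a‖ ≤ 1 / 4 → ‖b‖ ≤ 1 / 4 → z + a + b ∈ closedBall z (1 / 2) := by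
    intro a b ha hb
    rw [mem_closedBall, dist_eq_norm, show z + a + b - z = a + b by abel]
    exact (norm_add_le _ _).trans (by linarith)
  have m2 : ∀ a : Rn n, ‖a‖ ≤ 1 / 4 → z + a ∈ closedBall z (1 / 2) := by
    intro a ha
    simpa using m1 a 0 ha (by norm_num)
  constructor
  · have h := hcv.norm_image_sub_le_of_norm_fderiv_le (f := K) (C := C₁)
      (fun x hx => hd1 x (hball hx)) (fun x hx => hC₁ x (hball hx)) (m2 a ha) (m1 a b ha hb)
    rw [add_sub_cancel_left] at h
    refine h.trans ?_
    gcongr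
    exact (le_max_left _ _).trans (le_max_left _ _)
  -- Mean value inequality in b for K(z + a + b) - K(z + b), whose derivative is itself a difference
  -- and of size C₂ ‖a‖.
  · have h := (convex_closedBall (0 : Rn n) (1 / 4)).norm_image_sub_le_of_norm_hasFDerivWithin_le
      (f := fun b => K (z + a + b) - K (z + b)) (C := C₂ * ‖a‖)
      (f' := fun b => fderiv ℝ K (z + a + b) - fderiv ℝ K (z + b)) (x := 0) (y := b)
      (fun w hw => ?_) (fun w hw => ?_) (by simp) (by simpa using hb)
    · simp only [add_zero, sub_zero, Real.norm_eq_abs] at h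
      rw [show K (z + a + b) - K (z + a) - (K (z + b) - K z) =
        K (z + a + b) - K (z + b) - (K (z + a) - K z) by ring, ← mul_assoc]
      refine h.trans ?_
      gcongr
      exact (le_max_right _ _).trans (le_max_left _ _)
    · have hw : ‖w‖ ≤ 1 / 4 := by simpa using hw
      refine HasFDerivAt.hasFDerivWithinAt (HasFDerivAt.sub ?_ ?_)
      · have := (hd1 _ (hball (m1 a w ha hw))).hasFDerivAt.comp w ((hasFDerivAt_id w).const_add (z + a))
        simpa [Function.comp_def] using this
      · have := (hd1 _ (hball (m2 w hw))).hasFDerivAt.comp w ((hasFDerivAt_id w).const_add z)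
        simpa [Function.comp_def] using this
    · have hw : ‖w‖ ≤ 1 / 4 := by simpa using hw
      have h := hcv.norm_image_sub_le_of_norm_fderiv_le (f := fderiv ℝ K) (C := C₂)
        (fun x hx => hd2 x (hball hx)) (fun x hx => hC₂ x (hball hx)) (m2 w hw) (m1 a w ha hw)
      rwa [show z + a + w - (z + w) = a by abel] at h

/-- Rescaling to |z| = 1; the powers of |z| come from homogeneity of degree 1 - n. -/
theorem exists_gradKernel_sub_le {n : ℕ} (i : Fin n) :
    ∃ C : ℝ, 0 ≤ C ∧ ∀ z a b : Rn n, z ≠ 0 → ‖a‖ ≤ ‖z‖ / 4 → ‖b‖ ≤ ‖z‖ / 4 →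
      |gradKernel i (z + a + b) - gradKernel i (z + a)| ≤ C * (‖z‖ ^ n)⁻¹ * ‖b‖ ∧
      |gradKernel i (z + a + b) - gradKernel i (z + a) -
        (gradKernel i (z + b) - gradKernel i z)| ≤ C * (‖z‖ ^ (n + 1))⁻¹ * (‖a‖ * ‖b‖) := by
  obtain ⟨C, hC, H⟩ := exists_gradKernel_sub_le_of_norm_eq_one i
  refine ⟨C, hC, fun z a b hz ha hb => ?_⟩
  have hs := norm_pos_iff.2 hz
  set s := ‖z‖ with hs'
  have nrm : ∀ x : Rn n, ‖s⁻¹ • x‖ = s⁻¹ * ‖x‖ := fun x => by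
    rw [norm_smul, norm_inv, Real.norm_of_nonneg hs.le]
  have sc : ∀ x : Rn n, gradKernel i x = s * (s ^ n)⁻¹ * gradKernel i (s⁻¹ • x) := fun x => by
    rw [← gradKernel_smul i hs, smul_inv_smul₀ hs.ne']
  obtain ⟨h1, h2⟩ := H (s⁻¹ • z) (s⁻¹ • a) (s⁻¹ • b) (by rw [nrm, ← hs']; field_simp)
    (by rw [nrm, inv_mul_le_iff₀ hs]; linarith) (by rw [nrm, inv_mul_le_iff₀ hs]; linarith)
  rw [← smul_add, ← smul_add, nrm] at h1
  rw [← smul_add, ← smul_add, ← smul_add, nrm, nrm] at h2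
  have hp : 0 < s * (s ^ n)⁻¹ := by positivity
  rw [sc (z + a + b), sc (z + a), sc (z + b), sc z]
  constructor
  · rw [← mul_sub, abs_mul, abs_of_pos hp]
    refine (mul_le_mul_of_nonneg_left h1 hp.le).trans_eq ?_
    field_simp
  · rw [← mul_sub, ← mul_sub, ← mul_sub, abs_mul, abs_of_pos hp]
    refine (mul_le_mul_of_nonneg_left h2 hp.le).trans_eq ?_
    rw [pow_succ]
    field_simp

theorem abs_gradKernel_add_le {n : ℕ} (i : Fin n) {z a : Rn n} (hz : z ≠ 0) (ha : ‖a‖ ≤ ‖z‖ / 4) :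
    |gradKernel i (z + a)| ≤ (sphereArea n)⁻¹ * 2 ^ n * (‖z‖ * (‖z‖ ^ n)⁻¹) := by
  have hn : 1 ≤ n := Nat.one_le_of_lt i.isLt
  have hz' := norm_pos_iff.2 hz
  have hs := sphereArea_pos hn
  refine (abs_gradKernel_le i (z + a)).trans ?_
  rw [mul_assoc]
  refine mul_le_mul_of_nonneg_left ?_ (inv_nonneg.2 hs.le)
  have h1 : ‖z‖ / 2 ≤ ‖z + a‖ := by
    have : ‖z‖ ≤ ‖z + a‖ + ‖a‖ := by simpa using norm_sub_le (z + a) a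
    linarith
  refine (mul_inv_pow_le_of_le hn (by positivity) h1).trans ?_
  rw [div_pow, inv_div]
  have : 0 ≤ ‖z‖ * 2 ^ n * (‖z‖ ^ n)⁻¹ := by positivity
  calc ‖z‖ / 2 * (2 ^ n / ‖z‖ ^ n) = ‖z‖ * 2 ^ n * (‖z‖ ^ n)⁻¹ / 2 := by ring
    _ ≤ ‖z‖ * 2 ^ n * (‖z‖ ^ n)⁻¹ := by linarith
    _ = _ := by ring

theorem integrable_gradKernel_sub_mul {n : ℕ} (i : Fin n) {f : Rn n → ℝ} (hf : IsTest f)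
    (x : Rn n) : Integrable (fun y => gradKernel i (x - y) * f y) := by
  have h := integrable_gradKernel_mul i (isTest_comp_const_sub hf x).continuous
    (isTest_comp_const_sub hf x).2
  simpa using h.comp_sub_left x

theorem abs_integral_mul_le {n : ℕ} {f G : Rn n → ℝ} (hf : IsTest f) {m : ℝ}
    (hm : ∀ y ∈ tsupport f, |G y| ≤ m) : |∫ y, G y * f y| ≤ m * ∫ y, |f y| := by
  rw [← Real.norm_eq_abs, ← integral_const_mul]
  refine norm_integral_le_of_norm_le (hf.integrable.abs.const_mul m) (Eventually.of_forall fun y => ?_)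
  by_cases hy : y ∈ tsupport f
  · rw [norm_mul, Real.norm_eq_abs, Real.norm_eq_abs]
    exact mul_le_mul_of_nonneg_right (hm y hy) (abs_nonneg _)
  · rw [image_eq_zero_of_notMem_tsupport hy]; simp

/-- For |x - x₀| ≥ 8r the singularity is far from the support, so the kernel bounds apply under the
integral. If ∫ φ = 0, the kernel at z = x - x₀ may be subtracted, which gains a factor r / |z|. -/
theorem exists_decayAway_gradInvLap {n : ℕ} (i : Fin n) :
    ∃ C : ℝ, 0 ≤ C ∧ ∀ (x₀ : Rn n) (r : ℝ) (φ : Rn n → ℝ), 0 < r → IsTest φ →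
      tsupport φ ⊆ closedBall x₀ r →
        DecayAway n x₀ r (C * ∫ y, |φ y|) (gradInvLap i φ) ∧
        (∫ y, φ y = 0 → DecayAway (n + 1) x₀ r (C * r * ∫ y, |φ y|) (gradInvLap i φ)) := by
  obtain ⟨C₁, hC₁, H⟩ := exists_gradKernel_sub_le i
  set C₂ := (sphereArea n)⁻¹ * 2 ^ n with hC₂
  have hC₂0 : 0 ≤ C₂ := by
    have := sphereArea_pos (Nat.one_le_of_lt i.isLt); positivity
  refine ⟨C₁ + C₂, by positivity, fun x₀ r φ hr hφ hsupp => ?_⟩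
  have hI : 0 ≤ ∫ y, |φ y| := integral_nonneg fun _ => abs_nonneg _
  have hint := integrable_gradKernel_sub_mul i hφ
  have hya : ∀ y ∈ tsupport φ, ‖x₀ - y‖ ≤ r := fun y hy => by
    have := hsupp hy; rwa [mem_closedBall, dist_comm, dist_eq_norm] at this
  refine ⟨fun x hx => ?_, fun h0 x hx => ?_⟩
  all_goals
    set z := x - x₀ with hz
    have hzp : 0 < ‖z‖ := by linarith
    have hz0 : z ≠ 0 := norm_pos_iff.1 hzp
    have hxy : ∀ y, x - y = z + (x₀ - y) := fun y => by rw [hz]; abel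
    have hxhy : ∀ w y, w - y = z + (x₀ - y) + (w - x) := fun w y => by rw [hz]; abel
    have hnear : ∀ᶠ w in 𝓝 x, ‖w - x‖ ≤ ‖z‖ / 4 := by
      filter_upwards [closedBall_mem_nhds x (by positivity : 0 < ‖z‖ / 4)] with w hw
      rwa [mem_closedBall, dist_eq_norm] at hw
  · constructor
    · rw [gradInvLap_apply']
      refine (abs_integral_mul_le hφ (m := C₂ * (‖z‖ * (‖z‖ ^ n)⁻¹)) fun y hy => ?_).trans ?_
      · rw [hxy]
        exact abs_gradKernel_add_le i hz0 ((hya y hy).trans (by linarith))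
      · have : 0 ≤ C₁ * (‖z‖ * (‖z‖ ^ n)⁻¹) * ∫ y, |φ y| := by positivity
        nlinarith
    -- The gradient bound is read off from a Lipschitz bound near x, that is from first differences
    -- of the kernel.
    · refine norm_fderiv_le_of_lip' ℝ (by positivity) ?_
      filter_upwards [hnear] with w hw
      rw [gradInvLap_apply', gradInvLap_apply', ← integral_sub (hint w) (hint x)]
      simp only [← sub_mul]
      refine (abs_integral_mul_le hφ (m := C₁ * (‖z‖ ^ n)⁻¹ * ‖w - x‖) fun y hy => ?_).trans ?_
      · rw [hxy y, hxhy w y]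
        exact (H z _ _ hz0 ((hya y hy).trans (by linarith)) hw).1
      · have : 0 ≤ C₂ * (‖z‖ ^ n)⁻¹ * ‖w - x‖ * ∫ y, |φ y| := by positivity
        nlinarith
  · have hcst : ∀ c : ℝ, ∫ y, c * φ y = 0 := fun c => by rw [integral_const_mul, h0, mul_zero]
    have hci : ∀ c : ℝ, Integrable fun y => c * φ y := fun c => hφ.integrable.const_mul c
    constructor
    · rw [gradInvLap_apply', ← sub_zero (∫ y, gradKernel i (x - y) * φ y),
        ← hcst (gradKernel i z), ← integral_sub (hint x) (hci _)]
      simp only [← sub_mul]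
      refine (abs_integral_mul_le hφ (m := C₁ * (‖z‖ ^ n)⁻¹ * r) fun y hy => ?_).trans ?_
      · have h := (H z 0 (x₀ - y) hz0 (by rw [norm_zero]; positivity) ((hya y hy).trans (by linarith))).1
        rw [add_zero, ← hxy] at h
        refine h.trans ?_
        gcongr
        exact hya y hy
      · have e : ‖z‖ * (‖z‖ ^ (n + 1))⁻¹ = (‖z‖ ^ n)⁻¹ := by rw [pow_succ]; field_simp
        rw [e]
        have : 0 ≤ C₂ * (‖z‖ ^ n)⁻¹ * r * ∫ y, |φ y| := by positivity
        nlinarith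
    · refine norm_fderiv_le_of_lip' ℝ (by positivity) ?_
      filter_upwards [hnear] with w hw
      rw [gradInvLap_apply', gradInvLap_apply', ← integral_sub (hint w) (hint x)]
      -- Subtracting this multiple of ∫ φ = 0 turns the first difference of the kernel into a second
      -- difference.
      rw [← sub_zero (∫ y, _), ← hcst (gradKernel i (z + (w - x)) - gradKernel i z),
        ← integral_sub (f := fun y => gradKernel i (w - y) * φ y - gradKernel i (x - y) * φ y)
          ((hint w).sub (hint x)) (hci _)]
      simp only [← sub_mul]
      refine (abs_integral_mul_le hφ (m := C₁ * (‖z‖ ^ (n + 1))⁻¹ * (r * ‖w - x‖))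
        fun y hy => ?_).trans ?_
      · rw [hxy y, hxhy w y]
        refine ((H z _ _ hz0 ((hya y hy).trans (by linarith)) hw).2).trans ?_
        gcongr
        exact hya y hy
      · have : 0 ≤ C₂ * (‖z‖ ^ (n + 1))⁻¹ * (r * ‖w - x‖) * ∫ y, |φ y| := by positivity
        nlinarith

end

noncomputable section

/-! ### The `L²` bound for the limit pairings -/

open scoped ENNReal

theorem integral_pd_eq_zero {n : ℕ} (i : Fin n) {g : Rn n → ℝ} (hg : IsTest g) :
    ∫ x, pd i g x = 0 := by
  have h := integral_mul_pd i (contDiff_const (c := (1 : ℝ))) hg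
  simpa [pd] using h

theorem integral_sum_pd_eq_zero {n : ℕ} {g : Fin n → Rn n → ℝ} (hg : ∀ i, IsTest (g i)) :
    ∫ x, ∑ i, pd i (g i) x = 0 := by
  rw [integral_finsetSum _ fun i _ => ((hg i).pd i).integrable]
  exact Finset.sum_eq_zero fun i _ => integral_pd_eq_zero i (hg i)

theorem IsTest.sum {n : ℕ} {ι : Type*} (s : Finset ι) {g : ι → Rn n → ℝ}
    (hg : ∀ i, IsTest (g i)) : IsTest (fun x => ∑ i ∈ s, g i x) := by
  classical
  induction s using Finset.induction_on with
  | empty => simpa using IsTest.zero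
  | insert a s ha ih =>
    simp only [Finset.sum_insert ha]
    exact (hg a).add ih

/-- Caccioppoli's inequality for `Δ v = ∂_i φ`. -/
theorem caccioppoli {n : ℕ} (i : Fin n) {v φ θ : Rn n → ℝ} (hv : ContDiff ℝ ∞ v) (hφ : IsTest φ)
    (hθ : IsTest θ) (h : ∀ x, ∑ j, pd j (pd j v) x = pd i φ x) :
    ∫ x, θ x ^ 2 * gradSq v x ≤ 4 * (∫ x, θ x ^ 2 * φ x ^ 2) + 10 * ∫ x, gradSq θ x * v x ^ 2 := by
  have hdv : Differentiable ℝ v := hv.differentiable (by simp)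
  have hpv : ∀ j, ContDiff ℝ ∞ (pd j v) := contDiff_pd hv
  have hg1 : ∀ j, IsTest (fun x => θ x ^ 2 * (v x * pd j v x)) := fun j =>
    hθ.sq.mul_right (hv.mul (hpv j))
  have hg2 : IsTest (fun x => θ x ^ 2 * (v x * φ x)) := hθ.sq.mul_right (hv.mul hφ.1)
  -- This combination of derivatives of test functions integrates to zero, and in its expansion θ² v
  -- Δv cancels against θ² v ∂_i φ by the equation.
  have hP : IsTest (fun x => (∑ j, pd j (fun x => θ x ^ 2 * (v x * pd j v x)) x) -
      pd i (fun x => θ x ^ 2 * (v x * φ x)) x) :=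
    (IsTest.sum _ fun j => (hg1 j).pd j).sub (hg2.pd i)
  have h0 : ∫ x, ((∑ j, pd j (fun x => θ x ^ 2 * (v x * pd j v x)) x) -
      pd i (fun x => θ x ^ 2 * (v x * φ x)) x) = 0 := by
    rw [integral_sub (IsTest.sum _ fun j => (hg1 j).pd j).integrable (hg2.pd i).integrable,
      integral_sum_pd_eq_zero hg1, integral_pd_eq_zero i hg2, sub_zero]
  have hT1 : IsTest (fun x => θ x ^ 2 * gradSq v x) :=
    hθ.sq.mul_right (ContDiff.sum fun j _ => (hpv j).pow 2)
  have hT2 : IsTest (fun x => θ x ^ 2 * φ x ^ 2) := hθ.sq.mul_right (hφ.1.pow 2)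
  have hT3 : IsTest (fun x => gradSq θ x * v x ^ 2) := hθ.gradSq.mul_right (hv.pow 2)
  have hpt : ∀ x, θ x ^ 2 * gradSq v x - (4 * (θ x ^ 2 * φ x ^ 2) + 10 * (gradSq θ x * v x ^ 2)) ≤
      2 * ((∑ j, pd j (fun x => θ x ^ 2 * (v x * pd j v x)) x) -
      pd i (fun x => θ x ^ 2 * (v x * φ x)) x) := by
    intro x
    have dθ := hθ.differentiable x
    have dθ2 := hθ.sq.differentiable x
    have dφ := hφ.differentiable x
    have e1 : ∀ j, pd j (fun x => θ x ^ 2 * (v x * pd j v x)) x =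
        θ x ^ 2 * pd j v x ^ 2 + 2 * (θ x * v x) * (pd j θ x * pd j v x) +
          θ x ^ 2 * v x * pd j (pd j v) x := by
      intro j
      rw [pd_mul j dθ2 ((hdv x).fun_mul ((hpv j).differentiable (by simp) x)), pd_sq j dθ,
        pd_mul j (hdv x) ((hpv j).differentiable (by simp) x)]
      ring
    have e2 : pd i (fun x => θ x ^ 2 * (v x * φ x)) x =
        θ x ^ 2 * v x * pd i φ x + θ x ^ 2 * φ x * pd i v x +
          2 * (θ x * pd i θ x) * (v x * φ x) := by
      rw [pd_mul i dθ2 ((hdv x).fun_mul dφ), pd_sq i dθ, pd_mul i (hdv x) dφ]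
      ring
    have e3 : ∑ j, pd j (fun x => θ x ^ 2 * (v x * pd j v x)) x = θ x ^ 2 * gradSq v x +
        2 * (θ x * v x) * (∑ j, pd j θ x * pd j v x) + θ x ^ 2 * v x * pd i φ x := by
      simp only [e1, Finset.sum_add_distrib, ← Finset.mul_sum, h, gradSq]
    rw [e3, e2]
    -- The three cross terms use 1/2 + 1/2 of θ²|∇v|², out of the 2 available; their remainders add
    -- up to 4 = 2 + 2 and 10 = 8 + 2.
    have e4 : -(4 * (θ x * v x) * (∑ j, pd j θ x * pd j v x)) ≤
        1 / 2 * (θ x ^ 2 * gradSq v x) + 8 * (gradSq θ x * v x ^ 2) := by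
      simp only [gradSq, Finset.mul_sum, Finset.sum_mul, ← Finset.sum_neg_distrib,
        ← Finset.sum_add_distrib]
      refine Finset.sum_le_sum fun j _ => ?_
      nlinarith [sq_nonneg (θ x * pd j v x + 4 * (v x * pd j θ x))]
    have e5 : 2 * (θ x ^ 2 * φ x * pd i v x) ≤
        1 / 2 * (θ x ^ 2 * gradSq v x) + 2 * (θ x ^ 2 * φ x ^ 2) := by
      have := mul_le_mul_of_nonneg_left (pd_sq_le_gradSq i v x) (sq_nonneg (θ x))
      nlinarith [sq_nonneg (θ x * pd i v x - 2 * (θ x * φ x))]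
    have e6 : 4 * (θ x * pd i θ x) * (v x * φ x) ≤
        2 * (θ x ^ 2 * φ x ^ 2) + 2 * (gradSq θ x * v x ^ 2) := by
      have := mul_le_mul_of_nonneg_right (pd_sq_le_gradSq i θ x) (sq_nonneg (v x))
      nlinarith [sq_nonneg (θ x * φ x - v x * pd i θ x)]
    linarith
  have h1 := integral_mono (hT1.integrable.sub
    ((hT2.integrable.const_mul 4).add (hT3.integrable.const_mul 10)))
    (hP.integrable.const_mul 2) hpt
  rw [integral_const_mul, h0, mul_zero] at h1
  have h2 : ∫ x, (θ x ^ 2 * gradSq v x - (4 * (θ x ^ 2 * φ x ^ 2) + 10 * (gradSq θ x * v x ^ 2))) =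
      (∫ x, θ x ^ 2 * gradSq v x) -
        (4 * (∫ x, θ x ^ 2 * φ x ^ 2) + 10 * ∫ x, gradSq θ x * v x ^ 2) := by
    rw [integral_sub hT1.integrable, integral_add (hT2.integrable.const_mul 4)
      (hT3.integrable.const_mul 10), integral_const_mul, integral_const_mul]
    exact (hT2.integrable.const_mul 4).add (hT3.integrable.const_mul 10)
  have h1' : ∫ x, (θ x ^ 2 * gradSq v x -
    (4 * (θ x ^ 2 * φ x ^ 2) + 10 * (gradSq θ x * v x ^ 2))) ≤ 0 := h1
  rw [h2] at h1'
  linarith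

theorem sum_pd_pd_gradInvLap {n : ℕ} (hn : 1 ≤ n) (i : Fin n) {φ : Rn n → ℝ} (hφ : IsTest φ)
    (x : Rn n) : ∑ j, pd j (pd j (gradInvLap i φ)) x = pd i φ x := by
  rw [← sum_pd_gradInvLap hn (hφ.pd i) x]
  refine Finset.sum_congr rfl fun j _ => ?_
  congr 1
  rw [← pd_gradInvLap j i hφ]
  exact pd_gradInvLap_comm i j hφ

/-- The potential estimate for Lebesgue measure, with a = 2. Points of the two balls are at most 17r
apart, so truncation at 18r loses nothing. -/
theorem exists_setIntegral_gradInvLap_sq_le {n : ℕ} (hn : 2 ≤ n) :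
    ∃ C : ℝ, 0 ≤ C ∧ ∀ (i : Fin n) (x₀ : Rn n) (r : ℝ) (φ : Rn n → ℝ), 0 < r → IsTest φ →
      tsupport φ ⊆ closedBall x₀ r →
        ∫ x in closedBall x₀ (16 * r), gradInvLap i φ x ^ 2 ≤ C * r ^ 2 * ∫ x, φ x ^ 2 := by
  obtain ⟨C, hC, H⟩ := lintegral_rieszPot_sq_le hn (a := 2) (by norm_num) le_rfl
  have hσ := sphereArea_pos (by omega : 1 ≤ n)
  have hV := unitVol_pos n
  refine ⟨((sphereArea n)⁻¹) ^ 2 * (C * unitVol n * 18 ^ 2), by positivity,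
    fun i x₀ r φ hr hφ hsupp => ?_⟩
  have hv := contDiff_gradInvLap i hφ
  have hvint : IntegrableOn (fun x => gradInvLap i φ x ^ 2) (closedBall x₀ (16 * r)) :=
    (hv.continuous.pow 2).continuousOn.integrableOn_compact (isCompact_closedBall _ _)
  have h1 := H volume (unitVol n) (18 * r) hV.le (by positivity) (fun y s hs _ => by
    rw [volume_ball_eq_ofReal (by omega) y hs.le, sub_add_cancel, Real.rpow_natCast])
    (fun y => ENNReal.ofReal |φ y|) (by have := hφ.continuous.measurable; fun_prop)
  have hI : 0 ≤ ∫ x, φ x ^ 2 := integral_nonneg fun _ => sq_nonneg _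
  rw [← ENNReal.ofReal_le_ofReal_iff (by positivity), ofReal_integral_eq_lintegral_ofReal hvint
    (Eventually.of_forall fun _ => sq_nonneg _)]
  have h2 : ∫⁻ y, ENNReal.ofReal |φ y| ^ 2 = ENNReal.ofReal (∫ x, φ x ^ 2) := by
    rw [ofReal_integral_eq_lintegral_ofReal hφ.sq.integrable
      (Eventually.of_forall fun _ => sq_nonneg _)]
    refine lintegral_congr fun y => ?_
    rw [← ENNReal.ofReal_pow (abs_nonneg _), sq_abs]
  calc ∫⁻ x in closedBall x₀ (16 * r), ENNReal.ofReal (gradInvLap i φ x ^ 2)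
      ≤ ∫⁻ x in closedBall x₀ (16 * r), ENNReal.ofReal (sphereArea n)⁻¹ ^ 2 *
          rieszPot (18 * r) (fun y => ENNReal.ofReal |φ y|) x ^ 2 := by
        refine setLIntegral_mono' measurableSet_closedBall fun x hx => ?_
        rw [← mul_pow, ← sq_abs, ENNReal.ofReal_pow (abs_nonneg _)]
        refine pow_le_pow_left' (abs_gradInvLap_le_rieszPot hn i φ x _ fun y hy => ?_) 2
        refine image_eq_zero_of_notMem_tsupport fun h => hy ?_
        have h3 := hsupp h
        rw [mem_closedBall] at h3 hx
        rw [mem_ball]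
        have := dist_triangle_right y x x₀
        linarith
    _ ≤ ∫⁻ x, ENNReal.ofReal (sphereArea n)⁻¹ ^ 2 *
          rieszPot (18 * r) (fun y => ENNReal.ofReal |φ y|) x ^ 2 :=
        setLIntegral_le_lintegral _ _
    _ = ENNReal.ofReal (sphereArea n)⁻¹ ^ 2 *
          ∫⁻ x, rieszPot (18 * r) (fun y => ENNReal.ofReal |φ y|) x ^ 2 :=
        lintegral_const_mul' _ _ (by finiteness)
    _ ≤ ENNReal.ofReal (sphereArea n)⁻¹ ^ 2 *
          (ENNReal.ofReal (C * unitVol n * (18 * r) ^ (2 : ℝ)) * ENNReal.ofReal (∫ x, φ x ^ 2)) := by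
        rw [← h2]
        gcongr
    _ = _ := by
        rw [← ENNReal.ofReal_pow (by positivity), ← ENNReal.ofReal_mul (by positivity),
          ← ENNReal.ofReal_mul (by positivity), Real.rpow_two]
        congr 1; ring

/-- Cauchy–Schwarz up to a factor 2, from |φ| ≤ s φ² + 1/s and optimisation in s. -/
theorem integral_abs_le_sqrt {n : ℕ} (hn : 1 ≤ n) {φ : Rn n → ℝ} (hφ : IsTest φ) {x₀ : Rn n} {r : ℝ}
    (hr : 0 < r) (hsupp : tsupport φ ⊆ closedBall x₀ r) :
    ∫ x, |φ x| ≤ 2 * √(unitVol n) * r ^ ((n : ℝ) / 2) * √(∫ x, φ x ^ 2) := by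
  have hV := unitVol_pos n
  have h0 : ∀ x, x ∉ closedBall x₀ r → φ x = 0 := fun x hx =>
    image_eq_zero_of_notMem_tsupport fun h => hx (hsupp h)
  have hvol : volume.real (closedBall x₀ r) = unitVol n * r ^ n := by
    rw [← volume_real_ball hn x₀ hr.le]
    exact measureReal_congr (closedBall_ae_eq_ball hn x₀ r)
  have h := le_two_mul_sqrt_mul_sqrt (X := ∫ x, |φ x|) (a := ∫ x, φ x ^ 2) (b := unitVol n * r ^ n)
    (integral_nonneg fun _ => sq_nonneg _) (by positivity) fun s hs => ?_
  · refine h.trans_eq ?_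
    rw [Real.sqrt_mul hV.le, Real.sqrt_eq_rpow (r ^ n), ← Real.rpow_natCast, ← Real.rpow_mul hr.le,
      mul_one_div]
    ring
  · rw [← setIntegral_eq_integral_of_forall_compl_eq_zero (s := closedBall x₀ r)
      (fun x hx => by rw [h0 x hx, abs_zero]),
      ← setIntegral_eq_integral_of_forall_compl_eq_zero (s := closedBall x₀ r) (f := fun x => φ x ^ 2)
      (fun x hx => by rw [h0 x hx]; simp), ← hvol]
    have hc : IntegrableOn (fun _ : Rn n => s⁻¹) (closedBall x₀ r) :=
      integrableOn_const measure_closedBall_lt_top.ne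
    have hq : IntegrableOn (fun x => s * φ x ^ 2) (closedBall x₀ r) :=
      (hφ.sq.integrable.const_mul s).integrableOn
    have e : s * (∫ x in closedBall x₀ r, φ x ^ 2) + s⁻¹ * volume.real (closedBall x₀ r) =
        ∫ x in closedBall x₀ r, (s * φ x ^ 2 + s⁻¹) := by
      rw [integral_add hq hc, integral_const_mul, setIntegral_const, smul_eq_mul, mul_comm s⁻¹]
    rw [e]
    refine integral_mono hφ.integrable.abs.integrableOn (hq.add hc) fun x => ?_
    have h1 : s * s⁻¹ = 1 := mul_inv_cancel₀ hs.ne'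
    have h2 : 0 < s⁻¹ := inv_pos.2 hs
    change |φ x| ≤ s * φ x ^ 2 + s⁻¹
    rw [← sq_abs]
    nlinarith [sq_nonneg (s * |φ x| - 1 / 2), abs_nonneg (φ x), mul_nonneg h2.le (sq_nonneg (s * |φ x| - 1 / 2))]

end

/-! ### The near part of the potential and the bound for the limit pairings. -/

noncomputable section

open scoped ENNReal

/-- Since Δ ∂_i Δ⁻¹ φ = ∂_i φ, Caccioppoli's inequality bounds the localised gradient by ∫ φ² and
the L² norm of the potential on the support of the cutoff, and the latter is at most const · r² ∫
φ². -/
theorem exists_energy_cutoff_mul_gradInvLap_le {n : ℕ} (hn : 2 ≤ n) :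
    ∃ C : ℝ, 0 ≤ C ∧ ∀ (i : Fin n) (x₀ : Rn n) (r : ℝ) (φ : Rn n → ℝ), 0 < r → IsTest φ →
      tsupport φ ⊆ closedBall x₀ r →
        energy (16 * r) (fun x => cutoff x₀ (8 * r) x * gradInvLap i φ x) ≤
          C * r ^ 2 * ∫ x, φ x ^ 2 := by
  obtain ⟨C, hC, H⟩ := exists_setIntegral_gradInvLap_sq_le hn
  obtain ⟨A, hA, hcut⟩ := exists_norm_fderiv_cutoff_le n
  refine ⟨256 * (8 + 22 * (n * (A / 8) ^ 2 * C)) + C, by positivity,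
    fun i x₀ r φ hr hφ hsupp => ?_⟩
  set θ := cutoff x₀ (8 * r) with hθ'
  have h8 : 0 < 8 * r := by positivity
  have hθ : IsTest θ := isTest_cutoff h8
  set v := gradInvLap i φ with hv'
  have hv : ContDiff ℝ ∞ v := contDiff_gradInvLap i hφ
  have hdv : Differentiable ℝ v := hv.differentiable (by simp)
  have hθsupp : ∀ x, x ∉ closedBall x₀ (16 * r) → x ∉ tsupport θ := fun x hx h => hx (by
    have := tsupport_cutoff_subset h8 h
    rwa [show 2 * (8 * r) = 16 * r by ring] at this)
  have hS0 := H i x₀ r φ hr hφ hsupp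
  have hcac := caccioppoli i hv hφ hθ (sum_pd_pd_gradInvLap (by omega) i hφ)
  have hint : IntegrableOn (fun x => v x ^ 2) (closedBall x₀ (16 * r)) :=
    (hv.continuous.pow 2).continuousOn.integrableOn_compact (isCompact_closedBall _ _)
  have hθ1 : ∀ x, θ x ^ 2 ≤ 1 := fun x =>
    pow_le_one₀ cutoff_nonneg cutoff_le_one
  set I := ∫ x, φ x ^ 2 with hI
  have hI0 : 0 ≤ I := integral_nonneg fun _ => sq_nonneg _
  have b1 : ∫ x, θ x ^ 2 * φ x ^ 2 ≤ I := by
    refine integral_mono (hθ.sq.mul_right (hφ.1.pow 2)).integrable hφ.sq.integrable fun x => ?_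
    exact mul_le_of_le_one_left (sq_nonneg _) (hθ1 x)
  have b2 : ∫ x, gradSq θ x * v x ^ 2 ≤ n * (A / 8) ^ 2 * C * I := by
    rw [← setIntegral_eq_integral_of_forall_compl_eq_zero (s := closedBall x₀ (16 * r))
      (fun x hx => ?_)]
    · calc ∫ x in closedBall x₀ (16 * r), gradSq θ x * v x ^ 2
          ≤ ∫ x in closedBall x₀ (16 * r), (n * (A / (8 * r)) ^ 2) * v x ^ 2 := by
            refine integral_mono (hθ.gradSq.mul_right (hv.pow 2)).integrable.integrableOn
              (hint.const_mul _) fun x => ?_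
            refine mul_le_mul_of_nonneg_right ((gradSq_le θ x).trans ?_) (sq_nonneg _)
            gcongr
            exact hcut x₀ x _ h8
        _ = (n * (A / (8 * r)) ^ 2) * ∫ x in closedBall x₀ (16 * r), v x ^ 2 :=
            integral_const_mul _ _
        _ ≤ (n * (A / (8 * r)) ^ 2) * (C * r ^ 2 * I) := by gcongr
        _ = _ := by field_simp
    · have : gradSq θ x = 0 := by
        simp only [gradSq, pd]
        rw [image_eq_zero_of_notMem_tsupport (f := fderiv ℝ θ)
          (fun h => hθsupp x hx (tsupport_fderiv_subset ℝ h))]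
        simp
      rw [this, zero_mul]
  have b3 : ∫ x, (θ x * v x) ^ 2 ≤ C * r ^ 2 * I := by
    refine le_trans ?_ hS0
    rw [← setIntegral_eq_integral_of_forall_compl_eq_zero (s := closedBall x₀ (16 * r))
      (fun x hx => by rw [image_eq_zero_of_notMem_tsupport (hθsupp x hx)]; simp)]
    refine integral_mono (hθ.mul_right hv).sq.integrable.integrableOn hint fun x => ?_
    change (θ x * v x) ^ 2 ≤ v x ^ 2
    rw [mul_pow]
    exact mul_le_of_le_one_left (sq_nonneg _) (hθ1 x)
  have b4 : ∫ x, gradSq (fun x => θ x * v x) x ≤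
      2 * (∫ x, θ x ^ 2 * gradSq v x) + 2 * ∫ x, gradSq θ x * v x ^ 2 := by
    have i1 : Integrable (fun x => θ x ^ 2 * gradSq v x) :=
      (hθ.sq.mul_right (ContDiff.sum fun j _ => (contDiff_pd hv j).pow 2)).integrable
    have i2 : Integrable (fun x => gradSq θ x * v x ^ 2) :=
      (hθ.gradSq.mul_right (hv.pow 2)).integrable
    rw [← integral_const_mul, ← integral_const_mul,
      ← integral_add (i1.const_mul 2) (i2.const_mul 2)]
    refine integral_mono (hθ.mul_right hv).gradSq.integrable
      ((i1.const_mul 2).add (i2.const_mul 2)) fun x => ?_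
    simp only [gradSq, Finset.mul_sum, Finset.sum_mul]
    rw [← Finset.sum_add_distrib]
    refine Finset.sum_le_sum fun j _ => ?_
    rw [pd_mul j (hθ.differentiable x) (hdv x)]
    nlinarith [sq_nonneg (θ x * pd j v x - pd j θ x * v x)]
  rw [energy]
  -- 8 = 2 · 4 and 22 = 2 · 10 + 2, from Caccioppoli's constants and the product rule.
  have b5 : ∫ x, gradSq (fun x => θ x * v x) x ≤ (8 + 22 * (n * (A / 8) ^ 2 * C)) * I := by
    linarith
  calc (16 * r) ^ 2 * (∫ x, gradSq (fun x => θ x * v x) x) + ∫ x, (θ x * v x) ^ 2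
      ≤ (16 * r) ^ 2 * ((8 + 22 * (n * (A / 8) ^ 2 * C)) * I) + C * r ^ 2 * I := by gcongr
    _ = _ := by ring

/-- `L` is the limit of the truncated pairings `⟨∂_i Δ⁻¹(χ_R Q), φ⟩`. -/
def IsPairing {n : ℕ} (Q : Distr n) (i : Fin n) (φ : Test n ℝ) (L : ℂ) : Prop :=
  ∀ χ : Test n ℝ, (∀ᶠ x in 𝓝 0, χ x = 1) →
    Tendsto (fun R => truncPairing Q χ R i φ) atTop (𝓝 L)

/-- The near part is estimated by the local bound for Q and the energy of the cut-off potential, the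
tail by the geometric series. Cauchy–Schwarz for ∫ |φ| gives both the same power of r. -/
theorem LocalBound.exists_isPairing {n : ℕ} (hn : 2 ≤ n) {p C : ℝ} (hp : 0 < p) {Q : Distr n}
    (hQ : LocalBound p Q C) (i : Fin n) :
    ∃ C' : ℝ, 0 ≤ C' ∧ ∀ (x₀ : Rn n) (r : ℝ) (φ : Test n ℝ), 0 < r →
      tsupport φ ⊆ closedBall x₀ r → (1 / 2 < p ∨ ∫ x, φ x = 0) →
        ∃ L, IsPairing Q i φ L ∧
          ‖L‖ ≤ C' * r ^ ((n : ℝ) / 2 + 1 - 2 * p) * √(∫ x, φ x ^ 2) := by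
  obtain ⟨C₁, hC₁, H₁⟩ := exists_decayAway_gradInvLap i
  obtain ⟨C₂, hC₂, H₂⟩ := exists_energy_cutoff_mul_gradInvLap_le hn
  have hn1 : 1 ≤ n := by omega
  have hC := hQ.1
  have hV := unitVol_pos n
  have far : ∃ C₃ : ℝ, 0 ≤ C₃ ∧ ∀ (x₀ : Rn n) (r : ℝ) (φ : Test n ℝ) (hr : 0 < r),
      tsupport φ ⊆ closedBall x₀ r → (1 / 2 < p ∨ ∫ x, φ x = 0) →
        ∃ L, IsPairing Q i φ L ∧
          ‖L + Q (mkTest (fun x => cutoff x₀ (8 * r) x * gradInvLap i φ x)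
          ((isTest_cutoff (by positivity)).mul_right (contDiff_gradInvLap i (isTest_coe φ))))‖ ≤
          C₃ * (r ^ (1 - 2 * p) * ∫ x, |φ x|) := by
    have key : ∀ b : ℕ, 1 ≤ b → (b : ℝ) - (n + 1 - 2 * p) > 0 →
        ∃ C₃ : ℝ, 0 ≤ C₃ ∧ ∀ (x₀ : Rn n) (r D : ℝ) (φ : Test n ℝ) (hr : 0 < r), 0 ≤ D →
          DecayAway b x₀ r D (gradInvLap i φ) →
        ∃ L, IsPairing Q i φ L ∧
          ‖L + Q (mkTest (fun x => cutoff x₀ (8 * r) x * gradInvLap i φ x)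
          ((isTest_cutoff (by positivity)).mul_right (contDiff_gradInvLap i (isTest_coe φ))))‖ ≤
          C₃ * D * r ^ (n + 1 - 2 * p - b) := by
      intro b hb hκ
      obtain ⟨C₃, hC₃, H₃⟩ := hQ.exists_limit hn1 hb hκ rfl
      refine ⟨C₃, hC₃, fun x₀ r D φ hr hD hdec => ?_⟩
      obtain ⟨L, h1, h2⟩ := H₃ x₀ r D _ (contDiff_gradInvLap i (isTest_coe φ)) hr hD hdec
      refine ⟨-L, fun χ hχ => (h1 χ (isTest_coe χ) hχ).neg, ?_⟩
      rw [neg_sub] at h2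
      rwa [neg_add_eq_sub, norm_sub_rev]
    -- The series converges if b > n + 1 - 2p. Decay of order b = n suffices exactly for p > 1/2;
    -- order b = n + 1, available for mean zero, suffices for every p > 0.
    by_cases hp2 : 1 / 2 < p
    · obtain ⟨C₃, hC₃, H₃⟩ := key n hn1 (by linarith)
      refine ⟨C₃ * C₁, by positivity, fun x₀ r φ hr hs _ => ?_⟩
      have hI : 0 ≤ ∫ y, |φ y| := integral_nonneg fun _ => abs_nonneg _
      obtain ⟨L, h1, h2⟩ := H₃ x₀ r _ φ hr (by positivity) (H₁ x₀ r φ hr (isTest_coe φ) hs).1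
      refine ⟨L, h1, h2.trans_eq ?_⟩
      rw [show (n : ℝ) + 1 - 2 * p - n = 1 - 2 * p by ring]
      ring
    · obtain ⟨C₃, hC₃, H₃⟩ := key (n + 1) (by omega) (by push_cast; linarith)
      refine ⟨C₃ * C₁, by positivity, fun x₀ r φ hr hs h0 => ?_⟩
      have hI : 0 ≤ ∫ y, |φ y| := integral_nonneg fun _ => abs_nonneg _
      obtain ⟨L, h1, h2⟩ := H₃ x₀ r _ φ hr (by positivity)
        ((H₁ x₀ r φ hr (isTest_coe φ) hs).2 (h0.resolve_left hp2))
      refine ⟨L, h1, h2.trans_eq ?_⟩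
      rw [show (n : ℝ) + 1 - 2 * p - (n + 1 : ℕ) = -(2 * p) by push_cast; ring,
        show 1 - 2 * p = -(2 * p) + 1 by ring, Real.rpow_add_one hr.ne']
      ring
  obtain ⟨C₃, hC₃, H₃⟩ := far
  refine ⟨C₃ * (2 * √(unitVol n)) + C * 16 ^ ((n : ℝ) / 2 - 2 * p) * √C₂, by positivity,
    fun x₀ r φ hr hs h0 => ?_⟩
  obtain ⟨L, h1, h2⟩ := H₃ x₀ r φ hr hs h0
  refine ⟨L, h1, ?_⟩
  have hφ := isTest_coe φ
  have hT : IsTest (fun x => cutoff x₀ (8 * r) x * gradInvLap i φ x) :=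
    (isTest_cutoff (by positivity)).mul_right (contDiff_gradInvLap i hφ)
  have h3 := hQ.2 x₀ (16 * r) (by positivity) _ hT (by
    refine tsupport_mul_subset_left.trans ((tsupport_cutoff_subset (by positivity)).trans ?_)
    exact closedBall_subset_closedBall (by linarith))
  have h4 := integral_abs_le_sqrt hn1 hφ hr hs
  set N := √(∫ x, φ x ^ 2) with hN
  have h5 : √(energy (16 * r) fun x => cutoff x₀ (8 * r) x * gradInvLap i φ x) ≤ √C₂ * r * N := by
    refine (Real.sqrt_le_sqrt (H₂ i x₀ r φ hr hφ hs)).trans_eq ?_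
    rw [Real.sqrt_mul (by positivity), Real.sqrt_mul hC₂, Real.sqrt_sq hr.le]
  have e1 : r ^ ((n : ℝ) / 2 + 1 - 2 * p) = r ^ ((n : ℝ) / 2) * r ^ (1 - 2 * p) := by
    rw [← Real.rpow_add hr]; congr 1; ring
  have e2 : (16 * r) ^ ((n : ℝ) / 2 - 2 * p) * r =
      16 ^ ((n : ℝ) / 2 - 2 * p) * r ^ ((n : ℝ) / 2 + 1 - 2 * p) := by
    rw [Real.mul_rpow (by norm_num) hr.le, mul_assoc, ← Real.rpow_add_one hr.ne']
    congr 2; ring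
  have h6 : ‖L‖ ≤ ‖L + Q (mkTest _ hT)‖ + ‖Q (mkTest _ hT)‖ := by
    simpa using norm_sub_le (L + Q (mkTest _ hT)) (Q (mkTest _ hT))
  refine h6.trans ((add_le_add h2 h3).trans ?_)
  calc C₃ * (r ^ (1 - 2 * p) * ∫ x, |φ x|) + C * (16 * r) ^ ((n : ℝ) / 2 - 2 * p) *
        √(energy (16 * r) fun x => cutoff x₀ (8 * r) x * gradInvLap i φ x)
      ≤ C₃ * (r ^ (1 - 2 * p) * (2 * √(unitVol n) * r ^ ((n : ℝ) / 2) * N)) +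
        C * (16 * r) ^ ((n : ℝ) / 2 - 2 * p) * (√C₂ * r * N) := by gcongr
    _ = C₃ * (2 * √(unitVol n)) * (r ^ ((n : ℝ) / 2) * r ^ (1 - 2 * p)) * N +
        C * √C₂ * ((16 * r) ^ ((n : ℝ) / 2 - 2 * p) * r) * N := by ring
    _ = _ := by rw [e2, ← e1]; ring

end

noncomputable section

/-! ### Representation of functionals bounded in `L²` -/

open scoped ENNReal

/-- The bound forces l to vanish on the kernel of ι, so l descends to the range. Hahn–Banach extends
it to H with the same norm, and Riesz represents it. Neither injectivity nor density of ι is needed.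
-/
theorem exists_inner_eq_of_abs_le {W H : Type*} [AddCommGroup W] [Module ℝ W]
    [NormedAddCommGroup H] [InnerProductSpace ℝ H] [CompleteSpace H] (ι : W →ₗ[ℝ] H)
    (l : W →ₗ[ℝ] ℝ) {B : ℝ} (hB : 0 ≤ B) (h : ∀ w, |l w| ≤ B * ‖ι w‖) :
    ∃ f : H, ‖f‖ ≤ B ∧ ∀ w, l w = inner ℝ f (ι w) := by
  obtain ⟨s, hs⟩ := ι.rangeRestrict.exists_rightInverse_of_surjective ι.range_rangeRestrict
  have hs' : ∀ y : LinearMap.range ι, ι (s y) = y := fun y =>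
    congrArg Subtype.val (LinearMap.congr_fun hs y)
  set m : StrongDual ℝ (LinearMap.range ι) := (l.comp s).mkContinuous B fun y => by
    have := h (s y)
    rwa [hs'] at this
  obtain ⟨F, hF, hFn⟩ := exists_extension_norm_eq _ m
  refine ⟨(InnerProductSpace.toDual ℝ H).symm F, ?_, fun w => ?_⟩
  · rw [LinearIsometryEquiv.norm_map, hFn]
    exact LinearMap.mkContinuous_norm_le _ hB _
  · rw [InnerProductSpace.toDual_symm_apply]
    have h1 : F (ι w) = l (s (ι.rangeRestrict w)) := hF (ι.rangeRestrict w)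
    -- The argument lies in the kernel of ι, so the value of l does not depend on the chosen
    -- section.
    have h2 := h (w - s (ι.rangeRestrict w))
    have h0 : ((ι.rangeRestrict w : LinearMap.range ι) : H) = ι w := rfl
    rw [map_sub ι, hs', h0, sub_self, norm_zero, mul_zero] at h2
    have h3 := abs_nonpos_iff.1 h2
    rw [map_sub, sub_eq_zero] at h3
    rw [h1, h3]

theorem IsTest.memLp {n : ℕ} {φ : Rn n → ℝ} (hφ : IsTest φ) : MemLp φ 2 volume :=
  hφ.continuous.memLp_of_hasCompactSupport hφ.2

/-- Test functions as elements of `L²`. -/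
def testToL2 (n : ℕ) : Test n ℝ →ₗ[ℝ] Lp ℝ 2 (volume : Measure (Rn n)) where
  toFun φ := (isTest_coe φ).memLp.toLp φ
  map_add' _ _ := rfl
  map_smul' _ _ := rfl

theorem inner_testToL2 {n : ℕ} (f : Lp ℝ 2 (volume : Measure (Rn n))) (φ : Test n ℝ) :
    inner ℝ f (testToL2 n φ) = ∫ x, f x * φ x := by
  rw [L2.inner_def]
  refine integral_congr_ae ?_
  filter_upwards [(isTest_coe φ).memLp.coeFn_toLp] with x hx
  change inner ℝ (f x) ((isTest_coe φ).memLp.toLp φ x) = _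
  rw [hx]
  simp [mul_comm]

theorem norm_L2_eq {n : ℕ} (f : Lp ℝ 2 (volume : Measure (Rn n))) : ‖f‖ ^ 2 = ∫ x, f x ^ 2 := by
  rw [← real_inner_self_eq_norm_sq, L2.inner_def]
  simp [pow_two]

theorem norm_testToL2 {n : ℕ} (φ : Test n ℝ) : ‖testToL2 n φ‖ = √(∫ x, φ x ^ 2) := by
  rw [← Real.sqrt_sq (norm_nonneg _), norm_L2_eq]
  congr 1
  refine integral_congr_ae ?_
  filter_upwards [(isTest_coe φ).memLp.coeFn_toLp] with x hx
  change (isTest_coe φ).memLp.toLp φ x ^ 2 = _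
  rw [hx]

theorem exists_memLp_of_abs_le {n : ℕ} (l : Test n ℝ →ₗ[ℝ] ℝ) (W : Submodule ℝ (Test n ℝ)) {B : ℝ}
    (hB : 0 ≤ B) (h : ∀ φ ∈ W, |l φ| ≤ B * √(∫ x, φ x ^ 2)) :
    ∃ f : Rn n → ℝ, MemLp f 2 volume ∧ ∫ x, f x ^ 2 ≤ B ^ 2 ∧
      ∀ φ ∈ W, l φ = ∫ x, f x * φ x := by
  obtain ⟨f, hf, hl⟩ := exists_inner_eq_of_abs_le ((testToL2 n).comp W.subtype) (l.comp W.subtype) hB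
    (fun w => by
      have := h w w.2
      rwa [← norm_testToL2] at this)
  refine ⟨f, Lp.memLp f, ?_, fun φ hφ => ?_⟩
  · rw [← norm_L2_eq]
    gcongr
  · rw [← inner_testToL2]
    exact hl ⟨φ, hφ⟩

/-- Test functions supported in a closed ball. -/
def supportedIn {n : ℕ} (x₀ : Rn n) (r : ℝ) : Submodule ℝ (Test n ℝ) where
  carrier := {φ | ∀ x ∉ closedBall x₀ r, φ x = 0}
  add_mem' {φ ψ} hφ hψ x hx := by
    change φ x + ψ x = 0
    rw [hφ x hx, hψ x hx, add_zero]
  zero_mem' _ _ := rfl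
  smul_mem' c φ hφ x hx := by
    change c * φ x = 0
    rw [hφ x hx, mul_zero]

theorem mem_supportedIn_iff {n : ℕ} {x₀ : Rn n} {r : ℝ} {φ : Test n ℝ} :
    φ ∈ supportedIn x₀ r ↔ tsupport φ ⊆ closedBall x₀ r := by
  constructor
  · intro h
    refine closure_minimal (fun x hx => ?_) isClosed_closedBall
    by_contra hx'
    exact hx (h x hx')
  · exact fun h x hx => image_eq_zero_of_notMem_tsupport fun hmem => hx (h hmem)

/-- The integral, as a linear functional on test functions. -/
def testIntegral (n : ℕ) : Test n ℝ →ₗ[ℝ] ℝ where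
  toFun φ := ∫ x, φ x
  map_add' φ ψ := integral_add (isTest_coe φ).integrable (isTest_coe ψ).integrable
  map_smul' c _ := integral_const_mul c _

theorem exists_test_integral_eq_one {n : ℕ} (x₀ : Rn n) {r : ℝ} (hr : 0 < r) :
    ∃ ψ : Test n ℝ, tsupport ψ ⊆ ball x₀ r ∧ testIntegral n ψ = 1 := by
  let f : ContDiffBump x₀ := ⟨r / 4, r / 2, by positivity, by linarith⟩
  refine ⟨mkTest (f.normed volume) ⟨f.contDiff_normed, f.hasCompactSupport_normed⟩, ?_,
    f.integral_normed⟩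
  change tsupport (f.normed volume) ⊆ _
  rw [f.tsupport_normed_eq]
  exact closedBall_subset_ball (by change r / 2 < r; linarith)

theorem integrable_mul_test {n : ℕ} {g : Rn n → ℝ} (hg : LocallyIntegrable g) (φ : Test n ℝ) :
    Integrable fun x => g x * φ x :=
  hg.integrable_smul_right_of_hasCompactSupport (isTest_coe φ).continuous (isTest_coe φ).2

theorem ae_eq_on_ball_of_integral_eq {n : ℕ} {f g : Rn n → ℝ} (hf : LocallyIntegrable f)
    (hg : LocallyIntegrable g) {x₀ : Rn n} {r : ℝ}
    (h : ∀ φ : Test n ℝ, tsupport φ ⊆ ball x₀ r → ∫ x, f x * φ x = ∫ x, g x * φ x) :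
    ∀ᵐ x, x ∈ ball x₀ r → f x = g x := by
  have := isOpen_ball.ae_eq_zero_of_integral_contDiff_smul_eq_zero (μ := volume)
    (f := fun x => f x - g x) (U := ball x₀ r) ((hf.sub hg).locallyIntegrableOn _)
    (fun φ h1 h2 h3 => ?_)
  · filter_upwards [this] with x hx hx'
    exact sub_eq_zero.1 (hx hx')
  · have h4 := h (mkTest φ ⟨h1, h2⟩) h3
    have e : ∀ x, φ x • (f x - g x) = f x * φ x - g x * φ x := fun x => by
      rw [smul_eq_mul]; ring
    simp only [e]
    rw [integral_sub (f := fun x => f x * φ x) (g := fun x => g x * φ x) (integrable_mul_test hf (mkTest φ ⟨h1, h2⟩))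
      (integrable_mul_test hg (mkTest φ ⟨h1, h2⟩)), sub_eq_zero]
    exact h4


/-- The representing functions on the balls of radius k agree almost everywhere on overlaps and can
be glued. -/
theorem exists_memLp_locally_of_abs_le {n : ℕ} (l : Test n ℝ →ₗ[ℝ] ℝ)
    (h : ∀ k : ℕ, ∃ B, 0 ≤ B ∧ ∀ φ ∈ supportedIn (0 : Rn n) k, |l φ| ≤ B * √(∫ x, φ x ^ 2)) :
    ∃ g : Rn n → ℝ, (∀ K : Set (Rn n), IsCompact K → MemLp g 2 (volume.restrict K)) ∧
      ∀ φ, l φ = ∫ x, g x * φ x := by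
  choose B hB hl using h
  choose f hf _ hfl using fun k : ℕ => exists_memLp_of_abs_le l (supportedIn 0 k) (hB k) (hl k)
  have hloc : ∀ k, LocallyIntegrable (f k) := fun k =>
    locallyIntegrable_of_memLp fun K _ => (hf k).restrict K
  have hae : ∀ j k : ℕ, ∀ᵐ x, x ∈ ball (0 : Rn n) (min (j : ℝ) k) → f j x = f k x := by
    intro j k
    refine ae_eq_on_ball_of_integral_eq (hloc j) (hloc k) fun φ hφ => ?_
    rw [← hfl j φ, ← hfl k φ]
    · exact mem_supportedIn_iff.2 (hφ.trans
        (ball_subset_closedBall.trans (closedBall_subset_closedBall (min_le_right _ _))))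
    · exact mem_supportedIn_iff.2 (hφ.trans
        (ball_subset_closedBall.trans (closedBall_subset_closedBall (min_le_left _ _))))
  -- The index is chosen so that x lies in the open ball of that radius.
  set g : Rn n → ℝ := fun x => f (⌊‖x‖⌋₊ + 1) x with hg
  have hgk : ∀ k : ℕ, ∀ᵐ x, x ∈ ball (0 : Rn n) k → f k x = g x := by
    intro k
    filter_upwards [ae_all_iff.2 fun j => hae k j] with x hx hxk
    refine hx _ ?_
    rw [mem_ball_zero_iff] at hxk ⊢
    refine lt_min hxk ?_
    push_cast
    exact Nat.lt_floor_add_one _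
  have hK : ∀ K : Set (Rn n), IsCompact K → ∃ k : ℕ, K ⊆ ball 0 k := by
    intro K hK
    obtain ⟨M, hM⟩ := hK.isBounded.subset_ball 0
    obtain ⟨k, hk⟩ := exists_nat_ge M
    exact ⟨k, hM.trans (ball_subset_ball hk)⟩
  refine ⟨g, fun K hKc => ?_, fun φ => ?_⟩
  · obtain ⟨k, hk⟩ := hK K hKc
    refine ((hf k).restrict K).ae_eq ?_
    rw [Filter.EventuallyEq, ae_restrict_iff' hKc.measurableSet]
    filter_upwards [hgk k] with x hx hxK
    exact hx (hk hxK)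
  · obtain ⟨k, hk⟩ := hK _ (isTest_coe φ).2.isCompact
    rw [hfl k φ (mem_supportedIn_iff.2 (hk.trans ball_subset_closedBall))]
    refine integral_congr_ae ?_
    filter_upwards [hgk k] with x hx
    by_cases hxk : x ∈ tsupport φ
    · rw [hx (hk hxk)]
    · rw [image_eq_zero_of_notMem_tsupport hxk, mul_zero, mul_zero]

theorem integral_mul_sub_smul {n : ℕ} {f : Rn n → ℝ} (hf : LocallyIntegrable f) (φ ψ : Test n ℝ)
    (a : ℝ) : ∫ x, f x * (φ - a • ψ) x = (∫ x, f x * φ x) - a * ∫ x, f x * ψ x := by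
  rw [← integral_const_mul, ← integral_sub (integrable_mul_test hf φ)
    ((integrable_mul_test hf ψ).const_mul a)]
  congr 1; ext x
  change f x * (φ x - a * ψ x) = _
  ring

theorem setIntegral_sq_le_of_ae_eq {n : ℕ} {f g : Rn n → ℝ} {x₀ : Rn n} {r B : ℝ}
    (hf : MemLp f 2 volume) (hB : ∫ x, f x ^ 2 ≤ B)
    (h : ∀ᵐ x, x ∈ ball x₀ r → g x = f x) : ∫ x in ball x₀ r, g x ^ 2 ≤ B := by
  refine le_trans ?_ hB
  have e : ∫ x in ball x₀ r, g x ^ 2 = ∫ x in ball x₀ r, f x ^ 2 := by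
    refine setIntegral_congr_ae measurableSet_ball ?_
    filter_upwards [h] with x hx hx'
    rw [hx hx']
  rw [e]
  exact setIntegral_le_integral hf.integrable_sq (Eventually.of_forall fun _ => sq_nonneg _)

/-- L² duality: test functions supported in the ball determine g there, and the representing
function of the restricted functional has norm at most B. -/
theorem setIntegral_sq_le_of_abs_le {n : ℕ} {l : Test n ℝ →ₗ[ℝ] ℝ} {g : Rn n → ℝ}
    (hg : LocallyIntegrable g) (hl : ∀ φ, l φ = ∫ x, g x * φ x) {x₀ : Rn n} {r B : ℝ} (hB : 0 ≤ B)
    (h : ∀ φ ∈ supportedIn x₀ r, |l φ| ≤ B * √(∫ x, φ x ^ 2)) :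
    ∫ x in ball x₀ r, g x ^ 2 ≤ B ^ 2 := by
  obtain ⟨f, hf, hfB, hfl⟩ := exists_memLp_of_abs_le l (supportedIn x₀ r) hB h
  refine setIntegral_sq_le_of_ae_eq hf hfB ?_
  refine ae_eq_on_ball_of_integral_eq hg
    (locallyIntegrable_of_memLp fun K _ => hf.restrict K) fun φ hφ => ?_
  rw [← hl, ← hfl φ (mem_supportedIn_iff.2 (hφ.trans ball_subset_closedBall))]

/-- Mean-zero test functions determine g only up to a constant. The constant is found by testing
with one function ψ of integral one. -/
theorem exists_setIntegral_sub_sq_le_of_abs_le {n : ℕ} {l : Test n ℝ →ₗ[ℝ] ℝ} {g : Rn n → ℝ}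
    (hg : LocallyIntegrable g) (hl : ∀ φ, l φ = ∫ x, g x * φ x) {x₀ : Rn n} {r B : ℝ} (hr : 0 < r)
    (hB : 0 ≤ B)
    (h : ∀ φ ∈ supportedIn x₀ r, testIntegral n φ = 0 → |l φ| ≤ B * √(∫ x, φ x ^ 2)) :
    ∃ c, ∫ x in ball x₀ r, (g x - c) ^ 2 ≤ B ^ 2 := by
  obtain ⟨f, hf, hfB, hfl⟩ := exists_memLp_of_abs_le l
    (supportedIn x₀ r ⊓ LinearMap.ker (testIntegral n)) hB fun φ hφ => h φ hφ.1 hφ.2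
  have hfloc : LocallyIntegrable f := locallyIntegrable_of_memLp fun K _ => hf.restrict K
  obtain ⟨ψ, hψs, hψ⟩ := exists_test_integral_eq_one x₀ hr
  have hψm : ψ ∈ supportedIn x₀ r := mem_supportedIn_iff.2 (hψs.trans ball_subset_closedBall)
  set c := l ψ - ∫ x, f x * ψ x with hc
  refine ⟨c, setIntegral_sq_le_of_ae_eq (g := fun x => g x - c) hf hfB ?_⟩
  refine ae_eq_on_ball_of_integral_eq (hg.sub (locallyIntegrable_const c)) hfloc fun φ hφ => ?_
  have hφm : φ ∈ supportedIn x₀ r := mem_supportedIn_iff.2 (hφ.trans ball_subset_closedBall)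
  have h1 := hfl (φ - testIntegral n φ • ψ) ⟨sub_mem hφm (Submodule.smul_mem _ _ hψm), by
    change testIntegral n (φ - testIntegral n φ • ψ) = 0
    rw [map_sub, map_smul, hψ, smul_eq_mul, mul_one, sub_self]⟩
  rw [map_sub, map_smul, integral_mul_sub_smul hfloc, smul_eq_mul] at h1
  have h2 : ∫ x, (g x - c) * φ x = l φ - c * testIntegral n φ := by
    simp only [sub_mul]
    rw [integral_sub (integrable_mul_test hg φ) ((isTest_coe φ).integrable.const_mul c), hl,
      integral_const_mul]
    rfl
  change ∫ x, (g x - c) * φ x = _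
  rw [h2, hc]
  linarith

end

noncomputable section

/-! ### Campanato's characterization of Hölder functions -/

open scoped ENNReal

/-- McShane's extension by an infimum; it applies because ‖x - y‖^α satisfies the triangle
inequality for α ≤ 1. -/
theorem exists_holder_extension {X : Type*} [SeminormedAddCommGroup X] {E : Set X} (hE : E.Nonempty)
    {g : X → ℝ} {K α : ℝ} (hK : 0 ≤ K) (hα : 0 < α) (hα1 : α ≤ 1)
    (h : ∀ x ∈ E, ∀ y ∈ E, |g x - g y| ≤ K * ‖x - y‖ ^ α) :
    ∃ f : X → ℝ, (∀ x ∈ E, f x = g x) ∧ ∀ x y, |f x - f y| ≤ K * ‖x - y‖ ^ α := by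
  have hsub : ∀ x y z : X, K * ‖x - z‖ ^ α ≤ K * ‖x - y‖ ^ α + K * ‖y - z‖ ^ α := by
    intro x y z
    rw [← mul_add]
    gcongr
    refine (Real.rpow_le_rpow (norm_nonneg _) (norm_sub_le_norm_sub_add_norm_sub x y z) hα.le).trans ?_
    exact Real.rpow_add_le_add_rpow (norm_nonneg _) (norm_nonneg _) hα.le hα1
  have : Nonempty E := hE.to_subtype
  have hlow : ∀ x, ∀ y₀ ∈ E, ∀ y : E, g y₀ - K * ‖x - y₀‖ ^ α ≤ g y + K * ‖x - (y : X)‖ ^ α := by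
    intro x y₀ hy₀ y
    have h1 := (abs_le.1 (h y y.2 y₀ hy₀)).1
    have h2 := hsub y x y₀
    rw [norm_sub_rev (y : X) x] at h2
    linarith
  have hbdd : ∀ x, BddBelow (Set.range fun y : E => g y + K * ‖x - (y : X)‖ ^ α) := by
    intro x
    obtain ⟨y₀, hy₀⟩ := hE
    exact ⟨_, by rintro _ ⟨y, rfl⟩; exact hlow x y₀ hy₀ y⟩
  refine ⟨fun x => ⨅ y : E, (g y + K * ‖x - (y : X)‖ ^ α), fun x hx => ?_, ?_⟩
  · refine le_antisymm ?_ ?_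
    · refine (ciInf_le (hbdd x) ⟨x, hx⟩).trans_eq ?_
      simp [Real.zero_rpow hα.ne']
    · refine le_ciInf fun y => ?_
      have := hlow x x hx y
      simpa [Real.zero_rpow hα.ne'] using this
  · have key : ∀ x y, (⨅ z : E, (g z + K * ‖x - (z : X)‖ ^ α)) - K * ‖x - y‖ ^ α ≤
        ⨅ z : E, (g z + K * ‖y - (z : X)‖ ^ α) := by
      intro x y
      refine le_ciInf fun z => ?_
      have h1 := ciInf_le (hbdd x) z
      have h2 := hsub x y z
      linarith
    intro x y
    have h1 := key x y
    have h2 := key y x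
    rw [norm_sub_rev y x] at h2
    rw [abs_le]
    constructor <;> linarith

/-- Averages over successively halved balls change by a geometric sequence, of ratio 2^(-α), so at
points where averages converge g is within const · ρ^α of its average at scale ρ. For ρ = |x - y|,
compare g(x), the average on B(x, ρ), the average on B(y, 2ρ) and g(y). This covers a set of full
measure, and the extension lemma does the rest. -/
theorem exists_holder_of_campanato {n : ℕ} (hn : 1 ≤ n) {g : Rn n → ℝ} {M α : ℝ} (hM : 0 ≤ M)
    (hα : 0 < α) (hα1 : α ≤ 1) (hg : LocallyIntegrable g)
    (hg2 : LocallyIntegrable (fun x => g x ^ 2))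
    (hc : ∀ x r, 0 < r → ∃ c, ∫ y in ball x r, (g y - c) ^ 2 ≤ M * r ^ ((n : ℝ) + 2 * α)) :
    ∃ f : Rn n → ℝ, f =ᵐ[volume] g ∧ ∃ C, ∀ x y, |f x - f y| ≤ C * ‖x - y‖ ^ α := by
  set a : Rn n → ℝ → ℝ := fun x r => ⨍ y in ball x r, g y with ha
  have hc' : ∀ x r, 0 < r → ∫ y in ball x r, (g y - a x r) ^ 2 ≤ M * r ^ ((n : ℝ) + 2 * α) := by
    intro x r hr
    obtain ⟨c, hc⟩ := hc x r hr
    exact (setIntegral_sq_sub_average_le hr (integrableOn_ball_of_locallyIntegrable hg x r)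
      (integrableOn_ball_of_locallyIntegrable hg2 x r) c).trans hc
  have hV := unitVol_pos n
  set D := (unitVol n)⁻¹ * (unitVol n + M) * 2 ^ n with hD
  have hD0 : 0 ≤ D := by positivity
  have hstep : ∀ {x y : Rn n} {r : ℝ}, 0 < r → ball x r ⊆ ball y (2 * r) →
      |a x r - a y (2 * r)| ≤ D * (2 * r) ^ α := fun hr hsub =>
    abs_sub_le_of_ball_subset hn hM hα.le hg hg2 hc' hr hsub
  set q : ℝ := (1 / 2) ^ α with hq
  have hq0 : 0 < q := by positivity
  have hq1 : q < 1 := Real.rpow_lt_one (by norm_num) (by norm_num) hα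
  have h1q : 0 < 1 - q := by linarith
  set E : Set (Rn n) := {x | Tendsto (fun r => a x r) (𝓝[>] 0) (𝓝 (g x))} with hE
  have hEae : ∀ᵐ x, x ∈ E := ae_tendsto_ball_average hn hg
  have hdist : ∀ x ∈ E, ∀ ρ : ℝ, 0 < ρ → |a x ρ - g x| ≤ D * ρ ^ α / (1 - q) := by
    intro x hx ρ hρ
    have hu : ∀ k : ℕ, dist (a x (ρ * (1 / 2) ^ k)) (a x (ρ * (1 / 2) ^ (k + 1))) ≤
        D * ρ ^ α * q ^ k := by
      intro k
      have h1 := hstep (x := x) (y := x) (r := ρ * (1 / 2) ^ (k + 1)) (by positivity)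
        (ball_subset_ball (by have : 0 < ρ * (1 / 2) ^ (k + 1) := by positivity
                              linarith))
      have e : 2 * (ρ * (1 / 2) ^ (k + 1)) = ρ * (1 / 2) ^ k := by rw [pow_succ]; ring
      have e' : ((1 / 2 : ℝ) ^ k) ^ α = q ^ k := by
        rw [hq, ← Real.rpow_natCast, ← Real.rpow_natCast, ← Real.rpow_mul (by norm_num),
          ← Real.rpow_mul (by norm_num), mul_comm]
      rw [e, Real.mul_rpow hρ.le (by positivity), e'] at h1
      rw [dist_comm, Real.dist_eq]
      linarith
    have hlim : Tendsto (fun k : ℕ => a x (ρ * (1 / 2) ^ k)) atTop (𝓝 (g x)) := by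
      refine Tendsto.comp hx (tendsto_nhdsWithin_iff.2 ⟨?_, Eventually.of_forall fun k => ?_⟩)
      · simpa using (tendsto_pow_atTop_nhds_zero_of_lt_one (r := (1 / 2 : ℝ)) (by norm_num)
          (by norm_num)).const_mul ρ
      · exact Set.mem_Ioi.2 (by positivity)
    have h2 := dist_le_of_le_geometric_of_tendsto₀ q _ hq1 hu hlim
    simpa [Real.dist_eq] using h2
  set K := D / (1 - q) + D * 2 ^ α + D * 2 ^ α / (1 - q) with hK
  have hEne : E.Nonempty := hEae.exists
  have hEg : ∀ x ∈ E, ∀ y ∈ E, |g x - g y| ≤ K * ‖x - y‖ ^ α := by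
    intro x hx y hy
    rcases eq_or_ne x y with rfl | hxy
    · simp [Real.zero_rpow hα.ne']
    have hρ : 0 < ‖x - y‖ := norm_pos_iff.2 (sub_ne_zero.2 hxy)
    set ρ := ‖x - y‖ with hρ'
    have h1 := hdist x hx ρ hρ
    have h2 := hdist y hy (2 * ρ) (by positivity)
    have h3 := hstep (x := x) (y := y) hρ (ball_subset_ball' (by rw [dist_eq_norm]; linarith))
    rw [Real.mul_rpow (by norm_num) hρ.le] at h2 h3
    have e : K * ρ ^ α = D * ρ ^ α / (1 - q) + D * (2 ^ α * ρ ^ α) + D * (2 ^ α * ρ ^ α) / (1 - q) := by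
      rw [hK]; ring
    rw [e]
    rw [abs_le] at h1 h2 h3 ⊢
    constructor <;> linarith [h1.1, h1.2, h2.1, h2.2, h3.1, h3.2]
  obtain ⟨f, hf1, hf2⟩ := exists_holder_extension hEne (by positivity) hα hα1 hEg
  refine ⟨f, ?_, K, hf2⟩
  filter_upwards [hEae] with x hx
  exact hf1 x hx

end

noncomputable section

/-! ### The limit functionals -/

open scoped ENNReal

theorem truncPairing_add_smul {n : ℕ} (Q : Distr n) (χ : Test n ℝ) (R : Set.Ioi (0 : ℝ)) (i : Fin n)
    (a : ℝ) (φ ψ : Test n ℝ) :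
    truncPairing Q χ R i (a • φ + ψ) = a • truncPairing Q χ R i φ + truncPairing Q χ R i ψ := by
  have h : cutGradInvLapTest χ R i (a • φ + ψ) =
      a • cutGradInvLapTest χ R i φ + cutGradInvLapTest χ R i ψ := by
    ext x
    change χ ((R : ℝ)⁻¹ • x) * gradInvLap i (a • φ + ψ : Test n ℝ) x =
      a * (χ ((R : ℝ)⁻¹ • x) * gradInvLap i φ x) + χ ((R : ℝ)⁻¹ • x) * gradInvLap i ψ x
    have e : gradInvLap i (a • φ + ψ : Test n ℝ) x = a * gradInvLap i φ x + gradInvLap i ψ x := by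
      rw [gradInvLap_apply', gradInvLap_apply', gradInvLap_apply', ← integral_const_mul,
        ← integral_add ((integrable_gradKernel_sub_mul i (isTest_coe φ) x).const_mul a)
          (integrable_gradKernel_sub_mul i (isTest_coe ψ) x)]
      congr 1; ext y
      change gradKernel i (x - y) * (a * φ y + ψ y) = _
      ring
    rw [e]; ring
  rw [truncPairing, truncPairing, truncPairing, h, map_add, map_smul, neg_add, smul_neg]

theorem isTest_unitCutoff (n : ℕ) : IsTest (cutoff (0 : Rn n) 1) := isTest_cutoff one_pos

theorem eventually_unitCutoff_eq_one (n : ℕ) :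
    ∀ᶠ x in 𝓝 (0 : Rn n), mkTest _ (isTest_unitCutoff n) x = 1 := by
  filter_upwards [closedBall_mem_nhds (0 : Rn n) one_pos] with x hx
  exact cutoff_eq_one one_pos hx

theorem IsPairing.unique {n : ℕ} {Q : Distr n} {i : Fin n} {φ : Test n ℝ} {L L' : ℂ}
    (h : IsPairing Q i φ L) (h' : IsPairing Q i φ L') : L = L' :=
  tendsto_nhds_unique (h _ (eventually_unitCutoff_eq_one n)) (h' _ (eventually_unitCutoff_eq_one n))

theorem IsPairing.smul_add {n : ℕ} {Q : Distr n} {i : Fin n} {φ ψ : Test n ℝ} {L L' : ℂ}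
    (h : IsPairing Q i φ L) (h' : IsPairing Q i ψ L') (a : ℝ) :
    IsPairing Q i (a • φ + ψ) (a • L + L') := by
  intro χ hχ
  simp only [truncPairing_add_smul]
  exact ((h χ hχ).const_smul a).add (h' χ hχ)

theorem exists_mem_supportedIn {n : ℕ} (φ : Test n ℝ) :
    ∃ r : ℝ, 0 < r ∧ φ ∈ supportedIn (0 : Rn n) r := by
  obtain ⟨M, hM⟩ := (isTest_coe φ).2.isCompact.isBounded.subset_closedBall 0
  exact ⟨|M| + 1, by positivity, mem_supportedIn_iff.2
    (hM.trans (closedBall_subset_closedBall (by linarith [le_abs_self M])))⟩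

theorem supportedIn_mono {n : ℕ} {x₀ : Rn n} {r s : ℝ} (h : r ≤ s) :
    supportedIn x₀ r ≤ supportedIn x₀ s :=
  fun _ hφ x hx => hφ x fun hmem => hx (closedBall_subset_closedBall h hmem)

/-- A linear projection onto the test functions for which the limit pairings exist. -/
theorem exists_test_projection {n : ℕ} (hn : 1 ≤ n) (P₀ : Prop) :
    ∃ P : Test n ℝ →ₗ[ℝ] Test n ℝ, (∀ φ, P₀ ∨ testIntegral n (P φ) = 0) ∧
      (∀ φ, (P₀ ∨ testIntegral n φ = 0) → P φ = φ) ∧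
      ∀ k : ℕ, ∃ r B : ℝ, 0 < r ∧ 0 ≤ B ∧ ∀ φ ∈ supportedIn (0 : Rn n) k,
        P φ ∈ supportedIn (0 : Rn n) r ∧ √(∫ x, P φ x ^ 2) ≤ B * √(∫ x, φ x ^ 2) := by
  by_cases h : P₀
  · refine ⟨LinearMap.id, fun _ => Or.inl h, fun _ _ => rfl, fun k => ⟨k + 1, 1, by positivity,
      zero_le_one, fun φ hφ => ⟨supportedIn_mono (by linarith) hφ, ?_⟩⟩⟩
    rw [one_mul]; rfl
  obtain ⟨ψ, hψs, hψ⟩ := exists_test_integral_eq_one (0 : Rn n) one_pos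
  have hψm : ψ ∈ supportedIn (0 : Rn n) 1 := mem_supportedIn_iff.2 (hψs.trans ball_subset_closedBall)
  -- φ ↦ φ - (∫ φ) ψ projects onto mean-zero functions. The arbitrary choice of ψ reflects that the
  -- field is determined only modulo constants.
  refine ⟨LinearMap.id - (testIntegral n).smulRight ψ, fun φ => Or.inr ?_, fun φ hφ => ?_,
    fun k => ?_⟩
  · change testIntegral n (φ - testIntegral n φ • ψ) = 0
    rw [map_sub, map_smul, hψ, smul_eq_mul, mul_one, sub_self]
  · change φ - testIntegral n φ • ψ = φ
    rw [hφ.resolve_left h, zero_smul, sub_zero]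
  · have hk : (0 : ℝ) < k + 1 := by positivity
    refine ⟨k + 1, 1 + 2 * √(unitVol n) * ((k : ℝ) + 1) ^ ((n : ℝ) / 2) * ‖testToL2 n ψ‖, hk,
      by positivity, fun φ hφ => ?_⟩
    have hφ1 : φ ∈ supportedIn (0 : Rn n) (k + 1) := supportedIn_mono (by linarith) hφ
    refine ⟨sub_mem hφ1 (Submodule.smul_mem _ _ (supportedIn_mono (by
      have : (0 : ℝ) ≤ k := Nat.cast_nonneg k
      linarith) hψm)), ?_⟩
    change √(∫ x, (φ - testIntegral n φ • ψ) x ^ 2) ≤ _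
    rw [← norm_testToL2, ← norm_testToL2, map_sub, map_smul]
    refine (norm_sub_le _ _).trans ?_
    rw [norm_smul]
    have h1 : ‖testIntegral n φ‖ ≤ 2 * √(unitVol n) * ((k : ℝ) + 1) ^ ((n : ℝ) / 2) *
        ‖testToL2 n φ‖ := by
      rw [norm_testToL2]
      exact (norm_integral_le_integral_norm _).trans
        (integral_abs_le_sqrt hn (isTest_coe φ) hk (mem_supportedIn_iff.1 hφ1))
    calc ‖testToL2 n φ‖ + ‖testIntegral n φ‖ * ‖testToL2 n ψ‖
        ≤ ‖testToL2 n φ‖ + 2 * √(unitVol n) * ((k : ℝ) + 1) ^ ((n : ℝ) / 2) *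
          ‖testToL2 n φ‖ * ‖testToL2 n ψ‖ := by gcongr
      _ = _ := by ring

/-- Limits are unique, hence linear in φ; composing with the projection defines the functional on
all test functions. The final clause, without scaling, is what the representation in L²_loc needs;
the scaled bound, for admissible φ, gives the space condition. -/
theorem LocalBound.exists_limitFunctional {n : ℕ} (hn : 2 ≤ n) {p C : ℝ} (hp : 0 < p) {Q : Distr n}
    (hQ : LocalBound p Q C) (i : Fin n) :
    ∃ (l : Test n ℝ →ₗ[ℝ] ℂ) (C' : ℝ), 0 ≤ C' ∧
      (∀ φ, (1 / 2 < p ∨ testIntegral n φ = 0) → IsPairing Q i φ (l φ)) ∧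
      (∀ (x₀ : Rn n) (r : ℝ), 0 < r → ∀ φ ∈ supportedIn x₀ r,
        (1 / 2 < p ∨ testIntegral n φ = 0) →
          ‖l φ‖ ≤ C' * r ^ ((n : ℝ) / 2 + 1 - 2 * p) * √(∫ x, φ x ^ 2)) ∧
      ∀ k : ℕ, ∃ B, 0 ≤ B ∧ ∀ φ ∈ supportedIn (0 : Rn n) k, ‖l φ‖ ≤ B * √(∫ x, φ x ^ 2) := by
  obtain ⟨C', hC', H⟩ := hQ.exists_isPairing hn hp i
  obtain ⟨P, hP1, hP2, hP3⟩ := exists_test_projection (n := n) (by omega) (1 / 2 < p)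
  have hex : ∀ φ : Test n ℝ, ∃ L, IsPairing Q i (P φ) L := by
    intro φ
    obtain ⟨r, hr, hφ⟩ := exists_mem_supportedIn (P φ)
    obtain ⟨L, hL, -⟩ := H 0 r (P φ) hr (mem_supportedIn_iff.1 hφ) (hP1 φ)
    exact ⟨L, hL⟩
  choose L hL using hex
  have hlin : ∀ (a : ℝ) (φ ψ : Test n ℝ), L (a • φ + ψ) = a • L φ + L ψ := by
    intro a φ ψ
    refine (hL _).unique ?_
    rw [map_add, map_smul]
    exact (hL φ).smul_add (hL ψ) a
  have hL0 : L 0 = 0 := by simpa using hlin 1 0 0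
  let l : Test n ℝ →ₗ[ℝ] ℂ :=
    { toFun := L
      map_add' := fun φ ψ => by simpa using hlin 1 φ ψ
      map_smul' := fun a φ => by simpa [hL0] using hlin a φ 0 }
  have hbd : ∀ (x₀ : Rn n) (r : ℝ), 0 < r → ∀ φ, P φ ∈ supportedIn x₀ r →
      ‖l φ‖ ≤ C' * r ^ ((n : ℝ) / 2 + 1 - 2 * p) * √(∫ x, P φ x ^ 2) := by
    intro x₀ r hr φ hφ
    obtain ⟨L', hL', hb⟩ := H x₀ r (P φ) hr (mem_supportedIn_iff.1 hφ) (hP1 φ)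
    rwa [← (hL φ).unique hL'] at hb
  refine ⟨l, C', hC', fun φ hφ => ?_, fun x₀ r hr φ hφ h0 => ?_, fun k => ?_⟩
  · have := hL φ
    rwa [hP2 φ hφ] at this
  · have := hbd x₀ r hr φ (by rwa [hP2 φ h0])
    rwa [hP2 φ h0] at this
  · obtain ⟨r, B, hr, hB, h⟩ := hP3 k
    refine ⟨C' * r ^ ((n : ℝ) / 2 + 1 - 2 * p) * B, by positivity, fun φ hφ => ?_⟩
    obtain ⟨h1, h2⟩ := h φ hφ
    refine (hbd 0 r hr φ h1).trans ?_
    rw [mul_assoc _ B]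
    gcongr

/-- Since ∑ ∂_i Δ⁻¹ ∂_i φ = φ has compact support, the cutoff is one there for large R and the
summed pairings are eventually constant. -/
theorem sum_eq_neg_of_isPairing_pd {n : ℕ} (hn : 1 ≤ n) {Q : Distr n} (φ : Test n ℝ) {L : Fin n → ℂ}
    (hL : ∀ i, IsPairing Q i (mkTest _ ((isTest_coe φ).pd i)) (L i)) : ∑ i, L i = -Q φ := by
  have h1 := tendsto_finsetSum Finset.univ fun i _ => hL i _ (eventually_unitCutoff_eq_one n)
  refine tendsto_nhds_unique h1 (tendsto_const_nhds.congr' ?_)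
  obtain ⟨r, hr, hφ⟩ := exists_mem_supportedIn φ
  filter_upwards [eventually_ge_atTop (⟨r, hr⟩ : Set.Ioi (0 : ℝ))] with R hR
  have hR' : r ≤ (R : ℝ) := hR
  have hR0 : 0 < (R : ℝ) := R.2
  simp only [truncPairing]
  rw [Finset.sum_neg_distrib, ← map_sum]
  congr 2
  ext x
  rw [FunLike.coe_sum, Finset.sum_apply]
  change φ x = ∑ i, cutoff (0 : Rn n) 1 ((R : ℝ)⁻¹ • x) * gradInvLap i (pd i φ) x
  rw [← Finset.mul_sum, sum_gradInvLap_pd hn (isTest_coe φ)]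
  by_cases hx : x ∈ closedBall (0 : Rn n) r
  · rw [cutoff_eq_one one_pos, one_mul]
    rw [mem_closedBall_zero_iff] at hx ⊢
    rw [norm_smul, norm_inv, Real.norm_of_nonneg hR0.le, inv_mul_le_iff₀ hR0]
    linarith
  · rw [hφ x hx, mul_zero]

end

noncomputable section

/-! ### Construction of the vector field -/

open scoped ENNReal

/-- The scalar version of `SpaceCond`. -/
def ScalarSpaceCond {n : ℕ} (p : ℝ) (g : Rn n → ℝ) : Prop :=
  (p = 1 / 2 → ∃ M : ℝ, ∀ (x : Rn n) (r : ℝ), 0 < r →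
    ∃ c, ∫ y in ball x r, |g y - c| ≤ M * r ^ n) ∧
  (p < 1 / 2 → ∃ C : ℝ, ∀ x y : Rn n, |g x - g y| ≤ C * ‖x - y‖ ^ (1 - 2 * p)) ∧
  (1 / 2 < p → ∃ M : ℝ, ∀ (x : Rn n) (r : ℝ), 0 < r →
    ∫ y in ball x r, g y ^ 2 ≤ M * r ^ ((n : ℝ) + 2 - 4 * p))

/-- The square of the bound is C² r^(n + 2(1-2p)): the Morrey exponent when all φ are admissible,
the Campanato exponent with α = 1 - 2p when only mean-zero ones are. -/
theorem exists_scalarSpaceCond {n : ℕ} (hn : 1 ≤ n) {p C : ℝ} (hp : 0 < p) (hC : 0 ≤ C)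
    (l : Test n ℝ →ₗ[ℝ] ℝ)
    (hl : ∀ (x₀ : Rn n) (r : ℝ), 0 < r → ∀ φ ∈ supportedIn x₀ r,
      (1 / 2 < p ∨ testIntegral n φ = 0) →
        |l φ| ≤ C * r ^ ((n : ℝ) / 2 + 1 - 2 * p) * √(∫ x, φ x ^ 2))
    (hl' : ∀ k : ℕ, ∃ B, 0 ≤ B ∧ ∀ φ ∈ supportedIn (0 : Rn n) k, |l φ| ≤ B * √(∫ x, φ x ^ 2)) :
    ∃ g : Rn n → ℝ, (∀ K : Set (Rn n), IsCompact K → MemLp g 2 (volume.restrict K)) ∧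
      (∀ φ, l φ = ∫ x, g x * φ x) ∧ ScalarSpaceCond p g := by
  obtain ⟨g, hgK, hgl⟩ := exists_memLp_locally_of_abs_le l hl'
  have hg := locallyIntegrable_of_memLp hgK
  have hg2 := locallyIntegrable_sq_of_memLp hgK
  have hB : ∀ r : ℝ, 0 < r → 0 ≤ C * r ^ ((n : ℝ) / 2 + 1 - 2 * p) := fun r hr => by positivity
  have hpow : ∀ r : ℝ, 0 < r → (C * r ^ ((n : ℝ) / 2 + 1 - 2 * p)) ^ 2 =
      C ^ 2 * r ^ ((n : ℝ) + 2 * (1 - 2 * p)) := fun r hr => by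
    rw [mul_pow, ← Real.rpow_natCast (r ^ _), ← Real.rpow_mul hr.le]
    congr 2; push_cast; ring
  have hosc : ∀ x r, 0 < r → ∃ c, ∫ y in ball x r, (g y - c) ^ 2 ≤
      C ^ 2 * r ^ ((n : ℝ) + 2 * (1 - 2 * p)) := by
    intro x r hr
    rw [← hpow r hr]
    exact exists_setIntegral_sub_sq_le_of_abs_le hg hgl hr (hB r hr) fun φ hφ h0 =>
      hl x r hr φ hφ (Or.inr h0)
  rcases lt_trichotomy p (1 / 2) with h | h | h
  · obtain ⟨f, hfg, K, hK⟩ := exists_holder_of_campanato hn (sq_nonneg C)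
      (by linarith : 0 < 1 - 2 * p) (by linarith) hg hg2 hosc
    -- The Hölder condition is pointwise, so g is replaced by its continuous representative, which
    -- defines the same functional.
    refine ⟨f, fun S hS => (hgK S hS).ae_eq (ae_restrict_of_ae hfg.symm), fun φ => ?_,
      fun h' => absurd h' h.ne, fun _ => ⟨K, hK⟩, fun h' => absurd h' h.not_gt⟩
    rw [hgl]
    refine integral_congr_ae ?_
    filter_upwards [hfg] with x hx
    rw [hx]
  · refine ⟨g, hgK, hgl, fun _ => ⟨(unitVol n + C ^ 2) / 2, fun x r hr => ?_⟩,
      fun h' => absurd h h'.ne, fun h' => absurd h h'.ne'⟩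
    choose! c hc using hosc
    have h0 : 1 - 2 * p = 0 := by rw [h]; norm_num
    have := setIntegral_abs_sub_le hn hg hg2 hc x hr
    rw [h0, add_zero, Real.rpow_natCast] at this
    exact ⟨c x r, this⟩
  · refine ⟨g, hgK, hgl, fun h' => absurd h' h.ne', fun h' => absurd h' h.not_gt,
      fun _ => ⟨C ^ 2, fun x r hr => ?_⟩⟩
    have := setIntegral_sq_le_of_abs_le hg hgl (hB r hr) fun φ hφ => hl x r hr φ hφ (Or.inl h)
    rwa [hpow r hr, show (n : ℝ) + 2 * (1 - 2 * p) = n + 2 - 4 * p by ring] at this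

theorem norm_le_sum_abs {n : ℕ} (z : EuclideanSpace ℂ (Fin n)) :
    ‖z‖ ≤ ∑ i, (|(z i).re| + |(z i).im|) := by
  have h1 : ‖z‖ ≤ ∑ i, ‖z i‖ := by
    rw [EuclideanSpace.norm_eq]
    refine Real.sqrt_le_iff.2 ⟨Finset.sum_nonneg fun _ _ => norm_nonneg _, ?_⟩
    exact Finset.sum_sq_le_sq_sum_of_nonneg fun _ _ => norm_nonneg _
  exact h1.trans (Finset.sum_le_sum fun i _ => Complex.norm_le_abs_re_add_abs_im _)

theorem norm_sq_eq_sum {n : ℕ} (z : EuclideanSpace ℂ (Fin n)) :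
    ‖z‖ ^ 2 = ∑ i, ((z i).re ^ 2 + (z i).im ^ 2) := by
  rw [EuclideanSpace.norm_sq_eq]
  refine Finset.sum_congr rfl fun i _ => ?_
  rw [Complex.sq_norm, Complex.normSq_apply]
  ring

theorem spaceCond_of_scalar {n : ℕ} (hn : 1 ≤ n) {p : ℝ} {Γ : Rn n → EuclideanSpace ℂ (Fin n)}
    (hL : IsL2Loc Γ)
    (hre : ∀ i, ScalarSpaceCond p fun x => (Γ x i).re)
    (him : ∀ i, ScalarSpaceCond p fun x => (Γ x i).im) : SpaceCond p Γ := by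
  have hΓ : LocallyIntegrable Γ := locallyIntegrable_of_memLp hL
  have hreK : ∀ i, ∀ K : Set (Rn n), IsCompact K → MemLp (fun x => (Γ x i).re) 2 (volume.restrict K) :=
    fun i K hK => ((hL K hK).eval_piLp i).re
  have himK : ∀ i, ∀ K : Set (Rn n), IsCompact K → MemLp (fun x => (Γ x i).im) 2 (volume.restrict K) :=
    fun i K hK => ((hL K hK).eval_piLp i).im
  refine ⟨fun hp => ⟨hΓ, ?_⟩, fun hp => ?_, fun hp => ?_⟩
  · choose M hM using fun i => (hre i).1 hp
    choose N hN using fun i => (him i).1 hp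
    have hV := unitVol_pos n
    refine ⟨(unitVol n)⁻¹ * (2 * ∑ i, (M i + N i)), fun x₀ δ hδ => ?_⟩
    choose c hc using fun i => hM i x₀ δ hδ
    choose d hd using fun i => hN i x₀ δ hδ
    let a : EuclideanSpace ℂ (Fin n) := WithLp.toLp 2 fun i => ⟨c i, d i⟩
    rw [setAverage_eq, smul_eq_mul, volume_real_ball hn x₀ hδ.le]
    have i1 : ∀ i, IntegrableOn (fun y => |(Γ y i).re - c i|) (ball x₀ δ) := fun i =>
      (integrableOn_sub_const (locallyIntegrable_of_memLp (hreK i)) (c i) x₀ δ).abs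
    have i2 : ∀ i, IntegrableOn (fun y => |(Γ y i).im - d i|) (ball x₀ δ) := fun i =>
      (integrableOn_sub_const (locallyIntegrable_of_memLp (himK i)) (d i) x₀ δ).abs
    have i3 : ∀ i, IntegrableOn (fun y => |(Γ y i).re - c i| + |(Γ y i).im - d i|) (ball x₀ δ) :=
      fun i => (i1 i).add (i2 i)
    have h1 : ∫ x in ball x₀ δ, ‖Γ x - a‖ ≤ (∑ i, (M i + N i)) * δ ^ n := by
      calc ∫ x in ball x₀ δ, ‖Γ x - a‖
          ≤ ∫ x in ball x₀ δ, ∑ i, (|(Γ x i).re - c i| + |(Γ x i).im - d i|) := by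
            refine integral_mono
              ((integrableOn_ball_of_locallyIntegrable hΓ x₀ δ).sub
                (integrableOn_const measure_ball_lt_top.ne)).norm
              (integrable_finsetSum _ fun i _ => i3 i) fun x => ?_
            exact norm_le_sum_abs (Γ x - a)
        _ = ∑ i, ((∫ x in ball x₀ δ, |(Γ x i).re - c i|) +
              ∫ x in ball x₀ δ, |(Γ x i).im - d i|) := by
            rw [integral_finsetSum _ fun i _ => i3 i]
            exact Finset.sum_congr rfl fun i _ => integral_add (i1 i) (i2 i)
        _ ≤ ∑ i, (M i * δ ^ n + N i * δ ^ n) :=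
            Finset.sum_le_sum fun i _ => add_le_add (hc i) (hd i)
        _ = _ := by simp only [← add_mul, Finset.sum_mul]
    have h2 := setIntegral_norm_sub_average_le hδ
      (integrableOn_ball_of_locallyIntegrable hΓ x₀ δ) a
    rw [mul_inv, mul_assoc]
    refine mul_le_mul_of_nonneg_left ?_ (inv_nonneg.2 hV.le)
    rw [inv_mul_le_iff₀ (by positivity)]
    linarith
  · choose C hC using fun i => (hre i).2.1 hp
    choose D hD using fun i => (him i).2.1 hp
    refine ⟨∑ i, (C i + D i), fun x y => ?_⟩
    refine (norm_le_sum_abs _).trans ?_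
    rw [Finset.sum_mul]
    refine Finset.sum_le_sum fun i _ => ?_
    rw [add_mul]
    exact add_le_add (hC i x y) (hD i x y)
  · choose M hM using fun i => (hre i).2.2 hp
    choose N hN using fun i => (him i).2.2 hp
    refine ⟨∑ i, (M i + N i), fun x₀ δ hδ => ?_⟩
    have i1 : ∀ i, IntegrableOn (fun y => (Γ y i).re ^ 2) (ball x₀ δ) := fun i =>
      integrableOn_ball_of_locallyIntegrable (locallyIntegrable_sq_of_memLp (hreK i)) x₀ δ
    have i2 : ∀ i, IntegrableOn (fun y => (Γ y i).im ^ 2) (ball x₀ δ) := fun i =>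
      integrableOn_ball_of_locallyIntegrable (locallyIntegrable_sq_of_memLp (himK i)) x₀ δ
    have i3 : ∀ i, IntegrableOn (fun y => (Γ y i).re ^ 2 + (Γ y i).im ^ 2) (ball x₀ δ) :=
      fun i => (i1 i).add (i2 i)
    simp only [norm_sq_eq_sum]
    rw [integral_finsetSum _ fun i _ => i3 i, Finset.sum_mul]
    refine Finset.sum_le_sum fun i _ => ?_
    rw [add_mul, integral_add (i1 i) (i2 i)]
    exact add_le_add (hM i x₀ δ hδ) (hN i x₀ δ hδ)

/-- The components of the field represent the limit functionals, real and imaginary parts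
separately, so its relation to ∇Δ⁻¹Q holds by construction. -/
theorem exists_field_of_formBound {n : ℕ} (hn : 2 ≤ n) {p : ℝ} (hp : 0 < p) {Q : Distr n}
    (h : FormBound p Q) :
    ∃ Γ : Rn n → EuclideanSpace ℂ (Fin n), IsL2Loc Γ ∧
        IsGradInvLapModConst Q Γ ∧ (1 / 2 < p → IsGradInvLap Q Γ) ∧
        IsDiv Q Γ ∧ SpaceCond p Γ := by
  have hn1 : 1 ≤ n := by omega
  obtain ⟨C, hQ⟩ := exists_localBound hn1 h
  choose l C' hC' hpair hbd hloc using fun i => hQ.exists_limitFunctional hn hp i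
  choose g hgK hgl hgS using fun i => exists_scalarSpaceCond hn1 hp (hC' i)
    (Complex.reLm.comp (l i))
    (fun x₀ r hr φ hφ h0 => (Complex.abs_re_le_norm _).trans (hbd i x₀ r hr φ hφ h0))
    (fun k => by
      obtain ⟨B, hB, H⟩ := hloc i k
      exact ⟨B, hB, fun φ hφ => (Complex.abs_re_le_norm _).trans (H φ hφ)⟩)
  choose f hfK hfl hfS using fun i => exists_scalarSpaceCond hn1 hp (hC' i)
    (Complex.imLm.comp (l i))
    (fun x₀ r hr φ hφ h0 => (Complex.abs_im_le_norm _).trans (hbd i x₀ r hr φ hφ h0))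
    (fun k => by
      obtain ⟨B, hB, H⟩ := hloc i k
      exact ⟨B, hB, fun φ hφ => (Complex.abs_im_le_norm _).trans (H φ hφ)⟩)
  let Γ : Rn n → EuclideanSpace ℂ (Fin n) := fun x => WithLp.toLp 2 fun i => ⟨g i x, f i x⟩
  have hL : IsL2Loc Γ := fun K hK => MemLp.of_eval_piLp fun i =>
    memLp_re_im_iff.1 ⟨hgK i K hK, hfK i K hK⟩
  have hΓloc : ∀ i, LocallyIntegrable fun x => Γ x i := fun i =>
    locallyIntegrable_of_memLp fun K hK => (hL K hK).eval_piLp i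
  have hΓ : ∀ i (φ : Test n ℝ), ∫ x, Γ x i * (φ x : ℂ) = l i φ := by
    intro i φ
    have hint := integrable_mul_ofReal_test (hΓloc i) (isTest_coe φ)
    apply Complex.ext
    · rw [← Complex.reCLM_apply, ← Complex.reCLM.integral_comp_comm hint]
      refine Eq.trans ?_ (hgl i φ).symm
      congr 1; ext x
      simp [Γ]
    · rw [← Complex.imCLM_apply, ← Complex.imCLM.integral_comp_comm hint]
      refine Eq.trans ?_ (hfl i φ).symm
      congr 1; ext x
      simp [Γ]
  refine ⟨Γ, hL, fun χ hχ i φ h0 => ?_, fun hp2 χ hχ i φ => ?_, fun φ => ?_,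
    spaceCond_of_scalar hn1 hL hgS hfS⟩
  · rw [hΓ]
    exact hpair i φ (Or.inr h0) χ hχ
  · rw [hΓ]
    exact hpair i φ (Or.inl hp2) χ hχ
  · have hφ := isTest_coe φ
    change Q φ = -∫ x, ∑ i, Γ x i * (pd i φ x : ℂ)
    rw [integral_finsetSum _ fun i _ => integrable_mul_ofReal_test (hΓloc i) (hφ.pd i)]
    -- Partial derivatives of φ have integral zero, so here the functionals are true limits also for
    -- p ≤ 1/2.
    have h1 := sum_eq_neg_of_isPairing_pd hn1 φ (L := fun i => l i (mkTest _ (hφ.pd i)))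
      fun i => hpair i _ (Or.inr (integral_pd_eq_zero i hφ))
    rw [← neg_eq_iff_eq_neg.2 h1]
    congr 1
    exact Finset.sum_congr rfl fun i _ => (hΓ i _).symm

end

/-! ### The characterisation. -/

theorem theoremV (n : ℕ) (hn : 2 ≤ n) (p : ℝ) (hp0 : 0 < p) (hp1 : p < 1) (Q : Distr n) :
    (MultIneq p Q ↔
      ∃ Γ : Rn n → EuclideanSpace ℂ (Fin n), IsL2Loc Γ ∧
        IsGradInvLapModConst Q Γ ∧ (1 / 2 < p → IsGradInvLap Q Γ) ∧
        IsDiv Q Γ ∧ SpaceCond p Γ) ∧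
    (∀ Γ : Rn n → EuclideanSpace ℂ (Fin n),
      IsL2Loc Γ → IsDiv Q Γ → SpaceCond p Γ → MultIneq p Q) := by
  have hsuff : ∀ Γ : Rn n → EuclideanSpace ℂ (Fin n),
      IsL2Loc Γ → IsDiv Q Γ → SpaceCond p Γ → MultIneq p Q := fun Γ hL hdiv hΓ =>
    multIneq_of_formBound hp0 hp1 (formBound_of_isDiv hn hp1 hL hdiv hΓ)
  refine ⟨⟨fun h => exists_field_of_formBound hn hp0 (formBound_of_multIneq hp0 hp1 h), ?_⟩, hsuff⟩
  rintro ⟨Γ, hL, -, -, hdiv, hΓ⟩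
  exact hsuff Γ hL hdiv hΓ
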